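/- Let $\mathbb D$ be the open unit disc and $\mathbb T$ the unit circle. Let $H^\infty_{\rm r}(\mathbb D)$ be the space of functions $f$ on $\operatorname{clos}\mathbb D$ such that $f|\mathbb D$ is bounded and holomorphic and $\lim_{r\to1^-}f(r\zeta)=f(\zeta)$ for every $\zeta\in\mathbb T$. Let $H^\infty_{\rm r}(\mathbb D^2)$ be the space of functions $\Phi$ on $(\operatorname{clos}\mathbb D)^2$ such that $\Phi|\mathbb D^2$ is bounded and holomorphic and $\lim_{r\to1^-}\Phi(rz,w)=\lim_{r\to1^-}\Phi(z,rw)=\Phi(z,w)$ for all $z,w\in\operatorname{clos}\mathbb D$. For Borel spectral measures $E_1,E_2$ on $\mathbb T$ with values in the orthogonal projections of a Hilbert space $\mathscr H$, and a bounded Borel function $\Phi$ on $\mathbb T^2$, put $\iint\Phi\,dE_1Q\,dE_2=\left(\int_{\mathbb T^2}\Phi\,dE\right)Q$ for Hilbert--Schmidt operators $Q$ on $\mathscr H$, where $E$ is the spectral measure on the Hilbert--Schmidt class with $E(\Lambda\times\Delta)Q=E_1(\Lambda)QE_2(\Delta)$ for Borel sets $\Lambda,\Delta\subset\mathbb T$.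 The function $\Phi$ is a Schur multiplier with respect to $E_1,E_2$ if the transformer $Q\mapsto\iint\Phi\,dE_1Q\,dE_2$ maps the trace class $\boldsymbol S_1$ into itself; $\|\Phi\|_{\mathfrak M_{E_1,E_2}}$ is the norm of this transformer on $\boldsymbol S_1$. Let $\mathfrak M(\mathbb T^2)$ be the class of Borel Schur multipliers, that is, of the functions on $\mathbb T^2$ that are Schur multipliers with respect to all such $\mathscr H,E_1,E_2$, with norm $\|\Phi\|_{\mathfrak M(\mathbb T^2)}=\sup\|\Phi\|_{\mathfrak M_{E_1,E_2}}$, the supremum over all such $\mathscr H,E_1,E_2$. Let $\mathfrak M_{\rm A}(\mathbb D^2)$ be the class of analytic Schur multipliers, that is, of the functions $\Phi\in H^\infty_{\rm r}(\mathbb D^2)$ with $\Phi|\mathbb T^2\in\mathfrak M(\mathbb T^2)$, and put $\|\Phi\|_{\mathfrak M_{\rm A}(\mathbb D^2)}=\|\Phi|\mathbb T^2\|_{\mathfrak M(\mathbb T^2)}$. Let $H^\infty_{\rm r}(\mathbb D)\otimes_{\rm h}H^\infty_{\rm r}(\mathbb D)$ be the Haagerup tensor product, that is, the class of functions $\Phi(z,w)=\sum_{n\ge0}\varphi_n(z)\psi_n(w)$,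 $z,w\in\operatorname{clos}\mathbb D$, with $\varphi_n,\psi_n\in H^\infty_{\rm r}(\mathbb D)$ and with $\sum_n|\varphi_n|^2$ and $\sum_n|\psi_n|^2$ bounded on $\operatorname{clos}\mathbb D$; the norm of $\Phi$ is the infimum of $\sup_{z}\big(\sum_n|\varphi_n(z)|^2\big)^{1/2}\cdot\sup_{w}\big(\sum_n|\psi_n(w)|^2\big)^{1/2}$ over all such representations. **Theorem.** $$\mathfrak M_{\rm A}(\mathbb D^2)=H^\infty_{\rm r}(\mathbb D)\otimes_{\rm h}H^\infty_{\rm r}(\mathbb D),$$ and $\|\Phi\|_{H^\infty_{\rm r}(\mathbb D)\otimes_{\rm h}H^\infty_{\rm r}(\mathbb D)}=\|\Phi\|_{\mathfrak M_{\rm A}(\mathbb D^2)}$ for all $\Phi\in\mathfrak M_{\rm A}(\mathbb D^2)$. -/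

import Mathlib

open Filter Topology MeasureTheory
open scoped ENNReal

universe u

noncomputable section

/-! ### Function spaces on the closed disc and the closed bidisc -/

/-- The closed unit disc. -/
abbrev ClosedDisc : Type := Metric.closedBall (0 : ℂ) 1

/-- The unit circle, with its Borel sigma-algebra. -/
abbrev UnitCircle : Type := Metric.sphere (0 : ℂ) 1

/-- The inclusion of the unit circle in the closed unit disc. -/
def circleToDisc (ζ : UnitCircle) : ClosedDisc :=
  ⟨ζ.1, Metric.sphere_subset_closedBall ζ.2⟩

/-- Extension by zero of a function on the closed disc. It is only ever evaluated, or looked at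
near, points of the closed disc. -/
def discExt (f : ClosedDisc → ℂ) : ℂ → ℂ :=
  Function.extend (fun z : ClosedDisc => (z : ℂ)) f 0

/-- Extension by zero of a function on the closed bidisc. -/
def bidiscExt (Φ : ClosedDisc × ClosedDisc → ℂ) : ℂ × ℂ → ℂ :=
  Function.extend (fun p : ClosedDisc × ClosedDisc => ((p.1 : ℂ), (p.2 : ℂ))) Φ 0

/-- `H^∞_r(𝔻)`: functions on the closed disc that are bounded and holomorphic in the open disc and
whose value at every point of the circle is the radial limit at that point. -/
def HInfRDisc : Set (ClosedDisc → ℂ) :=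
  {f | DifferentiableOn ℂ (discExt f) (Metric.ball 0 1) ∧
    (∃ C : ℝ, ∀ z ∈ Metric.ball (0 : ℂ) 1, ‖discExt f z‖ ≤ C) ∧
    ∀ ζ : UnitCircle,
      Tendsto (fun r : ℝ => discExt f ((r : ℂ) * (ζ : ℂ))) (𝓝[<] 1) (𝓝 (f (circleToDisc ζ)))}

/-- `H^∞_r(𝔻²)`: functions on the closed bidisc that are bounded and holomorphic in the open bidisc
and are radially continuous in each variable separately, at every point of the closed bidisc. -/
def HInfRBidisc : Set (ClosedDisc × ClosedDisc → ℂ) :=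
  {Φ | DifferentiableOn ℂ (bidiscExt Φ) (Metric.ball 0 1 ×ˢ Metric.ball 0 1) ∧
    (∃ C : ℝ, ∀ p ∈ Metric.ball (0 : ℂ) 1 ×ˢ Metric.ball (0 : ℂ) 1, ‖bidiscExt Φ p‖ ≤ C) ∧
    ∀ z w : ClosedDisc,
      Tendsto (fun r : ℝ => bidiscExt Φ ((r : ℂ) * (z : ℂ), (w : ℂ))) (𝓝[<] 1) (𝓝 (Φ (z, w))) ∧
      Tendsto (fun r : ℝ => bidiscExt Φ ((z : ℂ), (r : ℂ) * (w : ℂ))) (𝓝[<] 1) (𝓝 (Φ (z, w)))}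

/-- The restriction of a function on the closed bidisc to the torus. -/
def torusRestriction (Φ : ClosedDisc × ClosedDisc → ℂ) : UnitCircle × UnitCircle → ℂ :=
  fun p => Φ (circleToDisc p.1, circleToDisc p.2)

/-! ### The Haagerup tensor product of two spaces of bounded functions -/

/-- The supremum norm of `(∑ |φ n|²)^(1/2)`, possibly infinite. -/
def squareFunctionNorm {α : Type*} (φ : ℕ → α → ℂ) : ℝ≥0∞ :=
  ⨆ x, (∑' n, ‖φ n x‖ₑ ^ 2) ^ (1 / 2 : ℝ)

/-- `Φ (x, y) = ∑ φ n x * ψ n y` everywhere, with `φ n ∈ X`, `ψ n ∈ Y` and both functions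
`∑ |φ n|²` and `∑ |ψ n|²` bounded. -/
structure IsHaagerupRep {α β : Type*} (X : Set (α → ℂ)) (Y : Set (β → ℂ)) (Φ : α × β → ℂ)
    (φ : ℕ → α → ℂ) (ψ : ℕ → β → ℂ) : Prop where
  left_mem : ∀ n, φ n ∈ X
  right_mem : ∀ n, ψ n ∈ Y
  hasSum : ∀ x y, HasSum (fun n => φ n x * ψ n y) (Φ (x, y))
  left_bdd : squareFunctionNorm φ < ∞
  right_bdd : squareFunctionNorm ψ < ∞

/-- The Haagerup tensor product `X ⊗_h Y`, as a set of functions on the product. -/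
def haagerup {α β : Type*} (X : Set (α → ℂ)) (Y : Set (β → ℂ)) : Set (α × β → ℂ) :=
  {Φ | ∃ φ ψ, IsHaagerupRep X Y Φ φ ψ}

/-- The norm in `X ⊗_h Y` (infinite outside of `X ⊗_h Y`). -/
def haagerupNorm {α β : Type*} (X : Set (α → ℂ)) (Y : Set (β → ℂ)) (Φ : α × β → ℂ) : ℝ≥0∞ :=
  ⨅ (φ : ℕ → α → ℂ) (ψ : ℕ → β → ℂ) (_ : IsHaagerupRep X Y Φ φ ψ),
    squareFunctionNorm φ * squareFunctionNorm ψ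

/-! ### Spectral measures and spectral integrals -/

/-- A spectral measure on a measurable space `X`: a strongly countably additive function on the
measurable sets, whose values are orthogonal projections on `K` and which is `1` on the whole
space. -/
structure SpectralMeasure (X : Type*) [MeasurableSpace X] (K : Type*) [NormedAddCommGroup K]
    [InnerProductSpace ℂ K] where
  proj : Set X → K →L[ℂ] K
  idem : ∀ s, MeasurableSet s → ∀ x, proj s (proj s x) = proj s x
  symm : ∀ s, MeasurableSet s → ∀ x y, inner ℂ (proj s x) y = inner ℂ x (proj s y)
  univ : proj Set.univ = 1
  iUnion : ∀ s : ℕ → Set X, (∀ n, MeasurableSet (s n)) → Pairwise (Function.onFun Disjoint s) →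
    ∀ x, HasSum (fun n => proj (s n) x) (proj (⋃ n, s n) x)

namespace SpectralMeasure

variable {X : Type*} [MeasurableSpace X] {K : Type*} [NormedAddCommGroup K] [InnerProductSpace ℂ K]

theorem proj_empty (E : SpectralMeasure X K) (x : K) : E.proj ∅ x = 0 := by
  have h := E.iUnion (fun _ => ∅) (fun _ => MeasurableSet.empty)
    (fun _ _ _ => disjoint_bot_left) x
  exact (summable_const_iff _).1 h.summable

theorem re_inner_nonneg (E : SpectralMeasure X K) {s : Set X} (hs : MeasurableSet s) (x : K) :
    0 ≤ (inner ℂ x (E.proj s x)).re := by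
  rw [← E.idem s hs x, ← E.symm s hs]
  exact inner_self_nonneg (𝕜 := ℂ)

/-- The finite positive measure `s ↦ (E(s) x, x)`. -/
def scalarMeasure (E : SpectralMeasure X K) (x : K) : Measure X :=
  Measure.ofMeasurable (fun s _ => ENNReal.ofReal (inner ℂ x (E.proj s x)).re)
    (by simp [E.proj_empty])
    (by
      intro s hs hd
      have h := ((E.iUnion s hs hd x).mapL (innerSL ℂ x)).mapL Complex.reCLM
      simp only [innerSL_apply_apply, Complex.reCLM_apply] at h
      rw [← h.tsum_eq, ENNReal.ofReal_tsum_of_nonneg (fun n => E.re_inner_nonneg (hs n) x)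
        h.summable])

/-- `T = ∫ f dE`: the bounded operator `T` whose quadratic form is given by the integrals of `f`
with respect to the measures `(E(·) x, x)`. -/
def IsIntegral (E : SpectralMeasure X K) (f : X → ℂ) (T : K →L[ℂ] K) : Prop :=
  ∀ x, inner ℂ x (T x) = ∫ t, f t ∂(E.scalarMeasure x)

end SpectralMeasure

/-! ### The Hilbert-Schmidt class and the trace class -/

section Operators

variable (H : Type*) [NormedAddCommGroup H] [InnerProductSpace ℂ H] [CompleteSpace H]

/-- The index set of an orthonormal basis of `H`. -/
def basisIndex : Set H := (exists_hilbertBasis ℂ H).choose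

/-- An orthonormal basis of `H`. The Hilbert-Schmidt class and its inner product, defined with
the help of it, do not depend on the choice. -/
def hBasis : HilbertBasis (basisIndex H) ℂ H := (exists_hilbertBasis ℂ H).choose_spec.choose

/-- The Hilbert-Schmidt operators on `H`, as a subspace of the bounded operators. -/
def hsSubmodule : Submodule ℂ (H →L[ℂ] H) where
  carrier := {Q | Memℓp (fun i => Q (hBasis H i)) 2}
  zero_mem' := (zero_memℓp : Memℓp (0 : basisIndex H → H) 2)
  add_mem' := fun hP hQ => hP.add hQ
  smul_mem' := fun c _ hQ => hQ.const_smul c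

/-- The membership condition says that `∑ ‖Q eᵢ‖²` is finite. -/
theorem mem_hsSubmodule_iff (Q : H →L[ℂ] H) :
    Q ∈ hsSubmodule H ↔ Summable fun i => ‖Q (hBasis H i)‖ ^ 2 := by
  change Memℓp _ 2 ↔ _
  rw [memℓp_gen_iff (by simp)]
  simp

/-- The Hilbert-Schmidt class `S₂` of `H`. It is a type of its own because its norm is not the
operator norm. -/
def HilbertSchmidt : Type _ := hsSubmodule H

namespace HilbertSchmidt

instance : AddCommGroup (HilbertSchmidt H) := inferInstanceAs (AddCommGroup (hsSubmodule H))

instance : Module ℂ (HilbertSchmidt H) := inferInstanceAs (Module ℂ (hsSubmodule H))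

variable {H}

/-- The underlying bounded operator. -/
def toCLM (Q : HilbertSchmidt H) : H →L[ℂ] H := Subtype.val (p := (· ∈ hsSubmodule H)) Q

variable (H) in
/-- The linear map `Q ↦ (Q eᵢ)ᵢ` from the Hilbert-Schmidt class to the Hilbert sum. -/
def toL2 : HilbertSchmidt H →ₗ[ℂ] lp (fun _ : basisIndex H => H) 2 where
  toFun Q := ⟨fun i => Q.toCLM (hBasis H i), Q.2⟩
  map_add' _ _ := rfl
  map_smul' _ _ := rfl

theorem toL2_injective : Function.Injective (toL2 H) := by
  intro P Q h
  apply Subtype.ext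
  apply ContinuousLinearMap.ext_on (s := Set.range (hBasis H))
  · rw [dense_iff_closure_eq, ← Submodule.topologicalClosure_coe, (hBasis H).dense_span]
    rfl
  · rintro _ ⟨i, rfl⟩
    exact congrFun (congrArg Subtype.val h) i

instance : NormedAddCommGroup (HilbertSchmidt H) :=
  NormedAddCommGroup.induced _ _ (toL2 H) toL2_injective

/-- The inner product of the Hilbert-Schmidt class. -/
instance : InnerProductSpace ℂ (HilbertSchmidt H) := InnerProductSpace.induced (toL2 H)

/-- The inner product is `∑ (P eᵢ, Q eᵢ)`. -/
theorem inner_eq_tsum (P Q : HilbertSchmidt H) :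
    inner ℂ P Q = ∑' i, inner ℂ (P.toCLM (hBasis H i)) (Q.toCLM (hBasis H i)) :=
  lp.inner_eq_tsum _ _

end HilbertSchmidt

variable {H}

/-- The trace norm (nuclear norm) of a bounded operator: the infimum of `∑ ‖u k‖ ‖v k‖` over the
representations `T = ∑ (·, v k) u k`. It is infinite if `T` is not of trace class. -/
def traceNorm (T : H →L[ℂ] H) : ℝ≥0∞ :=
  ⨅ (a : ℕ → H) (b : ℕ → H) (_ : ∀ x, HasSum (fun k => inner ℂ (b k) x • a k) (T x)),
    ∑' k, ‖a k‖ₑ * ‖b k‖ₑ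

/-- `T` belongs to the trace class `S₁`. -/
def IsTraceClass (T : H →L[ℂ] H) : Prop := traceNorm T < ∞

/-! ### Double operator integrals and Schur multipliers -/

variable {X Y : Type*} [MeasurableSpace X] [MeasurableSpace Y]

/-- `E` is the spectral measure on the Hilbert-Schmidt class with
`E(Λ × Δ) Q = E₁(Λ) Q E₂(Δ)` on measurable rectangles. -/
def IsProductSpectralMeasure (E₁ : SpectralMeasure X H) (E₂ : SpectralMeasure Y H)
    (E : SpectralMeasure (X × Y) (HilbertSchmidt H)) : Prop :=
  ∀ s t, MeasurableSet s → MeasurableSet t → ∀ Q : HilbertSchmidt H,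
    (E.proj (s ×ˢ t) Q).toCLM = E₁.proj s ∘L Q.toCLM ∘L E₂.proj t

/-- `T = ∬ Φ dE₁ Q dE₂` for a Hilbert-Schmidt operator `Q`, that is `T = (∫ Φ dE) Q`, where `E` is
the spectral measure with `E(Λ × Δ) Q = E₁(Λ) Q E₂(Δ)`. -/
def IsDoubleOperatorIntegral (E₁ : SpectralMeasure X H) (E₂ : SpectralMeasure Y H)
    (Φ : X × Y → ℂ) (Q T : HilbertSchmidt H) : Prop :=
  ∃ E : SpectralMeasure (X × Y) (HilbertSchmidt H), IsProductSpectralMeasure E₁ E₂ E ∧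
    ∃ J : HilbertSchmidt H →L[ℂ] HilbertSchmidt H, E.IsIntegral Φ J ∧ T = J Q

/-- The bounded measurable function `Φ` is a Schur multiplier (of `S₁`) with respect to the
spectral measures `E₁` and `E₂`: the transformer `Q ↦ ∬ Φ dE₁ Q dE₂` maps `S₁` to `S₁`. (Trace
class operators are Hilbert-Schmidt, so that it suffices to let `Q` range over `S₂`.) -/
def IsSchurMultiplier (E₁ : SpectralMeasure X H) (E₂ : SpectralMeasure Y H)
    (Φ : X × Y → ℂ) : Prop :=
  Measurable Φ ∧ (∃ C : ℝ, ∀ p, ‖Φ p‖ ≤ C) ∧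
    ∀ Q : HilbertSchmidt H, IsTraceClass Q.toCLM →
      ∃ T : HilbertSchmidt H, IsDoubleOperatorIntegral E₁ E₂ Φ Q T ∧ IsTraceClass T.toCLM

/-- The norm of the transformer `Q ↦ ∬ Φ dE₁ Q dE₂` on `S₁`. -/
def schurNorm (E₁ : SpectralMeasure X H) (E₂ : SpectralMeasure Y H) (Φ : X × Y → ℂ) : ℝ≥0∞ :=
  ⨆ (Q : HilbertSchmidt H) (T : HilbertSchmidt H) (_ : traceNorm Q.toCLM ≤ 1)
    (_ : IsDoubleOperatorIntegral E₁ E₂ Φ Q T), traceNorm T.toCLM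

end Operators

/-- The Borel Schur multipliers on the torus: the functions that are Schur multipliers with respect
to arbitrary Borel spectral measures on the circle, on arbitrary Hilbert spaces. -/
def borelSchurMultipliers : Set (UnitCircle × UnitCircle → ℂ) :=
  {Φ | ∀ (H : Type u) [NormedAddCommGroup H] [InnerProductSpace ℂ H] [CompleteSpace H]
    (E₁ E₂ : SpectralMeasure UnitCircle H), IsSchurMultiplier E₁ E₂ Φ}

/-- The norm of a Borel Schur multiplier: the supremum of its norms with respect to all pairs of
Borel spectral measures. -/
def borelSchurNorm (Φ : UnitCircle × UnitCircle → ℂ) : ℝ≥0∞ :=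
  ⨆ (H : Type u) (_ : NormedAddCommGroup H) (_ : InnerProductSpace ℂ H) (_ : CompleteSpace H)
    (E₁ : SpectralMeasure UnitCircle H) (E₂ : SpectralMeasure UnitCircle H), schurNorm E₁ E₂ Φ

/-- The analytic Schur multipliers on the bidisc. -/
def analyticSchurMultipliers : Set (ClosedDisc × ClosedDisc → ℂ) :=
  {Φ | Φ ∈ HInfRBidisc ∧ torusRestriction Φ ∈ borelSchurMultipliers.{u}}

/-- The norm of an analytic Schur multiplier: the norm of its restriction to the torus in the space
of Borel Schur multipliers. -/
def analyticSchurNorm (Φ : ClosedDisc × ClosedDisc → ℂ) : ℝ≥0∞ :=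
  borelSchurNorm.{u} (torusRestriction Φ)

end

/-! Easy inclusion. Let `Φ = ∑ φₙ ⊗ ψₙ`, with square functions bounded by `M` and `N`, and put `Aₙ =
∫ φₙ dE₁`, `Bₙ = ∫ ψₙ dE₂`. Then `∬ Φ dE₁ Q dE₂ = ∑ Aₙ Q Bₙ` weakly. Since `∑ ‖Aₙ a‖² = ∫ ∑ |φₙ|²
d(E₁ a, a) ≤ M² ‖a‖²`, and likewise for the adjoints of the `Bₙ`, Cauchy-Schwarz in `n` bounds the
trace norm of the result by `M N` times that of `Q` (`traceNorm_integral_le`). The product spectral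
measure must exist for this (`exists_isProductSpectralMeasure`): on a rank one operator its
quadratic form is a product of two scalar measures, and rank one operators are total in the
Hilbert-Schmidt class. Joint holomorphy of `Φ` and its separate radial limits are
`IsHaagerupRep.mem_HInfRBidisc`.

Hard inclusion. For spectral measures with a basis of eigenvectors indexed by the points of the
circle, the transformer is entrywise multiplication by the matrix `Φ (s, t)`; its action on rank one
operators gives nuclear estimates for all finite sections (`nuclearLE_of_schurNorm_lt`,
`exists_nuclearLE`). By Hahn-Banach a finite section is the off-diagonal block of a positive
semidefinite matrix with diagonal at most `D` (`exists_posSemidef_of_finite`). A compactness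
argument yields one such kernel for the whole circle, and a positive semidefinite kernel is a Gram
matrix, so `Φ (s, t) = (x s, y t)` with `‖x s‖², ‖y t‖² ≤ D` (`NuclearLE.exists_inner`).

Nothing is known about the regularity of `x` and `y`, but their pairings are slices of `Φ`. Weak
barycenters with respect to representing measures extend the factorization to the closed bidisc
(`HInfRBidisc.exists_extension`). Expanding the inner product in an orthonormal basis of a suitable
separable subspace then gives coordinate functions in `H^∞_r` (`HInfRBidisc.exists_isHaagerupRep`).
As `D` is any number above the multiplier norm, the norms agree. -/

/-! ### Quadratic forms of bounded operators -/

section QuadraticForms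

variable {K : Type*} [NormedAddCommGroup K] [InnerProductSpace ℂ K]

/-- Over the complex numbers an operator is determined by its quadratic form. Integrals against a
spectral measure are specified by quadratic forms only, so existence, uniqueness and limits all
reduce to this identity. -/
theorem inner_polarization (T : K →L[ℂ] K) (x y : K) :
    inner ℂ x (T y) = (inner ℂ (x + y) (T (x + y)) - inner ℂ (x - y) (T (x - y)) -
      Complex.I * inner ℂ (x + Complex.I • y) (T (x + Complex.I • y)) +
      Complex.I * inner ℂ (x - Complex.I • y) (T (x - Complex.I • y))) / 4 := by
  simp only [map_add, map_sub, map_smul, inner_add_left, inner_add_right, inner_sub_left,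
    inner_sub_right, inner_smul_left, inner_smul_right, Complex.conj_I]
  ring_nf
  simp only [Complex.I_sq]
  ring

theorem ContinuousLinearMap.ext_quadraticForm {S T : K →L[ℂ] K}
    (h : ∀ x, inner ℂ x (S x) = inner ℂ x (T x)) : S = T := by
  ext y
  refine ext_inner_left ℂ fun x => ?_
  rw [inner_polarization S, inner_polarization T]
  simp only [h]

theorem tendsto_inner_of_quadraticForm {ι : Type*} {l : Filter ι} {T : ι → K →L[ℂ] K}
    {S : K →L[ℂ] K}
    (h : ∀ x, Tendsto (fun n => inner ℂ x (T n x)) l (𝓝 (inner ℂ x (S x)))) (x y : K) :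
    Tendsto (fun n => inner ℂ x (T n y)) l (𝓝 (inner ℂ x (S y))) := by
  rw [inner_polarization S x y]
  simp only [fun n => inner_polarization (T n) x y]
  exact ((((h _).sub (h _)).sub ((h _).const_mul _)).add ((h _).const_mul _)).div_const _

/-- Polarization and the parallelogram law give the bound `C (‖x‖² + ‖y‖²)`; homogeneity turns it
into a product. The factor 2 is harmless, as only boundedness of the limiting form is needed. -/
theorem norm_le_of_quadraticForm {T : K →L[ℂ] K} {C : ℝ}
    (h : ∀ x, ‖inner ℂ x (T x)‖ ≤ C * ‖x‖ ^ 2) (x y : K) :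
    ‖inner ℂ x (T y)‖ ≤ 2 * C * ‖x‖ * ‖y‖ := by
  have key : ∀ x y : K, ‖inner ℂ x (T y)‖ ≤ C * (‖x‖ ^ 2 + ‖y‖ ^ 2) := by
    intro x y
    rw [inner_polarization T x y, norm_div]
    have h4 : ‖(4 : ℂ)‖ = 4 := by norm_num
    rw [h4, div_le_iff₀ (by norm_num)]
    have par := fun z w : K => parallelogram_law_with_norm ℂ z w
    have e1 := par x y
    have e2 := par x (Complex.I • y)
    have e3 : ‖Complex.I • y‖ = ‖y‖ := by simp [norm_smul]
    rw [e3] at e2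
    have n1 := h (x + y)
    have n2 := h (x - y)
    have n3 := h (x + Complex.I • y)
    have n4 := h (x - Complex.I • y)
    refine (norm_add_le _ _).trans ?_
    refine (add_le_add (norm_sub_le _ _) le_rfl).trans ?_
    refine (add_le_add (add_le_add (norm_sub_le _ _) le_rfl) le_rfl).trans ?_
    simp only [norm_mul, Complex.norm_I, one_mul]
    calc _ ≤ C * ‖x + y‖ ^ 2 + C * ‖x - y‖ ^ 2 + C * ‖x + Complex.I • y‖ ^ 2
          + C * ‖x - Complex.I • y‖ ^ 2 := by gcongr
      _ = _ := by linear_combination C * e1 + C * e2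
  rcases eq_or_ne x 0 with rfl | hx
  · simp
  rcases eq_or_ne y 0 with rfl | hy
  · simp
  have hx' : (0 : ℝ) < ‖x‖ := norm_pos_iff.2 hx
  have hy' : (0 : ℝ) < ‖y‖ := norm_pos_iff.2 hy
  -- Normalizing both vectors makes `‖x‖² + ‖y‖²` equal to 2.
  have := key (((‖x‖⁻¹ : ℝ) : ℂ) • x) (((‖y‖⁻¹ : ℝ) : ℂ) • y)
  simp only [map_smul, inner_smul_left, inner_smul_right, norm_smul, norm_mul, Complex.conj_ofReal,
    Complex.norm_real, norm_inv, norm_norm, inv_mul_cancel₀ hx'.ne',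
      inv_mul_cancel₀ hy'.ne'] at this
  rw [← mul_assoc, mul_comm, ← mul_assoc] at this
  field_simp at this
  linarith

/-- A sequence of bounded operators whose quadratic forms converge pointwise, with a common bound,
converges weakly. -/
theorem exists_of_tendsto_quadraticForm [CompleteSpace K] (T : ℕ → K →L[ℂ] K) {q : K → ℂ} {C : ℝ}
    (hC : ∀ n x, ‖inner ℂ x (T n x)‖ ≤ C * ‖x‖ ^ 2)
    (h : ∀ x, Tendsto (fun n => inner ℂ x (T n x)) atTop (𝓝 (q x))) :
    ∃ S : K →L[ℂ] K, ∀ x, inner ℂ x (S x) = q x := by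
  have hB : ∀ x y, ∃ b, Tendsto (fun n => inner ℂ x (T n y)) atTop (𝓝 b) := by
    intro x y
    simp only [fun n => inner_polarization (T n) x y]
    exact ⟨_, ((((h _).sub (h _)).sub ((h _).const_mul _)).add ((h _).const_mul _)).div_const _⟩
  choose B hB using hB
  have uniq := fun x y b => tendsto_nhds_unique (b := b) (hB x y)
  let B₁ : K →ₗ⋆[ℂ] K →ₗ[ℂ] ℂ := LinearMap.mk₂'ₛₗ _ _ B
    (fun x x' y => uniq _ _ _ (by simpa [inner_add_left] using (hB x y).add (hB x' y)))
    (fun c x y => uniq _ _ _ (by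
      simpa [inner_smul_left, mul_comm] using (hB x y).const_mul (starRingEnd ℂ c)))
    (fun x y y' => uniq _ _ _ (by simpa [inner_add_right] using (hB x y).add (hB x y')))
    (fun c x y => uniq _ _ _ (by simpa [inner_smul_right] using (hB x y).const_mul c))
  let B₂ : K →L⋆[ℂ] K →L[ℂ] ℂ := B₁.mkContinuous₂ (2 * C) (fun x y =>
    le_of_tendsto (hB x y).norm (Eventually.of_forall fun n => norm_le_of_quadraticForm (hC n) x y))
  -- The operator representing `B₂` sits in the first slot of the inner product; the adjoint moves
  -- it to the second.
  refine ⟨(InnerProductSpace.continuousLinearMapOfBilin B₂).adjoint, fun x => ?_⟩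
  rw [ContinuousLinearMap.adjoint_inner_right, InnerProductSpace.continuousLinearMapOfBilin_apply]
  exact tendsto_nhds_unique (hB x x) (h x)

end QuadraticForms

/-! ### Functional calculus of a spectral measure. -/

/-- Bounded measurable functions. -/
def BddMeasurable {X : Type*} [MeasurableSpace X] (f : X → ℂ) : Prop :=
  Measurable f ∧ ∃ C : ℝ, ∀ x, ‖f x‖ ≤ C

namespace BddMeasurable

variable {X : Type*} [MeasurableSpace X] {f g : X → ℂ}

theorem add (hf : BddMeasurable f) (hg : BddMeasurable g) : BddMeasurable (f + g) := by
  obtain ⟨C, hC⟩ := hf.2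
  obtain ⟨D, hD⟩ := hg.2
  exact ⟨hf.1.add hg.1, C + D, fun x => (norm_add_le _ _).trans (add_le_add (hC x) (hD x))⟩

theorem mul (hf : BddMeasurable f) (hg : BddMeasurable g) : BddMeasurable (f * g) := by
  obtain ⟨C, hC⟩ := hf.2
  obtain ⟨D, hD⟩ := hg.2
  refine ⟨hf.1.mul hg.1, C * D, fun x => ?_⟩
  rw [Pi.mul_apply, norm_mul]
  exact mul_le_mul (hC x) (hD x) (norm_nonneg _) ((norm_nonneg _).trans (hC x))

theorem conj (hf : BddMeasurable f) : BddMeasurable (fun x => starRingEnd ℂ (f x)) := by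
  obtain ⟨C, hC⟩ := hf.2
  exact ⟨Complex.continuous_conj.measurable.comp hf.1, C, fun x => by simpa using hC x⟩

theorem indicator_const (c : ℂ) {s : Set X} (hs : MeasurableSet s) :
    BddMeasurable (s.indicator fun _ => c) :=
  ⟨measurable_const.indicator hs, ‖c‖, fun x => norm_indicator_le_norm_self (fun _ => c) x⟩

theorem finset_sum {ι : Type*} {F : ι → X → ℂ} (s : Finset ι) (h : ∀ i ∈ s, BddMeasurable (F i)) :
    BddMeasurable (∑ i ∈ s, F i) := by
  classical
  induction s using Finset.induction_on with
  | empty => exact ⟨measurable_const, 0, fun x => by simp⟩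
  | insert i s hi ih =>
    rw [Finset.sum_insert hi]
    exact (h i (by simp)).add (ih fun j hj => h j (by simp [hj]))

theorem integrable (hf : BddMeasurable f) (μ : Measure X) [IsFiniteMeasure μ] :
    Integrable f μ := by
  obtain ⟨C, hC⟩ := hf.2
  exact Integrable.of_bound hf.1.aestronglyMeasurable C (Eventually.of_forall hC)

/-- To prove a property of all bounded measurable functions, it suffices to check it for multiples
of indicators, and to show that it is stable under sums and bounded pointwise limits. -/
theorem induction {p : (f : X → ℂ) → BddMeasurable f → Prop}
    (indicator : ∀ (c : ℂ) (s : Set X) (hs : MeasurableSet s), p _ (indicator_const c hs))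
    (add : ∀ f g (hf : BddMeasurable f) (hg : BddMeasurable g), p f hf → p g hg →
      p (f + g) (hf.add hg))
    (lim : ∀ (F : ℕ → X → ℂ) (f : X → ℂ) (C : ℝ) (hF : ∀ n, BddMeasurable (F n))
      (hf : BddMeasurable f), (∀ n x, ‖F n x‖ ≤ C) →
      (∀ x, Tendsto (fun n => F n x) atTop (𝓝 (f x))) → (∀ n, p (F n) (hF n)) → p f hf)
    {f : X → ℂ} (hf : BddMeasurable f) : p f hf := by
  obtain ⟨C, hC⟩ := hf.2
  have hsm := hf.1.stronglyMeasurable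
  have simp_bdd : ∀ g : SimpleFunc X ℂ, BddMeasurable g := fun g =>
    ⟨g.measurable, g.exists_forall_norm_le⟩
  have simp_p : ∀ g : SimpleFunc X ℂ, p g (simp_bdd g) := by
    intro g
    induction g using SimpleFunc.induction with
    | const c hs =>
      convert indicator c _ hs using 1
      ext x
      simp [Set.indicator, Set.piecewise]
    | add _ h₁ h₂ => exact add _ _ (simp_bdd _) (simp_bdd _) h₁ h₂
  -- On an empty space `C` could be negative, and the truncated approximation needs `0 ≤ C`.
  rcases isEmpty_or_nonempty X with hX | ⟨⟨x₀⟩⟩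
  · convert indicator 0 ∅ MeasurableSet.empty
  have hC0 : 0 ≤ C := (norm_nonneg _).trans (hC x₀)
  exact lim (fun n => hsm.approxBounded C n) f C (fun n => simp_bdd _) hf
    (fun n x => StronglyMeasurable.norm_approxBounded_le hsm hC0 n x)
    (fun x => StronglyMeasurable.tendsto_approxBounded_of_norm_le hsm (hC x)) fun n => simp_p _

end BddMeasurable

namespace SpectralMeasure

variable {X : Type*} [MeasurableSpace X] {K : Type*} [NormedAddCommGroup K] [InnerProductSpace ℂ K]
  (E : SpectralMeasure X K) {s t : Set X}

theorem proj_union (hs : MeasurableSet s) (ht : MeasurableSet t) (hd : Disjoint s t) (x : K) :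
    E.proj (s ∪ t) x = E.proj s x + E.proj t x := by
  let S : ℕ → Set X := fun n => if n = 0 then s else if n = 1 then t else ∅
  have hS : ∀ n, MeasurableSet (S n) := by
    intro n
    simp only [S]
    split_ifs <;> simp [hs, ht]
  have hU : ⋃ n, S n = s ∪ t := by
    ext x
    simp only [Set.mem_iUnion, Set.mem_union, S]
    constructor
    · rintro ⟨n, hn⟩
      split_ifs at hn <;> simp_all
    · rintro (h | h)
      exacts [⟨0, by simpa⟩, ⟨1, by simpa⟩]
  have hdS : Pairwise (Function.onFun Disjoint S) := by
    intro m n hmn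
    simp only [Function.onFun, S]
    split_ifs <;> simp_all [disjoint_comm]
  have h := E.iUnion S hS hdS x
  rw [hU] at h
  refine h.unique ?_
  have := hasSum_sum_of_ne_finset_zero (L := SummationFilter.unconditional ℕ)
    (f := fun n => E.proj (S n) x) (s := {0, 1}) (by
    intro n hn
    have : S n = ∅ := by
      simp only [Finset.mem_insert, Finset.mem_singleton, not_or] at hn
      simp [S, hn.1, hn.2]
    rw [this, E.proj_empty])
  simpa [S] using this

/-- Write `p`, `q` for the two projections. Idempotency of `p + q` gives `pq + qp = 0`. Multiplying
by `p` on the right and on the left gives `qp = -pqp = pq`, hence `2pq = 0`. -/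
theorem proj_proj_of_disjoint (hs : MeasurableSet s) (ht : MeasurableSet t) (hd : Disjoint s t)
    (x : K) : E.proj s (E.proj t x) = 0 := by
  have h : ∀ y, E.proj s (E.proj t y) + E.proj t (E.proj s y) = 0 := by
    intro y
    have := E.idem (s ∪ t) (hs.union ht) y
    simp only [E.proj_union hs ht hd, map_add, E.idem s hs, E.idem t ht] at this
    rw [← sub_eq_zero] at this
    rw [← this]
    abel
  have h1 := h (E.proj s x)
  rw [E.idem s hs] at h1
  have h2 := congrArg (E.proj s) (h x)
  rw [map_add, E.idem s hs, map_zero] at h2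
  have h3 := h x
  have e1 : E.proj s (E.proj t x) = E.proj t (E.proj s x) := by
    rw [eq_neg_of_add_eq_zero_right h1, eq_neg_of_add_eq_zero_left h2]
  rw [← e1, ← two_smul ℂ] at h3
  exact (smul_eq_zero.1 h3).resolve_left two_ne_zero

theorem proj_proj (hs : MeasurableSet s) (ht : MeasurableSet t) (x : K) :
    E.proj s (E.proj t x) = E.proj (s ∩ t) x := by
  have h1 : ∀ y, E.proj s y = E.proj (s ∩ t) y + E.proj (s \ t) y := fun y => by
    rw [← E.proj_union (hs.inter ht) (hs.diff ht) Set.disjoint_sdiff_inter.symm,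
      Set.inter_union_sdiff]
  have h2 : ∀ y, E.proj t y = E.proj (s ∩ t) y + E.proj (t \ s) y := fun y => by
    rw [Set.inter_comm, ← E.proj_union (ht.inter hs) (ht.diff hs) Set.disjoint_sdiff_inter.symm,
      Set.inter_union_sdiff]
  rw [h1, E.proj_proj_of_disjoint (hs.diff ht) ht Set.disjoint_sdiff_left, add_zero, h2, map_add,
    E.idem _ (hs.inter ht), E.proj_proj_of_disjoint (hs.inter ht) (ht.diff hs)
      (Set.disjoint_sdiff_right.mono_left Set.inter_subset_left), add_zero]

theorem inner_proj_self (hs : MeasurableSet s) (x : K) :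
    inner ℂ x (E.proj s x) = ((‖E.proj s x‖ ^ 2 : ℝ) : ℂ) := by
  rw [← E.idem s hs x, ← E.symm s hs, inner_self_eq_norm_sq_to_K, E.idem s hs]
  simp

theorem scalarMeasure_apply (hs : MeasurableSet s) (x : K) :
    E.scalarMeasure x s = ENNReal.ofReal (‖E.proj s x‖ ^ 2) := by
  rw [scalarMeasure, Measure.ofMeasurable_apply _ hs, E.inner_proj_self hs, Complex.ofReal_re]

theorem scalarMeasure_univ (x : K) : E.scalarMeasure x Set.univ = ENNReal.ofReal (‖x‖ ^ 2) := by
  rw [E.scalarMeasure_apply MeasurableSet.univ, E.univ, one_apply_eq_self]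

instance (x : K) : IsFiniteMeasure (E.scalarMeasure x) :=
  ⟨by rw [scalarMeasure_univ]; exact ENNReal.ofReal_lt_top⟩

theorem measureReal_scalarMeasure (hs : MeasurableSet s) (x : K) :
    (E.scalarMeasure x).real s = ‖E.proj s x‖ ^ 2 := by
  rw [measureReal_def, E.scalarMeasure_apply hs, ENNReal.toReal_ofReal (by positivity)]

theorem norm_integral_scalarMeasure_le {f : X → ℂ} {C : ℝ} (hC : ∀ x, ‖f x‖ ≤ C) (x : K) :
    ‖∫ t, f t ∂(E.scalarMeasure x)‖ ≤ C * ‖x‖ ^ 2 := by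
  have := norm_integral_le_of_norm_le_const (μ := E.scalarMeasure x) (Eventually.of_forall hC)
  rwa [E.measureReal_scalarMeasure MeasurableSet.univ, E.univ] at this

theorem tendsto_integral_scalarMeasure {F : ℕ → X → ℂ} {f : X → ℂ} {C : ℝ}
    (hF : ∀ n, BddMeasurable (F n)) (hC : ∀ n x, ‖F n x‖ ≤ C)
    (h : ∀ x, Tendsto (fun n => F n x) atTop (𝓝 (f x))) (x : K) :
    Tendsto (fun n => ∫ t, F n t ∂(E.scalarMeasure x)) atTop
      (𝓝 (∫ t, f t ∂(E.scalarMeasure x))) :=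
  tendsto_integral_of_dominated_convergence (fun _ => C)
    (fun n => (hF n).1.aestronglyMeasurable) (integrable_const _)
    (fun n => Eventually.of_forall (hC n)) (Eventually.of_forall h)

theorem isIntegral_indicator (c : ℂ) (hs : MeasurableSet s) :
    E.IsIntegral (s.indicator fun _ => c) (c • E.proj s) := by
  intro x
  rw [integral_indicator_const _ hs, E.measureReal_scalarMeasure hs, FunLike.coe_smul,
    Pi.smul_apply, inner_smul_right, E.inner_proj_self hs, Complex.real_smul, mul_comm]

variable {E} {f g : X → ℂ} {S T : K →L[ℂ] K}

theorem IsIntegral.add (hf : BddMeasurable f) (hg : BddMeasurable g) (hS : E.IsIntegral f S)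
    (hT : E.IsIntegral g T) : E.IsIntegral (f + g) (S + T) := by
  intro x
  simp only [Pi.add_apply]
  rw [integral_add (hf.integrable _) (hg.integrable _), add_apply,
    inner_add_right, hS, hT]

theorem IsIntegral.unique (hS : E.IsIntegral f S) (hT : E.IsIntegral f T) : S = T :=
  ContinuousLinearMap.ext_quadraticForm fun x => (hS x).trans (hT x).symm

theorem IsIntegral.conj [CompleteSpace K] (hT : E.IsIntegral f T) :
    E.IsIntegral (fun x => starRingEnd ℂ (f x)) T.adjoint := by
  intro x
  rw [ContinuousLinearMap.adjoint_inner_right, ← inner_conj_symm, hT, integral_conj]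

variable [CompleteSpace K]

/-- Bounded pointwise limits are handled by dominated convergence in every scalar measure, which
makes the quadratic forms converge with a common bound. -/
theorem exists_isIntegral (E : SpectralMeasure X K) (hf : BddMeasurable f) :
    ∃ T, E.IsIntegral f T := by
  induction hf using BddMeasurable.induction with
  | indicator c s hs => exact ⟨_, E.isIntegral_indicator c hs⟩
  | add f g hf hg h₁ h₂ =>
    obtain ⟨S, hS⟩ := h₁
    obtain ⟨T, hT⟩ := h₂
    exact ⟨_, hS.add hf hg hT⟩
  | lim F f C hF hf hC h hp =>
    choose T hT using hp
    refine exists_of_tendsto_quadraticForm T (C := C) (fun n x => ?_) fun x => ?_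
    · rw [hT]
      exact E.norm_integral_scalarMeasure_le (hC n) x
    · simp only [fun n => hT n x]
      exact E.tendsto_integral_scalarMeasure hF hC h x

open Classical in
/-- The integral of a bounded measurable function with respect to a spectral measure. -/
noncomputable def integral (E : SpectralMeasure X K) (f : X → ℂ) : K →L[ℂ] K :=
  if h : ∃ T, E.IsIntegral f T then h.choose else 0

variable (E)

theorem isIntegral_integral (hf : BddMeasurable f) : E.IsIntegral f (E.integral f) := by
  rw [integral, dif_pos (E.exists_isIntegral hf)]
  exact (E.exists_isIntegral hf).choose_spec

theorem integral_indicator (c : ℂ) (hs : MeasurableSet s) :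
    E.integral (s.indicator fun _ => c) = c • E.proj s :=
  (E.isIntegral_integral (.indicator_const c hs)).unique (E.isIntegral_indicator c hs)

theorem integral_add (hf : BddMeasurable f) (hg : BddMeasurable g) :
    E.integral (f + g) = E.integral f + E.integral g :=
  (E.isIntegral_integral (hf.add hg)).unique
    ((E.isIntegral_integral hf).add hf hg (E.isIntegral_integral hg))

theorem integral_sum {ι : Type*} {F : ι → X → ℂ} (s : Finset ι)
    (h : ∀ i ∈ s, BddMeasurable (F i)) :
    E.integral (∑ i ∈ s, F i) = ∑ i ∈ s, E.integral (F i) := by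
  classical
  induction s using Finset.induction_on with
  | empty =>
    have := E.integral_indicator 0 MeasurableSet.univ
    rwa [Set.indicator_univ, zero_smul] at this
  | insert i s hi ih =>
    rw [Finset.sum_insert hi, Finset.sum_insert hi, E.integral_add (h i (by simp))
      (.finset_sum s fun j hj => h j (by simp [hj])), ih fun j hj => h j (by simp [hj])]

theorem adjoint_integral (hf : BddMeasurable f) :
    (E.integral f).adjoint = E.integral fun x => starRingEnd ℂ (f x) :=
  (E.isIntegral_integral hf).conj.unique (E.isIntegral_integral hf.conj)

theorem tendsto_inner_integral {F : ℕ → X → ℂ} {C : ℝ} (hF : ∀ n, BddMeasurable (F n))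
    (hf : BddMeasurable f) (hC : ∀ n x, ‖F n x‖ ≤ C)
    (h : ∀ x, Tendsto (fun n => F n x) atTop (𝓝 (f x))) (x y : K) :
    Tendsto (fun n => inner ℂ x (E.integral (F n) y)) atTop (𝓝 (inner ℂ x (E.integral f y))) := by
  refine tendsto_inner_of_quadraticForm (fun x => ?_) x y
  simp only [fun n => E.isIntegral_integral (hF n) x, E.isIntegral_integral hf x]
  exact E.tendsto_integral_scalarMeasure hF hC h x

theorem proj_integral (hs : MeasurableSet s) (hf : BddMeasurable f) (y : K) :
    E.proj s (E.integral f y) = E.integral (s.indicator (fun _ => 1) * f) y := by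
  refine ext_inner_left ℂ fun x => ?_
  induction hf using BddMeasurable.induction generalizing x y with
  | indicator c t ht =>
    have : (s.indicator (fun _ => (1 : ℂ)) * t.indicator fun _ => c)
        = (s ∩ t).indicator fun _ => c := by
      ext x
      rw [← Set.indicator_indicator]
      by_cases h : x ∈ s <;> simp [h]
    rw [this, E.integral_indicator c ht, E.integral_indicator c (hs.inter ht)]
    simp [E.proj_proj hs ht]
  | add f g hf hg h₁ h₂ =>
    have h1 := BddMeasurable.indicator_const (1 : ℂ) hs
    rw [mul_add, E.integral_add hf hg, E.integral_add (h1.mul hf) (h1.mul hg)]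
    simp only [add_apply, map_add, inner_add_right, h₁, h₂]
  | lim F f C hF hf hC h hp =>
    have h1 := BddMeasurable.indicator_const (1 : ℂ) hs
    have l1 := E.tendsto_inner_integral hF hf hC h (E.proj s x) y
    simp only [E.symm s hs, hp] at l1
    refine tendsto_nhds_unique l1 (E.tendsto_inner_integral (C := C) (fun n => h1.mul (hF n))
      (h1.mul hf) (fun n x => ?_) (fun x => (h x).const_mul _) x y)
    rw [Pi.mul_apply, norm_mul]
    refine (mul_le_of_le_one_left (norm_nonneg _) ?_).trans (hC n x)
    by_cases hx : x ∈ s <;> simp [hx]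

/-- Induction on `f` with `g` fixed: for indicators this is `proj_integral`, and both sides pass to
bounded pointwise limits weakly. -/
theorem integral_mul (hf : BddMeasurable f) (hg : BddMeasurable g) (y : K) :
    E.integral (f * g) y = E.integral f (E.integral g y) := by
  refine ext_inner_left ℂ fun x => ?_
  induction hf using BddMeasurable.induction generalizing x y with
  | indicator c s hs =>
    -- The scalar `c` is moved to the factor `g`, so that the remaining indicator has value 1 and
    -- `proj_integral` applies.
    have : (s.indicator (fun _ => c)) * g
        = s.indicator (fun _ => (1 : ℂ)) * (Set.univ.indicator (fun _ => c) * g) := by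
      ext x
      by_cases h : x ∈ s <;> simp [h]
    have hu : ∀ z, E.proj Set.univ z = z := fun z => by rw [E.univ, one_apply_eq_self]
    have e : E.integral (Set.univ.indicator (fun _ => c) * g) y = c • E.integral g y := by
      have h1 : E.IsIntegral (Set.univ.indicator (fun _ => c) * g) (c • E.integral g) := by
        intro x
        simp only [Set.indicator_univ, Pi.mul_apply]
        rw [integral_const_mul, ← E.isIntegral_integral hg x, FunLike.coe_smul, Pi.smul_apply,
          inner_smul_right]
      rw [(E.isIntegral_integral
        ((BddMeasurable.indicator_const c MeasurableSet.univ).mul hg)).unique h1]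
      rfl
    rw [this, ← E.proj_integral hs ((BddMeasurable.indicator_const c MeasurableSet.univ).mul hg),
      e, E.integral_indicator c hs]
    simp
  | add f g' hf hg' h₁ h₂ =>
    rw [add_mul, E.integral_add hf hg', E.integral_add (hf.mul hg) (hg'.mul hg)]
    simp only [add_apply, inner_add_right, h₁, h₂]
  | lim F f C hF hf hC h hp =>
    obtain ⟨D, hD⟩ := hg.2
    have l1 := E.tendsto_inner_integral hF hf hC h x (E.integral g y)
    simp only [← hp] at l1
    refine tendsto_nhds_unique (E.tendsto_inner_integral (C := C * D) (fun n => (hF n).mul hg)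
      (hf.mul hg) (fun n x => ?_) (fun x => (h x).mul_const _) x y) l1
    rw [Pi.mul_apply, norm_mul]
    exact mul_le_mul (hC n x) (hD x) (norm_nonneg _) ((norm_nonneg _).trans (hC n x))

/-- This is `(T x, T x) = (x, T* T x)`, where `T* T` is the integral of `|f|²` by multiplicativity.
It converts bounds on `∑ |φₙ|²` into bounds on sums of operators. -/
theorem norm_sq_integral (hf : BddMeasurable f) (x : K) :
    ‖E.integral f x‖ ^ 2 = ∫ t, ‖f t‖ ^ 2 ∂(E.scalarMeasure x) := by
  have h : ((‖E.integral f x‖ ^ 2 : ℝ) : ℂ) = ∫ t, ((‖f t‖ ^ 2 : ℝ) : ℂ) ∂(E.scalarMeasure x) := by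
    have := inner_self_eq_norm_sq_to_K (𝕜 := ℂ) (E.integral f x)
    push_cast
    rw [← Complex.coe_algebraMap, ← this, ← ContinuousLinearMap.adjoint_inner_right,
      E.adjoint_integral hf,
      ← E.integral_mul hf.conj hf, E.isIntegral_integral (hf.conj.mul hf)]
    refine integral_congr_ae (Eventually.of_forall fun t => ?_)
    simp only [Pi.mul_apply]
    rw [Complex.conj_mul']
    rfl
  exact Complex.ofReal_injective (h.trans integral_ofReal)

/-- A vector in the range of the projection of an atom is an eigenvector of all integrals. -/
theorem inner_integral_of_proj_singleton [MeasurableSingletonClass X] (hf : BddMeasurable f)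
    {p : X} {x : K} (hx : E.proj {p} x = x) (y : K) :
    inner ℂ x (E.integral f y) = f p * inner ℂ x y := by
  induction hf using BddMeasurable.induction generalizing y with
  | indicator c s hs =>
    rw [E.integral_indicator c hs, FunLike.coe_smul, Pi.smul_apply, inner_smul_right,
      ← E.symm s hs, ← hx, E.proj_proj hs (measurableSet_singleton p)]
    by_cases h : p ∈ s
    · simp [h]
    · have : s ∩ {p} = ∅ := by simp [h]
      simp [h, this, E.proj_empty]
  | add f g hf hg h₁ h₂ =>
    rw [E.integral_add hf hg, add_apply, inner_add_right, h₁, h₂, Pi.add_apply,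
      add_mul]
  | lim F f C hF hf hC h hp =>
    have l1 := E.tendsto_inner_integral hF hf hC h x y
    simp only [hp] at l1
    exact tendsto_nhds_unique l1 ((h p).mul_const _)

end SpectralMeasure

/-- The Cauchy-Schwarz inequality for series of nonnegative numbers. -/
theorem summable_mul_and_tsum_mul_le {ι : Type*} {f g : ι → ℝ} (hf : ∀ i, 0 ≤ f i)
    (hg : ∀ i, 0 ≤ g i) (hf' : Summable fun i => f i ^ 2) (hg' : Summable fun i => g i ^ 2) :
    (Summable fun i => f i * g i) ∧
      ∑' i, f i * g i ≤ √(∑' i, f i ^ 2) * √(∑' i, g i ^ 2) := by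
  have h := Real.summable_and_inner_le_Lp_mul_Lq_tsum_of_nonneg Real.HolderConjugate.two_two hf hg
    (by simpa using hf') (by simpa using hg')
  simpa [Real.sqrt_eq_rpow] using h

section Basis

variable {H : Type*} [NormedAddCommGroup H] [InnerProductSpace ℂ H] {ι : Type*}

theorem HilbertBasis.hasSum_norm_inner_sq (e : HilbertBasis ι ℂ H) (x : H) :
    HasSum (fun i => ‖inner ℂ (e i) x‖ ^ 2) (‖x‖ ^ 2) := by
  have h := (e.hasSum_inner_mul_inner x x).mapL Complex.reCLM
  simp only [Complex.reCLM_apply] at h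
  have e1 : (inner ℂ x x).re = ‖x‖ ^ 2 := by
    rw [inner_self_eq_norm_sq_to_K]
    norm_cast
  rw [e1] at h
  convert h using 2 with i
  rw [← inner_conj_symm x (e i), Complex.conj_mul']
  norm_cast

theorem HilbertBasis.tsum_enorm_inner_sq (e : HilbertBasis ι ℂ H) (x : H) :
    ∑' i, ‖inner ℂ (e i) x‖ₑ ^ 2 = ‖x‖ₑ ^ 2 := by
  have h := e.hasSum_norm_inner_sq x
  have := ENNReal.ofReal_tsum_of_nonneg (fun i => by positivity) h.summable
  rw [h.tsum_eq] at this
  simp only [ENNReal.ofReal_pow (norm_nonneg _), ofReal_norm] at this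
  exact this.symm

end Basis

/-! ### The Hilbert space of Hilbert-Schmidt operators. -/

namespace HilbertSchmidt

variable {H : Type*} [NormedAddCommGroup H] [InnerProductSpace ℂ H] [CompleteSpace H]

@[simp] theorem toCLM_add (P Q : HilbertSchmidt H) : (P + Q).toCLM = P.toCLM + Q.toCLM := rfl

@[simp] theorem toCLM_sub (P Q : HilbertSchmidt H) : (P - Q).toCLM = P.toCLM - Q.toCLM := rfl

@[simp] theorem toCLM_zero : (0 : HilbertSchmidt H).toCLM = 0 := rfl

@[simp] theorem toCLM_smul (c : ℂ) (Q : HilbertSchmidt H) : (c • Q).toCLM = c • Q.toCLM := rfl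

@[ext] theorem ext {P Q : HilbertSchmidt H} (h : P.toCLM = Q.toCLM) : P = Q := Subtype.ext h

/-- A Hilbert-Schmidt operator, given by a bounded operator. -/
def mk (T : H →L[ℂ] H) (hT : T ∈ hsSubmodule H) : HilbertSchmidt H := ⟨T, hT⟩

@[simp] theorem toCLM_mk (T : H →L[ℂ] H) (hT : T ∈ hsSubmodule H) : (mk T hT).toCLM = T := rfl

theorem summable_norm_sq (Q : HilbertSchmidt H) : Summable fun i => ‖Q.toCLM (hBasis H i)‖ ^ 2 :=
  (mem_hsSubmodule_iff H _).1 Q.2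

theorem norm_sq_eq_tsum (Q : HilbertSchmidt H) : ‖Q‖ ^ 2 = ∑' i, ‖Q.toCLM (hBasis H i)‖ ^ 2 := by
  change ‖toL2 H Q‖ ^ 2 = _
  have := lp.norm_rpow_eq_tsum (p := 2) (by simp) (toL2 H Q)
  simp only [ENNReal.toReal_ofNat, Real.rpow_ofNat] at this
  exact this

theorem tsum_enorm_sq (Q : HilbertSchmidt H) :
    ∑' i, ‖Q.toCLM (hBasis H i)‖ₑ ^ 2 = ‖Q‖ₑ ^ 2 := by
  have := ENNReal.ofReal_tsum_of_nonneg (fun i => by positivity) Q.summable_norm_sq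
  rw [← norm_sq_eq_tsum] at this
  simp only [ENNReal.ofReal_pow (norm_nonneg _), ofReal_norm] at this
  exact this.symm

theorem mem_hsSubmodule_iff_tsum_lt_top (T : H →L[ℂ] H) :
    T ∈ hsSubmodule H ↔ ∑' i, ‖T (hBasis H i)‖ₑ ^ 2 < ∞ := by
  rw [mem_hsSubmodule_iff]
  constructor
  · intro h
    have h' := tsum_enorm_sq (mk T ((mem_hsSubmodule_iff H T).2 h))
    rw [toCLM_mk] at h'
    rw [h']
    finiteness
  · intro h
    have := ENNReal.summable_toReal h.ne
    simpa using this

/-- The operator `(·, b) a`, as a Hilbert-Schmidt operator. -/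
noncomputable def rankOne (a b : H) : HilbertSchmidt H :=
  mk ((innerSL ℂ b).smulRight a) <| by
    rw [mem_hsSubmodule_iff]
    have h := ((hBasis H).hasSum_norm_inner_sq b).summable.mul_right (‖a‖ ^ 2)
    refine h.congr fun i => ?_
    rw [ContinuousLinearMap.smulRight_apply, norm_smul, innerSL_apply_apply, mul_pow,
      norm_inner_symm]

@[simp] theorem rankOne_apply (a b x : H) : (rankOne a b).toCLM x = inner ℂ b x • a := rfl

/-- Rank one operators thus recover all matrix coefficients of `Q`; they separate points and span a
dense subspace, so identities in the Hilbert-Schmidt class are tested on them. -/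
theorem inner_rankOne (a b : H) (Q : HilbertSchmidt H) :
    inner ℂ (rankOne a b) Q = inner ℂ a (Q.toCLM b) := by
  rw [inner_eq_tsum]
  have h := ((hBasis H).hasSum_repr b).mapL ((innerSL ℂ a) ∘L Q.toCLM)
  rw [ContinuousLinearMap.comp_apply, innerSL_apply_apply] at h
  rw [← h.tsum_eq]
  refine tsum_congr fun i => ?_
  rw [rankOne_apply, inner_smul_left, inner_conj_symm, ContinuousLinearMap.comp_apply, map_smul,
    innerSL_apply_apply, inner_smul_right, HilbertBasis.repr_apply_apply]

theorem norm_rankOne (a b : H) : ‖rankOne a b‖ = ‖a‖ * ‖b‖ := by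
  have h := inner_rankOne a b (rankOne a b)
  rw [rankOne_apply, inner_smul_right, inner_self_eq_norm_sq_to_K, inner_self_eq_norm_sq_to_K,
    inner_self_eq_norm_sq_to_K, mul_comm, ← mul_pow] at h
  have h' : ‖rankOne a b‖ ^ 2 = (‖a‖ * ‖b‖) ^ 2 := by exact_mod_cast h
  exact (pow_left_inj₀ (norm_nonneg _) (by positivity) two_ne_zero).1 h'

theorem ext_inner_rankOne {P Q : HilbertSchmidt H}
    (h : ∀ a b, inner ℂ (rankOne a b) P = inner ℂ (rankOne a b) Q) : P = Q := by
  ext b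
  refine ext_inner_left ℂ fun a => ?_
  rw [← inner_rankOne, ← inner_rankOne, h]

/-- The isometry `toL2` is onto: a square summable family `h` is the image of `x ↦ ∑ (eᵢ, x) hᵢ`,
bounded by Cauchy-Schwarz. Completeness is needed for the weak limits that build the product
spectral measure. -/
instance : CompleteSpace (HilbertSchmidt H) := by
  have hiso : Isometry (toL2 H) := fun _ _ => rfl
  have hsurj : Function.Surjective (toL2 H) := by
    intro h
    have hh : Summable fun i => ‖h i‖ ^ 2 := by
      have := (memℓp_gen_iff (p := 2) (by simp)).1 h.2
      simpa using this
    have hx : ∀ x, Summable fun i => ‖inner ℂ (hBasis H i) x • h i‖ := fun x => by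
      simpa only [norm_smul] using (summable_mul_and_tsum_mul_le (fun i => norm_nonneg _)
        (fun i => norm_nonneg _) ((hBasis H).hasSum_norm_inner_sq x).summable hh).1
    let T : H →ₗ[ℂ] H :=
      { toFun := fun x => ∑' i, inner ℂ (hBasis H i) x • h i
        map_add' := fun x y => by
          simp only [inner_add_right, add_smul]
          exact (hx x).of_norm.tsum_add (hx y).of_norm
        map_smul' := fun c x => by
          simp only [inner_smul_right, mul_smul]
          exact tsum_const_smul'' c }
    let T' : H →L[ℂ] H := T.mkContinuous (√(∑' i, ‖h i‖ ^ 2)) fun x => by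
      refine (norm_tsum_le_tsum_norm (hx x)).trans ?_
      simp only [norm_smul]
      refine (summable_mul_and_tsum_mul_le (fun i => norm_nonneg _)
        (fun i => norm_nonneg _) ((hBasis H).hasSum_norm_inner_sq x).summable hh).2.trans ?_
      rw [((hBasis H).hasSum_norm_inner_sq x).tsum_eq, Real.sqrt_sq (norm_nonneg _), mul_comm]
    have hT : ∀ i, T' (hBasis H i) = h i := by
      intro i
      change ∑' j, inner ℂ (hBasis H j) (hBasis H i) • h j = h i
      rw [tsum_eq_single i]
      · rw [inner_self_eq_norm_sq_to_K, (hBasis H).orthonormal.1 i]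
        simp
      · intro j hj
        rw [(hBasis H).orthonormal.2 hj, zero_smul]
    refine ⟨⟨T', ?_⟩, ?_⟩
    · rw [mem_hsSubmodule_iff]
      simpa only [hT] using hh
    · ext i
      exact hT i
  exact (completeSpace_congr (e := Equiv.ofBijective _ ⟨toL2_injective, hsurj⟩)
    hiso.isUniformEmbedding).2 inferInstance

theorem topologicalClosure_span_rankOne :
    (Submodule.span ℂ (Set.range fun p : H × H => rankOne p.1 p.2)).topologicalClosure = ⊤ := by
  rw [Submodule.topologicalClosure_eq_top_iff, Submodule.eq_bot_iff]
  intro Q hQ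
  refine ext_inner_rankOne fun a b => ?_
  rw [inner_zero_right]
  exact (Submodule.mem_orthogonal _ _).1 hQ _ (Submodule.subset_span ⟨(a, b), rfl⟩)

/-- By Parseval both sides are the same double sum of squared matrix entries, in the two orders of
summation. Multiplication on the right is then estimated as multiplication on the left. -/
theorem tsum_enorm_sq_adjoint (T : H →L[ℂ] H) :
    ∑' i, ‖T.adjoint (hBasis H i)‖ₑ ^ 2 = ∑' i, ‖T (hBasis H i)‖ₑ ^ 2 := by
  simp only [← fun x => (hBasis H).tsum_enorm_inner_sq x]
  rw [ENNReal.tsum_comm]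
  refine tsum_congr fun i => tsum_congr fun j => ?_
  rw [ContinuousLinearMap.adjoint_inner_right, ← ofReal_norm, ← ofReal_norm, norm_inner_symm]

theorem tsum_enorm_sq_comp_le (A T : H →L[ℂ] H) :
    ∑' i, ‖(A ∘L T) (hBasis H i)‖ₑ ^ 2 ≤ ‖A‖ₑ ^ 2 * ∑' i, ‖T (hBasis H i)‖ₑ ^ 2 := by
  rw [← ENNReal.tsum_mul_left]
  refine ENNReal.tsum_le_tsum fun i => ?_
  rw [← mul_pow]
  gcongr
  exact A.le_opENorm _

theorem tsum_enorm_sq_sandwich_le (A T B : H →L[ℂ] H) :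
    ∑' i, ‖(A ∘L T ∘L B) (hBasis H i)‖ₑ ^ 2
      ≤ (‖A‖ₑ * ‖B‖ₑ) ^ 2 * ∑' i, ‖T (hBasis H i)‖ₑ ^ 2 := by
  refine (tsum_enorm_sq_comp_le A (T ∘L B)).trans ?_
  rw [← tsum_enorm_sq_adjoint, ContinuousLinearMap.adjoint_comp, mul_pow, mul_assoc]
  gcongr
  refine (tsum_enorm_sq_comp_le _ _).trans ?_
  rw [tsum_enorm_sq_adjoint, ← ofReal_norm, LinearIsometryEquiv.norm_map,
    ofReal_norm]

theorem sandwich_mem (A B : H →L[ℂ] H) (Q : HilbertSchmidt H) :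
    A ∘L Q.toCLM ∘L B ∈ hsSubmodule H := by
  rw [mem_hsSubmodule_iff_tsum_lt_top]
  refine (tsum_enorm_sq_sandwich_le A Q.toCLM B).trans_lt ?_
  rw [tsum_enorm_sq]
  finiteness

theorem norm_mk_sandwich_le (A B : H →L[ℂ] H) (Q : HilbertSchmidt H) :
    ‖mk (A ∘L Q.toCLM ∘L B) (sandwich_mem A B Q)‖ ≤ ‖A‖ * ‖B‖ * ‖Q‖ := by
  refine (enorm_le_iff_norm_le (y := ((‖A‖ * ‖B‖ * ‖Q‖ : ℝ)))).1 ?_ |>.trans_eq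
    (Real.norm_of_nonneg (by positivity))
  rw [← ENNReal.pow_le_pow_left_iff two_ne_zero, enorm_mul, enorm_mul, mul_pow]
  simp only [enorm_norm]
  rw [← tsum_enorm_sq, ← tsum_enorm_sq Q]
  exact tsum_enorm_sq_sandwich_le A Q.toCLM B

/-- The transformer `Q ↦ A Q B` on the Hilbert-Schmidt class. -/
noncomputable def sandwich (A B : H →L[ℂ] H) : HilbertSchmidt H →L[ℂ] HilbertSchmidt H :=
  LinearMap.mkContinuous
    { toFun := fun Q => mk (A ∘L Q.toCLM ∘L B) (sandwich_mem A B Q)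
      map_add' := fun P Q => HilbertSchmidt.ext (by ext x; simp)
      map_smul' := fun c Q => HilbertSchmidt.ext (by ext x; simp) }
    (‖A‖ * ‖B‖) (norm_mk_sandwich_le A B)

@[simp] theorem toCLM_sandwich (A B : H →L[ℂ] H) (Q : HilbertSchmidt H) :
    (sandwich A B Q).toCLM = A ∘L Q.toCLM ∘L B := rfl

theorem sandwich_rankOne (A B : H →L[ℂ] H) (a b : H) :
    sandwich A B (rankOne a b) = rankOne (A a) (B.adjoint b) := by
  ext x
  simp [ContinuousLinearMap.adjoint_inner_left]

theorem inner_sandwich (A B : H →L[ℂ] H) (P Q : HilbertSchmidt H) :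
    inner ℂ (sandwich A B P) Q = inner ℂ P (sandwich A.adjoint B.adjoint Q) := by
  rw [← ContinuousLinearMap.adjoint_inner_right]
  congr 1
  refine ext_inner_rankOne fun a b => ?_
  rw [ContinuousLinearMap.adjoint_inner_right, sandwich_rankOne, inner_rankOne, inner_rankOne,
    toCLM_sandwich, ContinuousLinearMap.comp_apply, ContinuousLinearMap.comp_apply,
    ContinuousLinearMap.adjoint_inner_right]

end HilbertSchmidt

/-! ### Extension of projection-valued set functions -/

/-- Orthogonal projections. -/
structure IsOrthProj {K : Type*} [NormedAddCommGroup K] [InnerProductSpace ℂ K]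
    (P : K →L[ℂ] K) : Prop where
  idem : ∀ x, P (P x) = P x
  symm : ∀ x y, inner ℂ (P x) y = inner ℂ x (P y)

namespace IsOrthProj

variable {K : Type*} [NormedAddCommGroup K] [InnerProductSpace ℂ K] {P Q : K →L[ℂ] K}

theorem inner_self (h : IsOrthProj P) (x : K) : inner ℂ x (P x) = ((‖P x‖ ^ 2 : ℝ) : ℂ) := by
  rw [← h.idem x, ← h.symm, inner_self_eq_norm_sq_to_K, h.idem]
  simp

theorem norm_le (h : IsOrthProj P) (x : K) : ‖P x‖ ≤ ‖x‖ := by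
  have h := norm_inner_le_norm (𝕜 := ℂ) x (P x) |>.trans' (by rw [h.inner_self])
  rw [Complex.norm_real, Real.norm_of_nonneg (by positivity)] at h
  by_contra! hc
  nlinarith [norm_nonneg x, norm_nonneg (P x)]

theorem zero : IsOrthProj (0 : K →L[ℂ] K) := ⟨fun x => by simp, fun x y => by simp⟩

theorem one_sub (h : IsOrthProj P) : IsOrthProj (1 - P) := by
  constructor
  · intro x
    simp [h.idem]
  · intro x y
    simp [h.symm]

/-- Two projections the sum of whose quadratic forms is at most one are orthogonal. -/
theorem apply_apply_eq_zero (hQ : IsOrthProj Q)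
    (h : ∀ x, ‖P x‖ ^ 2 + ‖Q x‖ ^ 2 ≤ ‖x‖ ^ 2) (x : K) : P (Q x) = 0 := by
  have := h (Q x)
  rw [hQ.idem] at this
  have h0 : ‖P (Q x)‖ ^ 2 = 0 := le_antisymm (by linarith) (by positivity)
  simpa using h0

theorem apply_eq_self_of_norm_ge (hP : IsOrthProj P) {x : K} (h : ‖x‖ ≤ ‖P x‖) : P x = x := by
  have h1 : ‖P x‖ = ‖x‖ := le_antisymm (hP.norm_le x) h
  have h2 : inner ℂ x (P x) = ((‖x‖ ^ 2 : ℝ) : ℂ) := by rw [hP.inner_self, h1]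
  rw [← sub_eq_zero, ← norm_eq_zero, ← sq_eq_zero_iff, norm_sub_sq (𝕜 := ℂ), h1, inner_re_symm, h2]
  simp only [RCLike.re_to_complex, Complex.ofReal_re]
  ring

variable {ι : Type*} {R : ι → K →L[ℂ] K}

theorem finset_sum (hR : ∀ i, IsOrthProj (R i)) (ho : ∀ i j, i ≠ j → ∀ x, R i (R j x) = 0)
    (s : Finset ι) : IsOrthProj (∑ i ∈ s, R i) := by
  classical
  constructor
  · intro x
    simp only [sum_apply, map_sum]
    refine Finset.sum_congr rfl fun i hi => ?_
    rw [Finset.sum_eq_single i (fun j _ hj => ho _ _ hj x) (fun h => (h hi).elim), (hR i).idem]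
  · intro x y
    simp only [sum_apply, sum_inner, inner_sum]
    exact Finset.sum_congr rfl fun i _ => (hR i).symm x y

/-- Pythagoras: strong convergence of a series of orthogonal projections is reduced to convergence
of a series of numbers. -/
theorem norm_sub_sum_sq (hP : IsOrthProj P) (hR : ∀ i, IsOrthProj (R i))
    (ho : ∀ i j, i ≠ j → ∀ x, R i (R j x) = 0) (hPR : ∀ i x, P (R i x) = R i x)
    (s : Finset ι) (x : K) :
    ‖P x - ∑ i ∈ s, R i x‖ ^ 2 = ‖P x‖ ^ 2 - ∑ i ∈ s, ‖R i x‖ ^ 2 := by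
  have hS := finset_sum hR ho s
  have e1 : inner ℂ (P x) ((∑ i ∈ s, R i) x) = ((∑ i ∈ s, ‖R i x‖ ^ 2 : ℝ) : ℂ) := by
    rw [hP.symm, sum_apply, map_sum, inner_sum]
    push_cast
    refine Finset.sum_congr rfl fun i _ => ?_
    rw [hPR, (hR i).inner_self]
    simp
  have e2 : inner ℂ x ((∑ i ∈ s, R i) x) = ((∑ i ∈ s, ‖R i x‖ ^ 2 : ℝ) : ℂ) := by
    rw [sum_apply, inner_sum]
    push_cast
    refine Finset.sum_congr rfl fun i _ => ?_
    rw [(hR i).inner_self]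
    simp
  rw [hS.inner_self] at e2
  have e3 : ‖(∑ i ∈ s, R i) x‖ ^ 2 = ∑ i ∈ s, ‖R i x‖ ^ 2 := by exact_mod_cast e2
  rw [← sum_apply, norm_sub_sq (𝕜 := ℂ), e1, e3]
  simp only [RCLike.re_to_complex, Complex.ofReal_re]
  ring

/-- Strong convergence of a series of mutually orthogonal projections follows from the convergence
of the quadratic forms on a total set. -/
theorem hasSum_of_total (hP : IsOrthProj P) (hR : ∀ i, IsOrthProj (R i))
    (ho : ∀ i j, i ≠ j → ∀ x, R i (R j x) = 0) (hPR : ∀ i x, P (R i x) = R i x) {S : Set K}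
    (hS : (Submodule.span ℂ S).topologicalClosure = ⊤)
    (h : ∀ x ∈ S, HasSum (fun i => ‖R i x‖ ^ 2) (‖P x‖ ^ 2)) (x : K) :
    HasSum (fun i => R i x) (P x) := by
  -- The remainders are contractions, uniformly in `s`; this carries convergence from the span of
  -- `S` to its closure.
  have hle : ∀ (s : Finset ι) y, ‖P y - ∑ i ∈ s, R i y‖ ≤ ‖y‖ := by
    intro s y
    refine (sq_le_sq₀ (norm_nonneg _) (norm_nonneg _)).1 ?_
    rw [norm_sub_sum_sq hP hR ho hPR]
    have h1 : (0 : ℝ) ≤ ∑ i ∈ s, ‖R i y‖ ^ 2 := Finset.sum_nonneg fun i _ => by positivity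
    have h2 := hP.norm_le y
    have h3 : ‖P y‖ ^ 2 ≤ ‖y‖ ^ 2 := by gcongr
    linarith
  let V : Submodule ℂ K :=
    { carrier := {y | HasSum (fun i => R i y) (P y)}
      zero_mem' := by simp
      add_mem' := fun ha hb => by
        simp only [Set.mem_ofPred_eq, map_add] at ha hb ⊢
        exact ha.add hb
      smul_mem' := fun c a ha => by
        simp only [Set.mem_ofPred_eq, map_smul] at ha ⊢
        exact ha.const_smul c }
  have hSV : Submodule.span ℂ S ≤ V := by
    rw [Submodule.span_le]
    intro y hy
    change HasSum _ _
    rw [HasSum, tendsto_iff_norm_sub_tendsto_zero]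
    have h1 : Tendsto (fun s => ‖P y‖ ^ 2 - ∑ i ∈ s, ‖R i y‖ ^ 2) atTop (𝓝 0) := by
      have := (tendsto_const_nhds (x := ‖P y‖ ^ 2)).sub (h y hy)
      rwa [sub_self] at this
    simp only [← norm_sub_sum_sq hP hR ho hPR _ y] at h1
    have h2 := h1.sqrt
    simp only [Real.sqrt_sq (norm_nonneg _), Real.sqrt_zero] at h2
    simpa only [norm_sub_rev, SummationFilter.unconditional_filter] using h2
  have hx : x ∈ (Submodule.span ℂ S).topologicalClosure := by rw [hS]; trivial
  rw [HasSum, Metric.tendsto_nhds]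
  intro ε hε
  obtain ⟨y, hy, hxy⟩ := Metric.mem_closure_iff.1 hx (ε / 2) (half_pos hε)
  filter_upwards [(Metric.tendsto_nhds.1 (hSV hy : HasSum _ _)) (ε / 2) (half_pos hε)] with s hs
  rw [dist_comm, dist_eq_norm] at hs hxy ⊢
  have e : P x - ∑ i ∈ s, R i x = (P y - ∑ i ∈ s, R i y) - (P (y - x) - ∑ i ∈ s, R i (y - x)) := by
    simp only [map_sub, Finset.sum_sub_distrib]
    abel
  rw [e]
  calc _ ≤ _ := norm_sub_le _ _
    _ < ε / 2 + ε / 2 := add_lt_add hs ((hle s _).trans_lt hxy)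
    _ = ε := add_halves ε

/-- If the quadratic forms of projections add up to the quadratic form of a projection, then the
projections add up strongly. -/
theorem hasSum_of_hasSum_norm_sq (hP : IsOrthProj P) (hR : ∀ i, IsOrthProj (R i))
    (h : ∀ x, HasSum (fun i => ‖R i x‖ ^ 2) (‖P x‖ ^ 2)) (x : K) :
    HasSum (fun i => R i x) (P x) := by
  classical
  have hP2 : ∀ x, ‖P x‖ ^ 2 ≤ ‖x‖ ^ 2 := fun x => by
    have := hP.norm_le x
    gcongr
  refine hasSum_of_total hP hR (fun i j hij => apply_apply_eq_zero (hR j) fun x => ?_)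
    (fun i x => hP.apply_eq_self_of_norm_ge ?_) (S := Set.univ)
    (by rw [Submodule.span_univ]; exact top_le_iff.1 (Submodule.le_topologicalClosure _))
    (fun x _ => h x) x
  · have := sum_le_hasSum {i, j} (fun k _ => by positivity) (h x)
    rw [Finset.sum_pair hij] at this
    exact this.trans (hP2 x)
  · have := le_hasSum (h (R i x)) i (fun k _ => by positivity)
    rw [(hR i).idem] at this
    exact (sq_le_sq₀ (norm_nonneg _) (norm_nonneg _)).1 this

variable [CompleteSpace K]

/-- Projections whose quadratic forms are orthogonal have a sum. -/
theorem exists_of_hasSum {R : ℕ → K →L[ℂ] K} (hR : ∀ i, IsOrthProj (R i))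
    {q : K → ℝ} (hq : ∀ x, q x ≤ ‖x‖ ^ 2) (h : ∀ x, HasSum (fun i => ‖R i x‖ ^ 2) (q x)) :
    ∃ P : K →L[ℂ] K, IsOrthProj P ∧ ∀ x, ‖P x‖ ^ 2 = q x := by
  classical
  -- Two of the quadratic forms add up to at most `q x ≤ ‖x‖ ^ 2`, which forces orthogonality of the
  -- ranges.
  have ho : ∀ i j, i ≠ j → ∀ x, R i (R j x) = 0 := by
    refine fun i j hij => apply_apply_eq_zero (hR j) fun x => ?_
    have := sum_le_hasSum {i, j} (fun k _ => by positivity) (h x)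
    rw [Finset.sum_pair hij] at this
    exact this.trans (hq x)
  let S : ℕ → K →L[ℂ] K := fun n => ∑ i ∈ Finset.range n, R i
  have hS : ∀ n, IsOrthProj (S n) := fun n => finset_sum hR ho _
  have hSq : ∀ n x, inner ℂ x (S n x) = ((∑ i ∈ Finset.range n, ‖R i x‖ ^ 2 : ℝ) : ℂ) := by
    intro n x
    simp only [S, sum_apply, inner_sum, (hR _).inner_self]
    push_cast
    rfl
  have hlim : ∀ x, Tendsto (fun n => inner ℂ x (S n x)) atTop (𝓝 ((q x : ℝ) : ℂ)) := by
    intro x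
    simp only [hSq]
    exact (Complex.continuous_ofReal.tendsto _).comp (h x).tendsto_sum_nat
  obtain ⟨P, hP⟩ := exists_of_tendsto_quadraticForm S (C := 1) (fun n x => by
    rw [(hS n).inner_self, Complex.norm_real, Real.norm_of_nonneg (by positivity), one_mul]
    have := (hS n).norm_le x
    gcongr) hlim
  have hsymm : ∀ x y, inner ℂ (P x) y = inner ℂ x (P y) := by
    have : (P : K →ₗ[ℂ] K).IsSymmetric := by
      rw [LinearMap.isSymmetric_iff_inner_map_self_real]
      intro x
      rw [ContinuousLinearMap.coe_coe, inner_conj_symm, hP, ← inner_conj_symm, hP,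
        Complex.conj_ofReal]
    exact this
  have hw : ∀ x y, Tendsto (fun n => inner ℂ x (S n y)) atTop (𝓝 (inner ℂ x (P y))) :=
    tendsto_inner_of_quadraticForm fun x => by rw [hP]; exact hlim x
  -- The partial sums eventually contain `R n`, so the weak limit `P` satisfies `R n P = R n`.
  -- Summing gives `S n P = S n`, and in the limit `P P = P`.
  have hRP : ∀ n y, R n (P y) = R n y := by
    intro n y
    refine ext_inner_left ℂ fun x => ?_
    rw [← (hR n).symm]
    refine tendsto_nhds_unique (hw _ y) (tendsto_const_nhds.congr' ?_)
    filter_upwards [eventually_gt_atTop n] with N hN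
    rw [(hR n).symm]
    congr 1
    simp only [S, sum_apply, map_sum]
    rw [Finset.sum_eq_single n (fun j _ hj => ho _ _ hj.symm y)
      (fun h => (h (Finset.mem_range.2 hN)).elim), (hR n).idem]
  have hproj : IsOrthProj P := by
    refine ⟨fun y => ext_inner_left ℂ fun x => ?_, hsymm⟩
    refine tendsto_nhds_unique (hw x (P y)) ?_
    have : ∀ n, S n (P y) = S n y := fun n => by simp only [S, sum_apply, hRP]
    simp only [this]
    exact hw x y
  refine ⟨P, hproj, fun x => ?_⟩
  have := hP x
  rw [hproj.inner_self] at this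
  exact_mod_cast this

end IsOrthProj

/-- A projection-valued set function on a semiring of sets, which is countably additive. -/
structure IsSpectralContent {α : Type u} (C : Set (Set α)) {K : Type*} [NormedAddCommGroup K]
    [InnerProductSpace ℂ K] (P : Set α → K →L[ℂ] K) : Prop where
  semiring : IsSetSemiring C
  univ_mem : Set.univ ∈ C
  isOrthProj : ∀ s ∈ C, IsOrthProj (P s)
  univ : P Set.univ = 1
  iUnion : ∀ (ι : Type u) [Countable ι] (s : ι → Set α), (∀ i, s i ∈ C) →
    Pairwise (Function.onFun Disjoint s) → (⋃ i, s i) ∈ C →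
    ∀ x, HasSum (fun i => ‖P (s i) x‖ ^ 2) (‖P (⋃ i, s i) x‖ ^ 2)

namespace IsSpectralContent

variable {α : Type u} {C : Set (Set α)} {K : Type*} [NormedAddCommGroup K]
  [InnerProductSpace ℂ K] {P : Set α → K →L[ℂ] K}

theorem tsum_ofReal (h : IsSpectralContent C P) (x : K) {ι : Type u} [Countable ι]
    (s : ι → Set α) (hs : ∀ i, s i ∈ C) (hd : Pairwise (Function.onFun Disjoint s))
    (hU : (⋃ i, s i) ∈ C) :
    ENNReal.ofReal (‖P (⋃ i, s i) x‖ ^ 2) = ∑' i, ENNReal.ofReal (‖P (s i) x‖ ^ 2) := by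
  have h1 := h.iUnion ι s hs hd hU x
  rw [← h1.tsum_eq, ENNReal.ofReal_tsum_of_nonneg (fun i => by positivity) h1.summable]

/-- The scalar content `s ↦ ‖P s x‖ ^ 2`. -/
noncomputable def content (h : IsSpectralContent C P) (x : K) : AddContent ℝ≥0∞ C where
  toFun s := ENNReal.ofReal (‖P s x‖ ^ 2)
  empty' := by
    -- Additivity over the empty family gives the value at the empty set.
    have h1 := h.tsum_ofReal x (ι := PEmpty) (fun _ => ∅) (fun _ => h.semiring.empty_mem)
      (fun i => i.elim) (by simpa using h.semiring.empty_mem)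
    simpa using h1
  sUnion' := by
    intro I hI hd hU
    rw [Set.sUnion_eq_iUnion] at hU ⊢
    have h1 := h.tsum_ofReal x (ι := I) (fun i => (i : Set α)) (fun i => hI i.2)
      (fun i j hij => hd i.2 j.2 (fun e => hij (Subtype.ext e))) hU
    refine h1.trans ?_
    rw [tsum_fintype, Finset.sum_coe_sort I fun u => ENNReal.ofReal (‖P u x‖ ^ 2)]

theorem content_apply (h : IsSpectralContent C P) (x : K) (s : Set α) :
    h.content x s = ENNReal.ofReal (‖P s x‖ ^ 2) := rfl

/-- Disjointification inside the semiring: each `f i` minus the earlier sets is a finite disjoint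
union of members of `C`. All these pieces form one countable partition of the union, and those
coming from `f i` weigh at most as much as `f i`. -/
theorem isSigmaSubadditive (h : IsSpectralContent C P) (x : K) :
    (h.content x).IsSigmaSubadditive := by
  classical
  intro f hf hU
  have hJ : ∀ i, (↑((Finset.range i).image f) : Set (Set α)) ⊆ C := by
    intro i s hs
    obtain ⟨j, -, rfl⟩ := Finset.mem_image.1 hs
    exact hf j
  let A : ℕ → Finset (Set α) := fun i => h.semiring.disjointOfDiffUnion (hf i) (hJ i)
  have hA : ∀ i, f i \ ⋃₀ ↑((Finset.range i).image f) = ⋃₀ ↑(A i) := fun i =>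
    h.semiring.sdiff_sUnion_eq_sUnion_disjointOfDiffUnion (hf i) (hJ i)
  have hAC : ∀ i, ↑(A i) ⊆ C := fun i => h.semiring.disjointOfDiffUnion_subset (hf i) (hJ i)
  have hAf : ∀ i, ∀ s ∈ A i, s ⊆ f i := fun i s hs =>
    h.semiring.subset_of_mem_disjointOfDiffUnion (hf i) (hJ i) s hs
  have hAd : ∀ i, ((A i : Set (Set α))).PairwiseDisjoint id := fun i =>
    h.semiring.pairwiseDisjoint_disjointOfDiffUnion (hf i) (hJ i)
  have hAlt : ∀ i j, i < j → ∀ s ∈ A i, ∀ t ∈ A j, Disjoint s t := by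
    intro i j hij s hs t ht
    refine Disjoint.mono (hAf i s hs) (Set.subset_sUnion_of_mem (Finset.mem_coe.2 ht)) ?_
    rw [← hA j]
    refine Set.disjoint_sdiff_right.mono_left ?_
    exact Set.subset_sUnion_of_mem
      (Finset.mem_coe.2 (Finset.mem_image_of_mem f (Finset.mem_range.2 hij)))
  let g : (Σ i : ℕ, ↥(A i)) → Set α := fun p => p.2
  have hgd : Pairwise (Function.onFun Disjoint g) := by
    rintro ⟨i, s, hs⟩ ⟨j, t, ht⟩ hne
    rcases lt_trichotomy i j with hij | rfl | hij
    · exact hAlt i j hij s hs t ht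
    · exact hAd i hs ht (fun e => hne (by subst e; rfl))
    · exact (hAlt j i hij t ht s hs).symm
  have hgU : ⋃ p, g p = ⋃ i, f i := by
    apply Set.Subset.antisymm
    · refine Set.iUnion_subset fun p => ?_
      exact (hAf p.1 p.2 p.2.2).trans (Set.subset_iUnion f p.1)
    · intro y hy
      obtain ⟨i, hi⟩ := Set.mem_iUnion.1 hy
      have hex : ∃ i, y ∈ f i := ⟨i, hi⟩
      have h1 : y ∈ f (Nat.find hex) \ ⋃₀ ↑((Finset.range (Nat.find hex)).image f) := by
        refine ⟨Nat.find_spec hex, ?_⟩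
        rintro ⟨s, hs, hys⟩
        obtain ⟨j, hj, rfl⟩ := Finset.mem_image.1 (Finset.mem_coe.1 hs)
        exact Nat.find_min hex (Finset.mem_range.1 hj) hys
      rw [hA] at h1
      obtain ⟨s, hs, hys⟩ := h1
      exact Set.mem_iUnion.2 ⟨⟨_, s, hs⟩, hys⟩
  have key := h.tsum_ofReal x g (fun p => hAC p.1 p.2.2) hgd (hgU ▸ hU)
  rw [hgU] at key
  rw [content_apply, key,
    ENNReal.tsum_sigma fun i (u : ↥(A i)) => ENNReal.ofReal (‖P (u : Set α) x‖ ^ 2)]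
  refine ENNReal.tsum_le_tsum fun i => ?_
  rw [tsum_fintype]
  refine le_of_eq_of_le ?_ (sum_addContent_le_of_subset (m := h.content x) h.semiring (hAC i)
    (hAd i) (hf i) (hAf i))
  rw [Finset.sum_coe_sort (A i) fun u => ENNReal.ofReal (‖P u x‖ ^ 2)]
  rfl

/-- A countably additive projection-valued set function on a semiring extends to a spectral
measure on the generated sigma-algebra. -/
theorem exists_spectralMeasure [CompleteSpace K] [hα : MeasurableSpace α]
    (h : IsSpectralContent C P) (hC : hα = MeasurableSpace.generateFrom C) :
    ∃ E : SpectralMeasure α K, ∀ s ∈ C, E.proj s = P s := by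
  let m : K → Measure α := fun x =>
    (h.content x).measure h.semiring hC.le (h.isSigmaSubadditive x)
  have hm : ∀ x, ∀ s ∈ C, m x s = ENNReal.ofReal (‖P s x‖ ^ 2) := fun x s hs =>
    (h.content x).measure_eq h.semiring hC (h.isSigmaSubadditive x) hs
  have hmu : ∀ x, m x Set.univ = ENNReal.ofReal (‖x‖ ^ 2) := fun x => by
    rw [hm x _ h.univ_mem, h.univ, one_apply_eq_self]
  have hfin : ∀ x, IsFiniteMeasure (m x) := fun x =>
    ⟨by rw [hmu]; exact ENNReal.ofReal_lt_top⟩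
  have hmur : ∀ x, (m x).real Set.univ = ‖x‖ ^ 2 := fun x => by
    rw [measureReal_def, hmu, ENNReal.toReal_ofReal (by positivity)]
  have hsum : ∀ (s : ℕ → Set α), (∀ n, MeasurableSet (s n)) →
      Pairwise (Function.onFun Disjoint s) → ∀ x,
      HasSum (fun n => (m x).real (s n)) ((m x).real (⋃ n, s n)) := by
    intro s hs hd x
    have h1 := measure_iUnion (μ := m x) hd hs
    have h2 := ENNReal.hasSum_toReal (h1 ▸ measure_ne_top (m x) _)
    rw [← ENNReal.tsum_toReal_eq (fun n => measure_ne_top (m x) _), ← h1] at h2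
    exact h2
  -- A π-λ argument: the sets `s` for which `x ↦ m x s` is the quadratic form of an orthogonal
  -- projection contain `C` and are closed under complements and countable disjoint unions.
  have main : ∀ s, MeasurableSet s →
      ∃ T : K →L[ℂ] K, IsOrthProj T ∧ ∀ x, ‖T x‖ ^ 2 = (m x).real s := by
    intro s hs
    induction s, hs using MeasurableSpace.induction_on_inter hC h.semiring.isPiSystem with
    | empty => exact ⟨0, IsOrthProj.zero, fun x => by simp⟩
    | basic s hs =>
      refine ⟨P s, h.isOrthProj s hs, fun x => ?_⟩
      rw [measureReal_def, hm x s hs, ENNReal.toReal_ofReal (by positivity)]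
    | compl s hs ih =>
      obtain ⟨T, hT, hTm⟩ := ih
      refine ⟨1 - T, hT.one_sub, fun x => ?_⟩
      -- Pythagoras with a single summand: `‖x - T x‖² = ‖x‖² - ‖T x‖²`.
      have e := IsOrthProj.norm_sub_sum_sq (P := (1 : K →L[ℂ] K)) (R := fun _ : Unit => T)
        ⟨fun x => rfl, fun x y => rfl⟩ (fun _ => hT) (fun i j hij => (hij rfl).elim)
        (fun _ _ => rfl) Finset.univ x
      simp only [Finset.univ_unique, Finset.sum_singleton, one_apply_eq_self] at e
      rw [sub_apply, one_apply_eq_self, e, hTm, measureReal_compl hs, hmur]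
    | iUnion f hd hf ih =>
      choose T hT hTm using ih
      obtain ⟨S, hS, hSm⟩ := IsOrthProj.exists_of_hasSum hT
        (q := fun x => (m x).real (⋃ n, f n)) (fun x => by
          rw [← hmur]
          exact measureReal_mono (Set.subset_univ _))
        (fun x => by simpa only [hTm] using hsum f hf hd x)
      exact ⟨S, hS, hSm⟩
  choose T hT hTm using main
  classical
  -- The values on nonmeasurable sets play no role and are set to 0.
  have hp : ∀ s (hs : MeasurableSet s), (if h : MeasurableSet s then T s h else 0) = T s hs :=
    fun s hs => dif_pos hs
  refine ⟨⟨fun s => if h : MeasurableSet s then T s h else 0, ?_, ?_, ?_, ?_⟩, ?_⟩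
  · intro s hs
    rw [hp s hs]
    exact (hT s hs).idem
  · intro s hs
    rw [hp s hs]
    exact (hT s hs).symm
  · rw [hp _ MeasurableSet.univ]
    ext x
    refine (hT _ MeasurableSet.univ).apply_eq_self_of_norm_ge ?_
    refine (sq_le_sq₀ (norm_nonneg _) (norm_nonneg _)).1 ?_
    rw [hTm, hmur]
  · intro s hs hd x
    rw [hp _ (MeasurableSet.iUnion hs)]
    simp only [hp _ (hs _)]
    refine (hT _ _).hasSum_of_hasSum_norm_sq (fun n => hT _ (hs n)) (fun x => ?_) x
    simp only [hTm]
    exact hsum s hs hd x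
  · intro s hs
    have hs' : MeasurableSet s := by
      rw [hC]
      exact MeasurableSpace.measurableSet_generateFrom hs
    simp only [hp s hs']
    refine ContinuousLinearMap.ext_quadraticForm fun x => ?_
    rw [(hT s hs').inner_self, (h.isOrthProj s hs).inner_self, hTm, measureReal_def, hm x s hs,
      ENNReal.toReal_ofReal (by positivity)]

end IsSpectralContent

/-! ### The product of two spectral measures, acting on the Hilbert-Schmidt class -/

section ProductSpectralMeasure

variable {H : Type*} [NormedAddCommGroup H] [InnerProductSpace ℂ H] [CompleteSpace H]
  {X Y : Type*} [MeasurableSpace X] [MeasurableSpace Y]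

/-- The measurable rectangles. -/
def measurableRectangles (X Y : Type*) [MeasurableSpace X] [MeasurableSpace Y] :
    Set (Set (X × Y)) :=
  Set.image2 (fun s t => s ×ˢ t) {s | MeasurableSet s} {t | MeasurableSet t}

theorem isSetSemiring_measurableRectangles : IsSetSemiring (measurableRectangles X Y) where
  empty_mem := ⟨∅, MeasurableSet.empty, ∅, MeasurableSet.empty, by simp⟩
  inter_mem := by
    rintro _ ⟨s, hs, t, ht, rfl⟩ _ ⟨s', hs', t', ht', rfl⟩
    exact ⟨s ∩ s', MeasurableSet.inter hs hs', t ∩ t', MeasurableSet.inter ht ht',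
      Set.prod_inter_prod.symm⟩
  sdiff_eq_sUnion' := by
    classical
    rintro _ ⟨s, hs, t, ht, rfl⟩ _ ⟨s', hs', t', ht', rfl⟩
    refine ⟨{(s \ s') ×ˢ t, (s ∩ s') ×ˢ (t \ t')}, ?_, ?_, ?_⟩
    · intro u hu
      simp only [Finset.coe_insert, Finset.coe_singleton, Set.mem_insert_iff,
        Set.mem_singleton_iff] at hu
      rcases hu with rfl | rfl
      · exact ⟨_, MeasurableSet.diff hs hs', _, ht, rfl⟩
      · exact ⟨_, MeasurableSet.inter hs hs', _, MeasurableSet.diff ht ht', rfl⟩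
    · have hd : Disjoint ((s \ s') ×ˢ t) ((s ∩ s') ×ˢ (t \ t')) :=
        Set.disjoint_prod.2 (Or.inl Set.disjoint_sdiff_inter)
      rw [Finset.coe_insert, Finset.coe_singleton]
      exact (Set.pairwiseDisjoint_singleton _ _).insert fun u hu _ => by
        rw [Set.mem_singleton_iff.1 hu]
        exact hd
    · ext ⟨x, y⟩
      simp only [Set.mem_sdiff, Set.mem_prod, Finset.coe_insert, Finset.coe_singleton,
        Set.sUnion_insert, Set.sUnion_singleton, Set.mem_union, Set.mem_inter_iff]
      tauto

open HilbertSchmidt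

variable (E₁ : SpectralMeasure X H) (E₂ : SpectralMeasure Y H)

/-- The transformer `Q ↦ E₁(Λ) Q E₂(Δ)` of the rectangle `Λ × Δ`. -/
noncomputable def rectangleProj (R : Set (X × Y)) : HilbertSchmidt H →L[ℂ] HilbertSchmidt H :=
  sandwich (E₁.proj (Prod.fst '' R)) (E₂.proj (Prod.snd '' R))

theorem SpectralMeasure.adjoint_proj (E : SpectralMeasure X H) {s : Set X} (hs : MeasurableSet s) :
    (E.proj s).adjoint = E.proj s := by
  ext y
  refine ext_inner_left ℂ fun x => ?_
  rw [ContinuousLinearMap.adjoint_inner_right, E.symm s hs]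

theorem rectangleProj_prod (s : Set X) (t : Set Y) :
    rectangleProj E₁ E₂ (s ×ˢ t) = sandwich (E₁.proj s) (E₂.proj t) := by
  rw [rectangleProj]
  -- If one factor is empty, the images of the rectangle do not recover the other factor; both sides
  -- are then 0.
  rcases s.eq_empty_or_nonempty with rfl | hs
  · ext Q x
    simp [E₁.proj_empty]
  rcases t.eq_empty_or_nonempty with rfl | ht
  · ext Q x
    simp [E₂.proj_empty]
  rw [Set.fst_image_prod s ht, Set.snd_image_prod hs t]

theorem rectangleProj_comp {R R' : Set (X × Y)} (hR : R ∈ measurableRectangles X Y)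
    (hR' : R' ∈ measurableRectangles X Y) (Q : HilbertSchmidt H) :
    rectangleProj E₁ E₂ R (rectangleProj E₁ E₂ R' Q) = rectangleProj E₁ E₂ (R ∩ R') Q := by
  obtain ⟨s, hs, t, ht, rfl⟩ := hR
  obtain ⟨s', hs', t', ht', rfl⟩ := hR'
  simp only [Set.prod_inter_prod, rectangleProj_prod]
  ext x
  simp only [toCLM_sandwich, ContinuousLinearMap.comp_apply]
  rw [E₁.proj_proj hs hs', E₂.proj_proj ht' ht, Set.inter_comm t']

theorem isOrthProj_rectangleProj {R : Set (X × Y)} (hR : R ∈ measurableRectangles X Y) :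
    IsOrthProj (rectangleProj E₁ E₂ R) := by
  refine ⟨fun Q => by rw [rectangleProj_comp E₁ E₂ hR hR, Set.inter_self], fun P Q => ?_⟩
  obtain ⟨s, hs, t, ht, rfl⟩ := hR
  rw [rectangleProj_prod, inner_sandwich, E₁.adjoint_proj hs, E₂.adjoint_proj ht]

theorem norm_sq_rectangleProj_rankOne {R : Set (X × Y)} (hR : R ∈ measurableRectangles X Y)
    (a b : H) : ‖rectangleProj E₁ E₂ R (rankOne a b)‖ ^ 2
      = ((E₁.scalarMeasure a).prod (E₂.scalarMeasure b)).real R := by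
  obtain ⟨s, hs, t, ht, rfl⟩ := hR
  rw [rectangleProj_prod, sandwich_rankOne, E₂.adjoint_proj ht, norm_rankOne, mul_pow,
    measureReal_prod_prod, E₁.measureReal_scalarMeasure hs, E₂.measureReal_scalarMeasure ht]

/-- The point is countable additivity. On a rank one operator made of `a` and `b`, the quadratic
form of a rectangle is its mass under the product of the scalar measures of `a` and `b`, which is
countably additive. Rank one operators being total, `hasSum_of_total` extends this to the whole
Hilbert-Schmidt class. -/
theorem isSpectralContent_rectangleProj :
    IsSpectralContent (measurableRectangles X Y) (rectangleProj E₁ E₂) where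
  semiring := isSetSemiring_measurableRectangles
  univ_mem := ⟨Set.univ, MeasurableSet.univ, Set.univ, MeasurableSet.univ, Set.univ_prod_univ⟩
  isOrthProj R hR := isOrthProj_rectangleProj E₁ E₂ hR
  univ := by
    rw [← Set.univ_prod_univ, rectangleProj_prod, E₁.univ, E₂.univ]
    ext Q x
    simp
  iUnion := by
    intro ι _ R hR hd hU Q
    have h : HasSum (fun i => rectangleProj E₁ E₂ (R i) Q) (rectangleProj E₁ E₂ (⋃ i, R i) Q) := by
      refine (isOrthProj_rectangleProj E₁ E₂ hU).hasSum_of_total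
        (fun i => isOrthProj_rectangleProj E₁ E₂ (hR i)) (fun i j hij P => ?_) (fun i P => ?_)
        topologicalClosure_span_rankOne ?_ Q
      · rw [rectangleProj_comp E₁ E₂ (hR i) (hR j), (hd hij).inter_eq]
        have := rectangleProj_prod E₁ E₂ ∅ ∅
        rw [Set.empty_prod] at this
        rw [this]
        ext x
        simp [E₁.proj_empty]
      · rw [rectangleProj_comp E₁ E₂ hU (hR i),
          Set.inter_eq_self_of_subset_right (Set.subset_iUnion R i)]
      · rintro _ ⟨⟨a, b⟩, rfl⟩
        simp only [norm_sq_rectangleProj_rankOne E₁ E₂ (hR _),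
          norm_sq_rectangleProj_rankOne E₁ E₂ hU]
        have hm : ∀ i, MeasurableSet (R i) := by
          intro i
          obtain ⟨s, hs, t, ht, e⟩ := hR i
          rw [← e]
          exact MeasurableSet.prod hs ht
        have h1 := measure_iUnion (μ := (E₁.scalarMeasure a).prod (E₂.scalarMeasure b)) hd hm
        have h2 := ENNReal.hasSum_toReal (h1 ▸ measure_ne_top _ _)
        rwa [← ENNReal.tsum_toReal_eq (fun n => measure_ne_top _ _), ← h1] at h2
    have h' := (h.mapL (innerSL ℂ Q)).mapL Complex.reCLM
    simp only [innerSL_apply_apply, Complex.reCLM_apply,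
      (isOrthProj_rectangleProj E₁ E₂ hU).inner_self,
      (isOrthProj_rectangleProj E₁ E₂ (hR _)).inner_self, Complex.ofReal_re] at h'
    exact h'

/-- The product of two spectral measures exists. -/
theorem exists_isProductSpectralMeasure :
    ∃ E : SpectralMeasure (X × Y) (HilbertSchmidt H), IsProductSpectralMeasure E₁ E₂ E := by
  obtain ⟨E, hE⟩ := (isSpectralContent_rectangleProj E₁ E₂).exists_spectralMeasure
    generateFrom_prod.symm
  refine ⟨E, fun s t hs ht Q => ?_⟩
  rw [hE _ ⟨s, hs, t, ht, rfl⟩]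
  change (rectangleProj E₁ E₂ (s ×ˢ t) Q).toCLM = _
  rw [rectangleProj_prod, toCLM_sandwich]

variable {E₁ E₂} {E : SpectralMeasure (X × Y) (HilbertSchmidt H)}

theorem BddMeasurable.tensor {φ : X → ℂ} {ψ : Y → ℂ} (hφ : BddMeasurable φ)
    (hψ : BddMeasurable ψ) : BddMeasurable fun p : X × Y => φ p.1 * ψ p.2 := by
  obtain ⟨C, hC⟩ := hφ.2
  obtain ⟨D, hD⟩ := hψ.2
  exact BddMeasurable.mul (f := fun p : X × Y => φ p.1) (g := fun p : X × Y => ψ p.2)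
    ⟨hφ.1.comp measurable_fst, C, fun p => hC p.1⟩ ⟨hψ.1.comp measurable_snd, D, fun p => hD p.2⟩

theorem inner_rankOne_integral_indicator_tensor (hE : IsProductSpectralMeasure E₁ E₂ E)
    (c : ℂ) {s : Set X} (hs : MeasurableSet s) {ψ : Y → ℂ} (hψ : BddMeasurable ψ)
    (Q : HilbertSchmidt H) (a b : H) :
    inner ℂ (rankOne a b) (E.integral (fun p => s.indicator (fun _ => c) p.1 * ψ p.2) Q)
      = inner ℂ (rankOne a b)
        (sandwich (E₁.integral (s.indicator fun _ => c)) (E₂.integral ψ) Q) := by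
  have hφ := BddMeasurable.indicator_const c hs
  simp only [inner_rankOne, toCLM_sandwich, ContinuousLinearMap.comp_apply]
  induction hψ using BddMeasurable.induction with
  | indicator d t ht =>
    have e : (fun p : X × Y => s.indicator (fun _ => c) p.1 * t.indicator (fun _ => d) p.2)
        = (s ×ˢ t).indicator fun _ => c * d := by
      ext ⟨x, y⟩
      by_cases hx : x ∈ s <;> by_cases hy : y ∈ t <;> simp [hx, hy]
    rw [e, E.integral_indicator _ (hs.prod ht), E₁.integral_indicator _ hs,
      E₂.integral_indicator _ ht]
    simp only [FunLike.coe_smul, Pi.smul_apply, toCLM_smul, hE s t hs ht,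
      ContinuousLinearMap.comp_apply, inner_smul_right, map_smul]
    ring
  | add f g hf hg h₁ h₂ =>
    have e : (fun p : X × Y => s.indicator (fun _ => c) p.1 * (f + g) p.2)
        = (fun p : X × Y => s.indicator (fun _ => c) p.1 * f p.2)
          + fun p : X × Y => s.indicator (fun _ => c) p.1 * g p.2 := by
      ext p
      simp [mul_add]
    rw [e, E.integral_add (hφ.tensor hf) (hφ.tensor hg), E₂.integral_add hf hg]
    simp only [add_apply, toCLM_add, map_add, inner_add_right, h₁, h₂]
  | lim F f C hF hf hC h hp =>
    have l1 := E.tendsto_inner_integral (C := ‖c‖ * C) (fun n => hφ.tensor (hF n)) (hφ.tensor hf)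
      (fun n p => by
        rw [norm_mul]
        exact mul_le_mul (norm_indicator_le_norm_self (fun _ => c) p.1) (hC n p.2) (norm_nonneg _)
          (norm_nonneg _)) (fun p => (h p.2).const_mul _) (rankOne a b) Q
    simp only [inner_rankOne] at l1
    refine tendsto_nhds_unique l1 ?_
    simp only [hp]
    have l2 := E₂.tendsto_inner_integral hF hf hC h
      (((E₁.integral (s.indicator fun _ => c)) ∘L Q.toCLM).adjoint a) b
    simpa only [ContinuousLinearMap.adjoint_inner_left, ContinuousLinearMap.comp_apply] using l2

/-- Approximation in one variable at a time: the preceding lemma has an indicator in the first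
variable and varies `ψ`; here `φ` varies. In both, only weak convergence is used. -/
theorem integral_tensor (hE : IsProductSpectralMeasure E₁ E₂ E) {φ : X → ℂ} {ψ : Y → ℂ}
    (hφ : BddMeasurable φ) (hψ : BddMeasurable ψ) (Q : HilbertSchmidt H) :
    E.integral (fun p => φ p.1 * ψ p.2) Q = sandwich (E₁.integral φ) (E₂.integral ψ) Q := by
  refine ext_inner_rankOne fun a b => ?_
  induction hφ using BddMeasurable.induction with
  | indicator c s hs => exact inner_rankOne_integral_indicator_tensor hE c hs hψ Q a b
  | add f g hf hg h₁ h₂ =>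
    have e : (fun p : X × Y => (f + g) p.1 * ψ p.2)
        = (fun p : X × Y => f p.1 * ψ p.2) + fun p : X × Y => g p.1 * ψ p.2 := by
      ext p
      simp [add_mul]
    rw [e, E.integral_add (hf.tensor hψ) (hg.tensor hψ), E₁.integral_add hf hg]
    simp only [add_apply, inner_add_right, h₁, h₂]
    simp only [inner_rankOne, toCLM_sandwich, ContinuousLinearMap.comp_apply, add_apply,
      inner_add_right]
  | lim F f C hF hf hC h hp =>
    obtain ⟨D, hD⟩ := hψ.2
    have l1 := E.tendsto_inner_integral (C := C * D) (fun n => (hF n).tensor hψ) (hf.tensor hψ)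
      (fun n p => by
        rw [norm_mul]
        exact mul_le_mul (hC n p.1) (hD p.2) (norm_nonneg _) ((norm_nonneg _).trans (hC n p.1)))
      (fun p => (h p.1).mul_const _) (rankOne a b) Q
    refine tendsto_nhds_unique l1 ?_
    simp only [hp]
    simp only [inner_rankOne, toCLM_sandwich, ContinuousLinearMap.comp_apply]
    exact E₁.tendsto_inner_integral hF hf hC h a _

end ProductSpectralMeasure

/-! ### The trace norm of double operator integrals -/

/-- `∑ |φ n x|²` converges and is at most `M²`, for all `x`. -/
def SquareSumLE {X : Type*} (φ : ℕ → X → ℂ) (M : ℝ) : Prop :=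
  ∀ x, (Summable fun n => ‖φ n x‖ ^ 2) ∧ ∑' n, ‖φ n x‖ ^ 2 ≤ M ^ 2

section TraceNorm

variable {X Y : Type*} {φ : ℕ → X → ℂ} {ψ : ℕ → Y → ℂ} {M N : ℝ}

theorem SquareSumLE.norm_le (h : SquareSumLE φ M) (hM : 0 ≤ M) (n : ℕ) (x : X) :
    ‖φ n x‖ ≤ M := by
  refine (sq_le_sq₀ (norm_nonneg _) hM).1 (le_trans ?_ (h x).2)
  exact (h x).1.le_tsum n fun _ _ => by positivity

theorem SquareSumLE.summable_mul (hφ : SquareSumLE φ M) (hψ : SquareSumLE ψ N) (hM : 0 ≤ M)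
    (hN : 0 ≤ N) (x : X) (y : Y) : (Summable fun n => ‖φ n x‖ * ‖ψ n y‖) ∧
      ∑' n, ‖φ n x‖ * ‖ψ n y‖ ≤ M * N := by
  have h := summable_mul_and_tsum_mul_le (fun n => norm_nonneg (φ n x))
    (fun n => norm_nonneg (ψ n y)) (hφ x).1 (hψ y).1
  refine ⟨h.1, h.2.trans ?_⟩
  gcongr
  · exact (Real.sqrt_le_sqrt (hφ x).2).trans_eq (Real.sqrt_sq hM)
  · exact (Real.sqrt_le_sqrt (hψ y).2).trans_eq (Real.sqrt_sq hN)

theorem SquareSumLE.bddMeasurable [MeasurableSpace X] (h : SquareSumLE φ M) (hM : 0 ≤ M)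
    (hφ : ∀ n, Measurable (φ n))
    (n : ℕ) : BddMeasurable (φ n) :=
  ⟨hφ n, M, h.norm_le hM n⟩

end TraceNorm

section TraceNorm

variable {X Y : Type*} {φ : ℕ → X → ℂ} {ψ : ℕ → Y → ℂ} {M N : ℝ}

theorem tsum_enorm_mul_enorm_le {V W : Type*} [SeminormedAddCommGroup V]
    [SeminormedAddCommGroup W] {f : ℕ → V} {g : ℕ → W} {A B : ℝ} (hA : 0 ≤ A) (hB : 0 ≤ B)
    (hf : (Summable fun n => ‖f n‖ ^ 2) ∧ ∑' n, ‖f n‖ ^ 2 ≤ A ^ 2)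
    (hg : (Summable fun n => ‖g n‖ ^ 2) ∧ ∑' n, ‖g n‖ ^ 2 ≤ B ^ 2) :
    ∑' n, ‖f n‖ₑ * ‖g n‖ₑ ≤ ENNReal.ofReal A * ENNReal.ofReal B := by
  have h := summable_mul_and_tsum_mul_le (fun n => norm_nonneg (f n))
    (fun n => norm_nonneg (g n)) hf.1 hg.1
  have e := ENNReal.ofReal_tsum_of_nonneg (fun n => by positivity) h.1
  simp only [ENNReal.ofReal_mul (norm_nonneg _), ofReal_norm] at e
  rw [← e, ← ENNReal.ofReal_mul hA]
  refine ENNReal.ofReal_le_ofReal (h.2.trans ?_)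
  gcongr
  · exact (Real.sqrt_le_sqrt hf.2).trans_eq (Real.sqrt_sq hA)
  · exact (Real.sqrt_le_sqrt hg.2).trans_eq (Real.sqrt_sq hB)

theorem SquareSumLE.conj (h : SquareSumLE φ M) :
    SquareSumLE (fun n x => starRingEnd ℂ (φ n x)) M := fun x => by
  simpa using h x

variable {H : Type*} [NormedAddCommGroup H] [InnerProductSpace ℂ H] [CompleteSpace H]
  [MeasurableSpace X] [MeasurableSpace Y]

/-- A finite sum can be taken inside the scalar integral of `norm_sq_integral`, where the pointwise
bound `M ^ 2` applies; the total mass is `‖a‖ ^ 2`. -/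
theorem SpectralMeasure.norm_sq_integral_sum_le (E : SpectralMeasure X H) (h : SquareSumLE φ M)
    (hM : 0 ≤ M) (hφ : ∀ n, Measurable (φ n)) (a : H) :
    (Summable fun n => ‖E.integral (φ n) a‖ ^ 2) ∧
      ∑' n, ‖E.integral (φ n) a‖ ^ 2 ≤ (M * ‖a‖) ^ 2 := by
  have hb := h.bddMeasurable hM hφ
  have key : ∀ s : Finset ℕ, ∑ n ∈ s, ‖E.integral (φ n) a‖ ^ 2 ≤ (M * ‖a‖) ^ 2 := by
    intro s
    have hi : ∀ n, Integrable (fun t => ‖φ n t‖ ^ 2) (E.scalarMeasure a) := fun n =>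
      Integrable.of_bound ((hφ n).norm.pow_const 2).aestronglyMeasurable (M ^ 2)
        (Eventually.of_forall fun t => by
          have := h.norm_le hM n t
          rw [norm_pow, norm_norm]
          gcongr)
    simp only [fun n => E.norm_sq_integral (hb n) a]
    rw [← integral_finsetSum _ fun n _ => hi n]
    have h1 : ∫ t, ∑ n ∈ s, ‖φ n t‖ ^ 2 ∂(E.scalarMeasure a)
        ≤ ∫ _, M ^ 2 ∂(E.scalarMeasure a) := by
      refine integral_mono (integrable_finsetSum _ fun n _ => hi n) (integrable_const _) fun t => ?_
      exact ((h t).1.sum_le_tsum s fun _ _ => by positivity).trans (h t).2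
    refine h1.trans_eq ?_
    rw [integral_const, E.measureReal_scalarMeasure MeasurableSet.univ, E.univ, smul_eq_mul,
      one_apply_eq_self]
    ring
  have hs := summable_of_sum_le (fun n => by positivity) key
  exact ⟨hs, hs.tsum_le_of_sum_le key⟩

open HilbertSchmidt

variable {E₁ : SpectralMeasure X H} {E₂ : SpectralMeasure Y H}
  {E : SpectralMeasure (X × Y) (HilbertSchmidt H)} {Φ : X × Y → ℂ}

/-- The double operator integral of `∑ φ n x * ψ n y` is the sum of the double operator integrals
of the terms. -/
theorem tendsto_inner_sum_integral (hE : IsProductSpectralMeasure E₁ E₂ E)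
    (hφ : ∀ n, Measurable (φ n)) (hψ : ∀ n, Measurable (ψ n)) (hM : 0 ≤ M) (hN : 0 ≤ N)
    (hφM : SquareSumLE φ M) (hψN : SquareSumLE ψ N) (hΦ : BddMeasurable Φ)
    (hsum : ∀ x y, HasSum (fun n => φ n x * ψ n y) (Φ (x, y))) (Q : HilbertSchmidt H) (x y : H) :
    Tendsto (fun n => ∑ i ∈ Finset.range n,
      inner ℂ y (E₁.integral (φ i) (Q.toCLM (E₂.integral (ψ i) x)))) atTop
      (𝓝 (inner ℂ y ((E.integral Φ Q).toCLM x))) := by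
  have hφb := hφM.bddMeasurable hM hφ
  have hψb := hψN.bddMeasurable hN hψ
  let F : ℕ → X × Y → ℂ := fun n => ∑ i ∈ Finset.range n, fun p => φ i p.1 * ψ i p.2
  have hF : ∀ n, BddMeasurable (F n) := fun n =>
    BddMeasurable.finset_sum _ fun i _ => (hφb i).tensor (hψb i)
  have hFM : ∀ n p, ‖F n p‖ ≤ M * N := by
    intro n p
    have h := summable_mul_and_tsum_mul_le (fun n => norm_nonneg (φ n p.1))
      (fun n => norm_nonneg (ψ n p.2)) (hφM _).1 (hψN _).1
    simp only [F, Finset.sum_apply]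
    refine (norm_sum_le _ _).trans ?_
    simp only [norm_mul]
    refine (h.1.sum_le_tsum _ fun _ _ => by positivity).trans (h.2.trans ?_)
    gcongr
    · exact (Real.sqrt_le_sqrt (hφM _).2).trans_eq (Real.sqrt_sq hM)
    · exact (Real.sqrt_le_sqrt (hψN _).2).trans_eq (Real.sqrt_sq hN)
  have h := E.tendsto_inner_integral hF hΦ hFM (fun p => by
    simp only [F, Finset.sum_apply]
    exact (hsum p.1 p.2).tendsto_sum_nat) (rankOne y x) Q
  rw [inner_rankOne] at h
  refine h.congr fun n => ?_
  simp only [F]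
  rw [E.integral_sum _ fun i _ => (hφb i).tensor (hψb i), sum_apply, inner_sum]
  refine Finset.sum_congr rfl fun i _ => ?_
  rw [integral_tensor hE (hφb i) (hψb i), inner_rankOne]
  rfl

/-- With `Aₙ = ∫ φₙ dE₁` and `Bₙ = ∫ ψₙ dE₂`, the operator is represented by the double family of
rank one terms with vectors `Aₙ aₖ` and `Bₙ* bₖ`. For fixed `k`, Cauchy-Schwarz in `n` bounds the
sum of the products of norms by `M N ‖aₖ‖ ‖bₖ‖`. -/
theorem traceNorm_integral_le (hE : IsProductSpectralMeasure E₁ E₂ E)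
    (hφ : ∀ n, Measurable (φ n)) (hψ : ∀ n, Measurable (ψ n)) (hM : 0 ≤ M) (hN : 0 ≤ N)
    (hφM : SquareSumLE φ M) (hψN : SquareSumLE ψ N) (hΦ : BddMeasurable Φ)
    (hsum : ∀ x y, HasSum (fun n => φ n x * ψ n y) (Φ (x, y))) (Q : HilbertSchmidt H)
    {a b : ℕ → H} (hQ : ∀ x, HasSum (fun k => inner ℂ (b k) x • a k) (Q.toCLM x))
    (hab : ∑' k, ‖a k‖ₑ * ‖b k‖ₑ ≠ ∞) :
    traceNorm (E.integral Φ Q).toCLM ≤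
      ENNReal.ofReal M * ENNReal.ofReal N * ∑' k, ‖a k‖ₑ * ‖b k‖ₑ := by
  have hφb := hφM.bddMeasurable hM hφ
  have hψb := hψN.bddMeasurable hN hψ
  let α : ℕ × ℕ → H := fun p => E₁.integral (φ p.1) (a p.2)
  let β : ℕ × ℕ → H := fun p => (E₂.integral (ψ p.1)).adjoint (b p.2)
  have hle : ∑' p, ‖α p‖ₑ * ‖β p‖ₑ
      ≤ ENNReal.ofReal M * ENNReal.ofReal N * ∑' k, ‖a k‖ₑ * ‖b k‖ₑ := by
    rw [ENNReal.tsum_prod', ENNReal.tsum_comm, ← ENNReal.tsum_mul_left]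
    refine ENNReal.tsum_le_tsum fun k => ?_
    have h1 := E₁.norm_sq_integral_sum_le hφM hM hφ (a k)
    have h2 := E₂.norm_sq_integral_sum_le hψN.conj hN
      (fun n => Complex.continuous_conj.measurable.comp (hψ n)) (b k)
    simp only [← fun n => E₂.adjoint_integral (hψb n)] at h2
    refine (tsum_enorm_mul_enorm_le (by positivity) (by positivity) h1 h2).trans_eq ?_
    rw [ENNReal.ofReal_mul hM, ENNReal.ofReal_mul hN, ofReal_norm, ofReal_norm]
    ring
  have hfin : ∑' p, ‖α p‖ₑ * ‖β p‖ₑ ≠ ∞ := by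
    refine (hle.trans_lt ?_).ne
    exact ENNReal.mul_lt_top (by finiteness) hab.lt_top
  have hsα : Summable fun p => ‖α p‖ * ‖β p‖ := by
    have := ENNReal.summable_toReal hfin
    simpa using this
  have hT : ∀ x, HasSum (fun p => inner ℂ (β p) x • α p) ((E.integral Φ Q).toCLM x) := by
    intro x
    have hs : Summable fun p => inner ℂ (β p) x • α p := by
      refine Summable.of_norm_bounded (hsα.mul_right ‖x‖) fun p => ?_
      rw [norm_smul]
      have := norm_inner_le_norm (𝕜 := ℂ) (β p) x
      nlinarith [norm_nonneg (α p)]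
    have hinner : ∀ n, HasSum (fun k => inner ℂ (β (n, k)) x • α (n, k))
        (E₁.integral (φ n) (Q.toCLM (E₂.integral (ψ n) x))) := by
      intro n
      have := (hQ (E₂.integral (ψ n) x)).mapL (E₁.integral (φ n))
      simpa only [map_smul, α, β, ContinuousLinearMap.adjoint_inner_left] using this
    have hout := hs.hasSum.prod_fiberwise hinner
    convert hs.hasSum using 1
    -- The double series converges in norm, while the integral is known only as a weak limit of its
    -- sums over `n`; testing against `y` identifies the two.
    refine ext_inner_left ℂ fun y => ?_
    have l1 := (hout.mapL (innerSL ℂ y)).tendsto_sum_nat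
    simp only [innerSL_apply_apply] at l1
    exact tendsto_nhds_unique
      (tendsto_inner_sum_integral hE hφ hψ hM hN hφM hψN hΦ hsum Q x y) l1
  rw [traceNorm]
  let e := Nat.pairEquiv.symm
  refine iInf₂_le_of_le (α ∘ e) (β ∘ e) (iInf_le_of_le (fun x => ?_) ?_)
  · exact (e.hasSum_iff (f := fun p => inner ℂ (β p) x • α p)).2 (hT x)
  · exact (e.tsum_eq (fun p => ‖α p‖ₑ * ‖β p‖ₑ)).trans_le hle

theorem exists_of_traceNorm_lt {T : H →L[ℂ] H} {c : ℝ≥0∞} (h : traceNorm T < c) :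
    ∃ a b : ℕ → H, (∀ x, HasSum (fun k => inner ℂ (b k) x • a k) (T x)) ∧
      ∑' k, ‖a k‖ₑ * ‖b k‖ₑ < c := by
  simp only [traceNorm, iInf_lt_iff] at h
  obtain ⟨a, b, h1, h2⟩ := h
  exact ⟨a, b, h1, h2⟩

/-- A function `∑ φ n x * ψ n y` with bounded `∑ |φ n|²` and `∑ |ψ n|²` is a Schur multiplier. -/
theorem isSchurMultiplier_of_hasSum
    (hφ : ∀ n, Measurable (φ n)) (hψ : ∀ n, Measurable (ψ n)) (hM : 0 ≤ M) (hN : 0 ≤ N)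
    (hφM : SquareSumLE φ M) (hψN : SquareSumLE ψ N) (hΦ : BddMeasurable Φ)
    (hsum : ∀ x y, HasSum (fun n => φ n x * ψ n y) (Φ (x, y))) :
    IsSchurMultiplier E₁ E₂ Φ := by
  refine ⟨hΦ.1, hΦ.2, fun Q hQ => ?_⟩
  obtain ⟨E, hE⟩ := exists_isProductSpectralMeasure E₁ E₂
  obtain ⟨a, b, hab, hlt⟩ := exists_of_traceNorm_lt hQ
  refine ⟨E.integral Φ Q, ⟨E, hE, _, E.isIntegral_integral hΦ, rfl⟩, ?_⟩
  exact (traceNorm_integral_le hE hφ hψ hM hN hφM hψN hΦ hsum Q hab hlt.ne).trans_lt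
    (ENNReal.mul_lt_top (by finiteness) hlt)

theorem schurNorm_le_of_hasSum
    (hφ : ∀ n, Measurable (φ n)) (hψ : ∀ n, Measurable (ψ n)) (hM : 0 ≤ M) (hN : 0 ≤ N)
    (hφM : SquareSumLE φ M) (hψN : SquareSumLE ψ N) (hΦ : BddMeasurable Φ)
    (hsum : ∀ x y, HasSum (fun n => φ n x * ψ n y) (Φ (x, y))) :
    schurNorm E₁ E₂ Φ ≤ ENNReal.ofReal M * ENNReal.ofReal N := by
  rw [schurNorm]
  refine iSup₂_le fun Q T => iSup₂_le fun hQ hT => ?_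
  obtain ⟨E, hE, J, hJ, rfl⟩ := hT
  rw [hJ.unique (E.isIntegral_integral hΦ)]
  refine ENNReal.le_of_forall_pos_le_add fun ε hε _ => ?_
  set c := ENNReal.ofReal M * ENNReal.ofReal N with hc
  have hc' : c ≠ ∞ := by finiteness
  -- The trace norm is an infimum, perhaps not attained, so a representation of cost below `1 + δ`
  -- is taken. The `+ 1` avoids a zero denominator.
  let δ : ℝ≥0∞ := ε / (c + 1)
  have hδ : 0 < δ := ENNReal.div_pos (by simpa using hε.ne') (by finiteness)
  have hlt : traceNorm Q.toCLM < 1 + δ :=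
    hQ.trans_lt (ENNReal.lt_add_right ENNReal.one_ne_top hδ.ne')
  obtain ⟨a, b, hab, hlt⟩ := exists_of_traceNorm_lt hlt
  refine (traceNorm_integral_le hE hφ hψ hM hN hφM hψN hΦ hsum Q hab
    (ne_top_of_lt hlt)).trans ?_
  calc _ ≤ c * (1 + δ) := by gcongr
    _ = c + c * δ := by ring
    _ ≤ c + (c + 1) * δ := by
      gcongr
      exact le_self_add
    _ = c + ε := by
      rw [ENNReal.mul_div_cancel (by simp) (by finiteness)]

end TraceNorm

/-! ### Bounded holomorphic functions on the disc -/

open Metric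

section HolomorphicLimits

variable {V : Type*} [NormedAddCommGroup V] [NormedSpace ℂ V] [CompleteSpace V]

/-- A bounded pointwise limit of holomorphic functions on the disc is holomorphic. -/
theorem differentiableOn_ball_of_tendsto {F : ℕ → ℂ → V} {f : ℂ → V} {C : ℝ}
    (hF : ∀ n, DifferentiableOn ℂ (F n) (ball 0 1)) (hC : ∀ n, ∀ z ∈ ball (0 : ℂ) 1, ‖F n z‖ ≤ C)
    (h : ∀ z ∈ ball (0 : ℂ) 1, Tendsto (fun n => F n z) atTop (𝓝 (f z))) :
    DifferentiableOn ℂ f (ball 0 1) := by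
  intro z hz
  rw [mem_ball_zero_iff] at hz
  obtain ⟨R, hzR, hR1⟩ := exists_between hz
  have hR0 : 0 < R := (norm_nonneg z).trans_lt hzR
  lift R to NNReal using hR0.le
  have hmap : ∀ θ, circleMap 0 R θ ∈ ball (0 : ℂ) 1 := fun θ => by
    rw [mem_ball_zero_iff, norm_circleMap_zero, abs_of_pos hR0]
    exact hR1
  have hcont : ∀ n, Continuous fun θ => F n (circleMap 0 R θ) := fun n =>
    (hF n).continuousOn.comp_continuous (continuous_circleMap 0 R) hmap
  have hmeas : AEStronglyMeasurable (fun θ => f (circleMap 0 R θ)) volume :=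
    aestronglyMeasurable_of_tendsto_ae atTop (fun n => (hcont n).aestronglyMeasurable)
      (Eventually.of_forall fun θ => h _ (hmap θ))
  have hfC : ∀ w ∈ ball (0 : ℂ) 1, ‖f w‖ ≤ C := fun w hw =>
    le_of_tendsto (h w hw).norm (Eventually.of_forall fun n => hC n w hw)
  have hint : CircleIntegrable f 0 R := by
    rw [CircleIntegrable, intervalIntegrable_iff]
    exact Measure.integrableOn_of_bounded measure_Ioc_lt_top.ne hmeas (M := C)
      (Eventually.of_forall fun θ => hfC _ (hmap θ))
  -- Locally uniform convergence is not assumed: Cauchy's formula on a circle of radius `R` passes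
  -- to the limit by dominated convergence, and a Cauchy integral is analytic inside its circle.
  have hcauchy : ∀ w ∈ ball (0 : ℂ) R,
      ((2 * Real.pi * Complex.I : ℂ)⁻¹ • ∮ ζ in C(0, R), (ζ - w)⁻¹ • f ζ) = f w := by
    intro w hw
    have hw1 : w ∈ ball (0 : ℂ) 1 := ball_subset_ball hR1.le hw
    have hball : closedBall (0 : ℂ) R ⊆ ball 0 1 := closedBall_subset_ball hR1
    have h1 : ∀ n, ((2 * Real.pi * Complex.I : ℂ)⁻¹ • ∮ ζ in C(0, R), (ζ - w)⁻¹ • F n ζ)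
        = F n w := fun n =>
      ((hF n).mono hball).diffContOnCl_ball (Set.Subset.refl _)
        |>.two_pi_i_inv_smul_circleIntegral_sub_inv_smul hw
    refine tendsto_nhds_unique ?_ (h w hw1)
    simp only [← h1]
    refine Tendsto.const_smul ?_ _
    rw [mem_ball_zero_iff] at hw
    have hne : ∀ θ, (R : ℝ) - ‖w‖ ≤ ‖circleMap 0 R θ - w‖ := fun θ => by
      have := norm_sub_norm_le (circleMap 0 R θ) w
      rwa [norm_circleMap_zero, abs_of_pos hR0] at this
    have hpos : 0 < (R : ℝ) - ‖w‖ := sub_pos.2 hw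
    refine intervalIntegral.tendsto_integral_filter_of_dominated_convergence
      (fun _ => (R : ℝ) * (((R : ℝ) - ‖w‖)⁻¹ * C)) ?_ ?_ (by simp) ?_
    · refine Eventually.of_forall fun n => Continuous.aestronglyMeasurable ?_
      have c1 : Continuous fun θ => (circleMap 0 R θ - w)⁻¹ :=
        ((continuous_circleMap 0 R).sub continuous_const).inv₀ fun θ => by
          rw [← norm_pos_iff]
          exact hpos.trans_le (hne θ)
      have c2 : Continuous (deriv (circleMap 0 R)) := by
        simp only [funext (deriv_circleMap 0 (R : ℝ))]
        fun_prop
      exact c2.smul (c1.smul (hcont n))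
    · refine Eventually.of_forall fun n => Eventually.of_forall fun θ _ => ?_
      rw [norm_smul, norm_smul, deriv_circleMap, norm_mul, norm_circleMap_zero, abs_of_pos hR0,
        Complex.norm_I, mul_one, norm_inv]
      have := hne θ
      have := hC n _ (hmap θ)
      gcongr
    · exact Eventually.of_forall fun θ _ => ((h _ (hmap θ)).const_smul _).const_smul _
  have hps := hasFPowerSeriesOn_cauchy_integral hint (by exact_mod_cast hR0)
  have hd : DifferentiableAt ℂ
      (fun w => (2 * Real.pi * Complex.I : ℂ)⁻¹ • ∮ ζ in C(0, R), (ζ - w)⁻¹ • f ζ) z := by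
    refine (hps.analyticAt_of_mem ?_).differentiableAt
    simpa [edist_zero_right] using hzR
  refine (hd.congr_of_eventuallyEq ?_).differentiableWithinAt
  filter_upwards [isOpen_ball.mem_nhds (mem_ball_zero_iff.2 hzR)] with w hw
  exact (hcauchy w hw).symm

end HolomorphicLimits

theorem discExt_coe (f : ClosedDisc → ℂ) (z : ClosedDisc) : discExt f z = f z :=
  Subtype.val_injective.extend_apply f 0 z

theorem discExt_of_mem (f : ClosedDisc → ℂ) {z : ℂ} (hz : z ∈ closedBall (0 : ℂ) 1) :
    discExt f z = f ⟨z, hz⟩ := discExt_coe f ⟨z, hz⟩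

theorem bidiscExt_coe (Φ : ClosedDisc × ClosedDisc → ℂ) (z w : ClosedDisc) :
    bidiscExt Φ ((z : ℂ), (w : ℂ)) = Φ (z, w) := by
  have : Function.Injective fun p : ClosedDisc × ClosedDisc => ((p.1 : ℂ), (p.2 : ℂ)) :=
    fun p q h => Prod.ext (Subtype.ext (Prod.mk.inj h).1) (Subtype.ext (Prod.mk.inj h).2)
  exact this.extend_apply Φ 0 (z, w)

theorem real_mul_mem_closedBall {r : ℝ} (hr : r ∈ Set.Icc (0 : ℝ) 1) (z : ClosedDisc) :
    (r : ℂ) * z ∈ closedBall (0 : ℂ) 1 := by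
  have hz := mem_closedBall_zero_iff.1 z.2
  rw [mem_closedBall_zero_iff, norm_mul, Complex.norm_real, Real.norm_of_nonneg hr.1]
  exact mul_le_one₀ hr.2 (norm_nonneg _) hz

theorem real_mul_mem_ball {r : ℝ} (hr : r ∈ Set.Ico (0 : ℝ) 1) (z : ClosedDisc) :
    (r : ℂ) * z ∈ ball (0 : ℂ) 1 := by
  have hz := mem_closedBall_zero_iff.1 z.2
  rw [mem_ball_zero_iff, norm_mul, Complex.norm_real, Real.norm_of_nonneg hr.1]
  exact (mul_le_of_le_one_right hr.1 hz).trans_lt hr.2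

/-- The point `r z` of the closed disc, for `r` in `[0, 1]` (`r` is clamped to this interval). -/
noncomputable def shrink (r : ℝ) (z : ClosedDisc) : ClosedDisc :=
  ⟨(Set.projIcc (0 : ℝ) 1 zero_le_one r : ℝ) * z, real_mul_mem_closedBall (Subtype.mem _) z⟩

theorem coe_shrink {r : ℝ} (hr : r ∈ Set.Icc (0 : ℝ) 1) (z : ClosedDisc) :
    (shrink r z : ℂ) = r * z := by
  simp [shrink, Set.projIcc_of_mem _ hr]

theorem eventually_mem_Ico : ∀ᶠ r : ℝ in 𝓝[<] 1, r ∈ Set.Ico (0 : ℝ) 1 :=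
  Ico_mem_nhdsLT zero_lt_one

theorem discExt_eventuallyEq_shrink (f : ClosedDisc → ℂ) (z : ClosedDisc) :
    (fun r : ℝ => discExt f ((r : ℂ) * z)) =ᶠ[𝓝[<] 1] fun r => f (shrink r z) := by
  filter_upwards [eventually_mem_Ico] with r hr
  rw [← coe_shrink (Set.Ico_subset_Icc_self hr), discExt_coe]

theorem bidiscExt_eventuallyEq_shrink_left (Φ : ClosedDisc × ClosedDisc → ℂ) (z w : ClosedDisc) :
    (fun r : ℝ => bidiscExt Φ ((r : ℂ) * z, (w : ℂ))) =ᶠ[𝓝[<] 1] fun r => Φ (shrink r z, w) := by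
  filter_upwards [eventually_mem_Ico] with r hr
  rw [← coe_shrink (Set.Ico_subset_Icc_self hr), bidiscExt_coe]

theorem bidiscExt_eventuallyEq_shrink_right (Φ : ClosedDisc × ClosedDisc → ℂ) (z w : ClosedDisc) :
    (fun r : ℝ => bidiscExt Φ ((z : ℂ), (r : ℂ) * w)) =ᶠ[𝓝[<] 1] fun r => Φ (z, shrink r w) := by
  filter_upwards [eventually_mem_Ico] with r hr
  rw [← coe_shrink (Set.Ico_subset_Icc_self hr), bidiscExt_coe]

theorem shrink_mem_ball {r : ℝ} (hr : r ∈ Set.Ico (0 : ℝ) 1) (z : ClosedDisc) :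
    (shrink r z : ℂ) ∈ ball (0 : ℂ) 1 := by
  rw [coe_shrink (Set.Ico_subset_Icc_self hr)]
  exact real_mul_mem_ball hr z

theorem mem_ball_or_exists_circleToDisc (z : ClosedDisc) :
    (z : ℂ) ∈ ball (0 : ℂ) 1 ∨ ∃ ζ, z = circleToDisc ζ := by
  rcases (mem_closedBall_zero_iff.1 z.2).lt_or_eq with h | h
  · exact Or.inl (mem_ball_zero_iff.2 h)
  · exact Or.inr ⟨⟨z, mem_sphere_zero_iff_norm.2 h⟩, rfl⟩

theorem tendsto_real_mul (z : ℂ) : Tendsto (fun r : ℝ => (r : ℂ) * z) (𝓝[<] 1) (𝓝 z) := by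
  have : Continuous fun r : ℝ => (r : ℂ) * z := by fun_prop
  have h := this.tendsto 1
  simp only [Complex.ofReal_one, one_mul] at h
  exact h.mono_left nhdsWithin_le_nhds

namespace HInfRDisc

variable {f g : ClosedDisc → ℂ}

theorem tendsto_shrink (hf : f ∈ HInfRDisc) (z : ClosedDisc) :
    Tendsto (fun r => f (shrink r z)) (𝓝[<] 1) (𝓝 (f z)) := by
  refine Tendsto.congr' (discExt_eventuallyEq_shrink f z) ?_
  rcases mem_ball_or_exists_circleToDisc z with hz | ⟨ζ, rfl⟩
  · have := (hf.1.differentiableAt (isOpen_ball.mem_nhds hz)).continuousAt.tendsto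
    rw [discExt_coe] at this
    exact this.comp (tendsto_real_mul z)
  · exact hf.2.2 ζ

/-- Membership in `H^∞_r` can be checked by radial convergence at all points. -/
theorem of_tendsto (hd : DifferentiableOn ℂ (discExt f) (ball 0 1)) {C : ℝ}
    (hC : ∀ z : ClosedDisc, ‖f z‖ ≤ C)
    (h : ∀ z, Tendsto (fun r => f (shrink r z)) (𝓝[<] 1) (𝓝 (f z))) : f ∈ HInfRDisc := by
  refine ⟨hd, ⟨C, fun z hz => ?_⟩, fun ζ => ?_⟩
  · rw [discExt_of_mem f (ball_subset_closedBall hz)]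
    exact hC _
  · exact (h (circleToDisc ζ)).congr' (discExt_eventuallyEq_shrink f (circleToDisc ζ)).symm

theorem exists_bound (hf : f ∈ HInfRDisc) : ∃ C : ℝ, ∀ z, ‖f z‖ ≤ C := by
  obtain ⟨C, hC⟩ := hf.2.1
  refine ⟨C, fun z => le_of_tendsto (tendsto_shrink hf z).norm ?_⟩
  filter_upwards [eventually_mem_Ico] with r hr
  rw [← discExt_coe f]
  exact hC _ (shrink_mem_ball hr z)

theorem zero_mem : (0 : ClosedDisc → ℂ) ∈ HInfRDisc := by
  refine of_tendsto (C := 0) ?_ (by simp) (by simp)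
  refine (differentiableOn_const 0).congr (f := fun _ => (0 : ℂ)) fun z hz => ?_
  rw [discExt_of_mem _ (ball_subset_closedBall hz)]
  rfl

theorem add_mem (hf : f ∈ HInfRDisc) (hg : g ∈ HInfRDisc) : f + g ∈ HInfRDisc := by
  obtain ⟨C, hC⟩ := exists_bound hf
  obtain ⟨D, hD⟩ := exists_bound hg
  refine of_tendsto (C := C + D) ?_ (fun z => (norm_add_le _ _).trans (add_le_add (hC z) (hD z)))
    fun z => (tendsto_shrink hf z).add (tendsto_shrink hg z)
  refine (hf.1.add hg.1).congr fun z hz => ?_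
  simp only [Pi.add_apply, discExt_of_mem _ (ball_subset_closedBall hz)]

theorem smul_mem (hf : f ∈ HInfRDisc) (c : ℂ) : c • f ∈ HInfRDisc := by
  obtain ⟨C, hC⟩ := exists_bound hf
  refine of_tendsto (C := ‖c‖ * C) ?_ (fun z => ?_) fun z => (tendsto_shrink hf z).const_smul c
  · refine (hf.1.const_smul c).congr fun z hz => ?_
    simp only [Pi.smul_apply, discExt_of_mem _ (ball_subset_closedBall hz)]
  · rw [Pi.smul_apply, norm_smul]
    have := hC z
    gcongr

/-- `H^∞_r` is closed under uniform limits. -/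
theorem of_tendstoUniformly {F : ℕ → ClosedDisc → ℂ} (hF : ∀ n, F n ∈ HInfRDisc)
    (h : TendstoUniformly F f atTop) : f ∈ HInfRDisc := by
  obtain ⟨N, hN⟩ := ((Metric.tendstoUniformly_iff.1 h) 1 one_pos).exists
  obtain ⟨C, hC⟩ := exists_bound (hF N)
  refine of_tendsto (C := C + 1) ?_ (fun z => ?_) fun z => ?_
  · have : TendstoLocallyUniformlyOn (fun n => discExt (F n)) (discExt f) atTop (ball 0 1) := by
      refine TendstoUniformlyOn.tendstoLocallyUniformlyOn ?_
      rw [Metric.tendstoUniformlyOn_iff]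
      intro ε hε
      filter_upwards [(Metric.tendstoUniformly_iff.1 h) ε hε] with n hn z hz
      simp only [discExt_of_mem _ (ball_subset_closedBall hz)]
      exact hn _
    exact this.differentiableOn (Eventually.of_forall fun n => (hF n).1) isOpen_ball
  · have h1 := hN z
    rw [dist_eq_norm] at h1
    have h2 : ‖f z‖ ≤ ‖F N z‖ + ‖f z - F N z‖ := by
      simpa using norm_add_le (F N z) (f z - F N z)
    linarith [hC z]
  · have hu : TendstoUniformlyOnFilter (fun n r => F n (shrink r z)) (fun r => f (shrink r z))
        atTop (𝓝[<] 1) :=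
      (h.comp fun r => shrink r z).tendstoUniformlyOnFilter.mono_right le_top
    exact hu.tendsto_of_eventually_tendsto
      (Eventually.of_forall fun n => tendsto_shrink (hF n) z) (h.tendsto_at z)

/-- The boundary function is the pointwise limit of the continuous functions `ζ ↦ f (uₙ ζ)`. -/
theorem measurable_circle (hf : f ∈ HInfRDisc) : Measurable fun ζ => f (circleToDisc ζ) := by
  obtain ⟨u, -, hu1, hu⟩ := exists_seq_strictMono_tendsto' (zero_lt_one' ℝ)
  have hu' : Tendsto u atTop (𝓝[<] 1) :=
    tendsto_nhdsWithin_iff.2 ⟨hu, Eventually.of_forall fun n => (hu1 n).2⟩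
  refine measurable_of_tendsto_metrizable
    (f := fun n ζ => discExt f ((u n : ℂ) * (ζ : UnitCircle).1)) (fun n => ?_) ?_
  · refine Continuous.measurable ?_
    refine hf.1.continuousOn.comp_continuous (by fun_prop) fun ζ => ?_
    exact real_mul_mem_ball ⟨(hu1 n).1.le, (hu1 n).2⟩ (circleToDisc ζ)
  · rw [tendsto_pi_nhds]
    exact fun ζ => (hf.2.2 ζ).comp hu'

end HInfRDisc

/-! ### The Haagerup tensor product consists of analytic Schur multipliers -/

/-- The truncations are holomorphic, bounded by `M` and convergent at each point in `ℓ²`. With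
values in `ℓ²`, joint holomorphy of `∑ φₙ(z) ψₙ(w)` follows by composing with the bounded bilinear
pairing. -/
theorem exists_differentiableOn_lp {f : ℕ → ℂ → ℂ} {M : ℝ} (hM : 0 ≤ M)
    (hf : ∀ n, DifferentiableOn ℂ (f n) (ball 0 1))
    (h : ∀ z ∈ ball (0 : ℂ) 1, (Summable fun n => ‖f n z‖ ^ 2) ∧ ∑' n, ‖f n z‖ ^ 2 ≤ M ^ 2) :
    ∃ F : ℂ → lp (fun _ : ℕ => ℂ) 2, DifferentiableOn ℂ F (ball 0 1) ∧
      ∀ z ∈ ball (0 : ℂ) 1, ∀ n, F z n = f n z := by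
  classical
  have hmem : ∀ z ∈ ball (0 : ℂ) 1, Memℓp (fun n => f n z) 2 := fun z hz => by
    rw [memℓp_gen_iff (by simp)]
    simpa using (h z hz).1
  have hF : ∀ z, ∃ F : lp (fun _ : ℕ => ℂ) 2, z ∈ ball (0 : ℂ) 1 → ∀ n, F n = f n z := fun z => by
    by_cases hz : z ∈ ball (0 : ℂ) 1
    · exact ⟨⟨_, hmem z hz⟩, fun _ _ => rfl⟩
    · exact ⟨0, fun hz' => absurd hz' hz⟩
  choose F hF using hF
  refine ⟨F, ?_, hF⟩
  refine differentiableOn_ball_of_tendsto (C := M)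
    (F := fun N z => ∑ n ∈ Finset.range N, f n z • lp.single 2 n (1 : ℂ)) (fun N => ?_)
    (fun N z hz => ?_) fun z hz => ?_
  · exact DifferentiableOn.fun_sum fun n _ => (hf n).smul_const _
  · have e := lp.norm_sum_single (E := fun _ : ℕ => ℂ) (p := 2) (by simp) (fun n => f n z)
      (Finset.range N)
    simp only [ENNReal.toReal_ofNat, Real.rpow_ofNat] at e
    have e2 : ∀ n, f n z • lp.single (E := fun _ : ℕ => ℂ) 2 n (1 : ℂ) = lp.single 2 n (f n z) :=
      fun n => by rw [← lp.single_smul, smul_eq_mul, mul_one]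
    simp only [e2]
    refine (sq_le_sq₀ (norm_nonneg _) hM).1 ?_
    rw [e]
    exact ((h z hz).1.sum_le_tsum _ fun _ _ => by positivity).trans (h z hz).2
  · have := (lp.hasSum_single (by simp) (F z)).tendsto_sum_nat
    refine this.congr fun N => Finset.sum_congr rfl fun n _ => ?_
    rw [hF z hz, ← lp.single_smul, smul_eq_mul, mul_one]

/-- The bilinear pairing `∑ u n * v n` on `ℓ²`. -/
theorem exists_bilin_lp : ∃ B : lp (fun _ : ℕ => ℂ) 2 →L[ℂ] lp (fun _ : ℕ => ℂ) 2 →L[ℂ] ℂ,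
    ∀ u v, HasSum (fun n => u n * v n) (B u v) := by
  let B₀ : lp (fun _ : ℕ => ℂ) 2 →ₗ[ℂ] lp (fun _ : ℕ => ℂ) 2 →ₗ[ℂ] ℂ :=
    LinearMap.mk₂ ℂ (fun u v => inner ℂ (star u) v)
      (fun u u' v => by rw [star_add, inner_add_left])
      (fun c u v => by rw [star_smul, inner_smul_left]; simp)
      (fun u v v' => inner_add_right _ _ _)
      (fun c u v => inner_smul_right _ _ _)
  refine ⟨B₀.mkContinuous₂ 1 fun u v => ?_, fun u v => ?_⟩
  · simpa [B₀] using norm_inner_le_norm (𝕜 := ℂ) (star u) v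
  · have := lp.hasSum_inner (𝕜 := ℂ) (star u) v
    simpa [B₀, lp.star_apply, mul_comm] using this

theorem squareSumLE_of_squareFunctionNorm {X : Type*} {φ : ℕ → X → ℂ}
    (h : squareFunctionNorm φ < ∞) : SquareSumLE φ (squareFunctionNorm φ).toReal := by
  intro x
  have h1 : (∑' n, ‖φ n x‖ₑ ^ 2) ^ (1 / 2 : ℝ) ≤ squareFunctionNorm φ :=
    le_iSup (fun x => (∑' n, ‖φ n x‖ₑ ^ 2) ^ (1 / 2 : ℝ)) x
  have h2 : ∑' n, ‖φ n x‖ₑ ^ 2 ≤ squareFunctionNorm φ ^ 2 := by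
    have := ENNReal.rpow_le_rpow h1 (zero_le_two (α := ℝ))
    rw [← ENNReal.rpow_mul] at this
    simpa using this
  have h3 : ∑' n, ‖φ n x‖ₑ ^ 2 ≠ ∞ := (h2.trans_lt (ENNReal.pow_lt_top h)).ne
  have h4 : ∀ n, (‖φ n x‖ₑ ^ 2).toReal = ‖φ n x‖ ^ 2 := fun n => by simp
  have hs := ENNReal.hasSum_toReal h3
  simp only [h4] at hs
  refine ⟨hs.summable, ?_⟩
  rw [hs.tsum_eq, ← ENNReal.toReal_pow]
  simp only [← h4]
  rw [← ENNReal.tsum_toReal_eq (fun n => ENNReal.ne_top_of_tsum_ne_top h3 n)]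
  exact ENNReal.toReal_mono (ENNReal.pow_lt_top h).ne h2

theorem squareFunctionNorm_le {X : Type*} {φ : ℕ → X → ℂ} {M : ℝ} (hM : 0 ≤ M)
    (h : SquareSumLE φ M) : squareFunctionNorm φ ≤ ENNReal.ofReal M := by
  refine iSup_le fun x => ?_
  have e : ∑' n, ‖φ n x‖ₑ ^ 2 ≤ ENNReal.ofReal M ^ 2 := by
    rw [← ENNReal.ofReal_pow hM]
    refine le_trans (le_of_eq ?_) (ENNReal.ofReal_le_ofReal (h x).2)
    rw [ENNReal.ofReal_tsum_of_nonneg (fun n => by positivity) (h x).1]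
    exact tsum_congr fun n => by rw [ENNReal.ofReal_pow (norm_nonneg _), ofReal_norm]
  refine (ENNReal.rpow_le_rpow e (by norm_num)).trans_eq ?_
  rw [← ENNReal.rpow_natCast, ← ENNReal.rpow_mul]
  norm_num

/-- Under a square sum bound, `∑ φ n x * c n` converges uniformly for `c` in `ℓ²`. -/
theorem SquareSumLE.tendstoUniformly {X : Type*} {φ : ℕ → X → ℂ} {M : ℝ} (hM : 0 ≤ M)
    (h : SquareSumLE φ M) {c : ℕ → ℂ} (hc : Summable fun n => ‖c n‖ ^ 2) {f : X → ℂ}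
    (hf : ∀ x, HasSum (fun n => φ n x * c n) (f x)) :
    TendstoUniformly (fun N x => ∑ n ∈ Finset.range N, φ n x * c n) f atTop := by
  have ht : Tendsto (fun N => M * √(∑' n, ‖c (n + N)‖ ^ 2)) atTop (𝓝 0) := by
    have := ((Real.continuous_sqrt.tendsto 0).comp
      (tendsto_sum_nat_add fun n => ‖c n‖ ^ 2)).const_mul M
    simpa using this
  rw [Metric.tendstoUniformly_iff]
  intro ε hε
  filter_upwards [ht.eventually_lt_const hε] with N hN x
  refine lt_of_le_of_lt ?_ hN
  have h1 : Summable fun n => ‖φ (n + N) x‖ ^ 2 := (summable_nat_add_iff N).2 (h x).1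
  have h2 : Summable fun n => ‖c (n + N)‖ ^ 2 := (summable_nat_add_iff N).2 hc
  have h3 := summable_mul_and_tsum_mul_le (fun n => norm_nonneg (φ (n + N) x))
    (fun n => norm_nonneg (c (n + N))) h1 h2
  have h4 := (hasSum_nat_add_iff' N).2 (hf x)
  rw [dist_eq_norm, ← h4.tsum_eq]
  refine (norm_tsum_le_tsum_norm (by simpa using h3.1)).trans ?_
  simp only [norm_mul]
  refine h3.2.trans ?_
  gcongr
  refine (Real.sqrt_le_sqrt ?_).trans_eq (Real.sqrt_sq hM)
  refine le_trans ?_ (h x).2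
  rw [← (h x).1.sum_add_tsum_nat_add N]
  have : 0 ≤ ∑ i ∈ Finset.range N, ‖φ i x‖ ^ 2 := Finset.sum_nonneg fun _ _ => by positivity
  linarith

namespace IsHaagerupRep

/-- With one variable frozen, the coefficients form a fixed `ℓ²` sequence and the series converges
uniformly in the other variable up to the boundary. This is why radial limits survive separately in
each variable. -/
theorem sum_mem_HInfRDisc {φ : ℕ → ClosedDisc → ℂ} {M : ℝ} (hM : 0 ≤ M)
    (hφ : ∀ n, φ n ∈ HInfRDisc) (h : SquareSumLE φ M) {c : ℕ → ℂ}
    (hc : Summable fun n => ‖c n‖ ^ 2) {f : ClosedDisc → ℂ}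
    (hf : ∀ x, HasSum (fun n => φ n x * c n) (f x)) : f ∈ HInfRDisc := by
  refine HInfRDisc.of_tendstoUniformly (fun N => ?_) (h.tendstoUniformly hM hc hf)
  induction N with
  | zero =>
    simp only [Finset.range_zero, Finset.sum_empty]
    exact HInfRDisc.zero_mem
  | succ N ih =>
    simp only [Finset.sum_range_succ]
    refine HInfRDisc.add_mem ih ?_
    have := HInfRDisc.smul_mem (hφ N) (c N)
    refine (congrArg (· ∈ HInfRDisc) (funext fun x => ?_)).mp this
    simp [mul_comm]

variable {Φ : ClosedDisc × ClosedDisc → ℂ} {φ ψ : ℕ → ClosedDisc → ℂ}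

theorem norm_le (h : IsHaagerupRep HInfRDisc HInfRDisc Φ φ ψ) (p : ClosedDisc × ClosedDisc) :
    ‖Φ p‖ ≤ (squareFunctionNorm φ).toReal * (squareFunctionNorm ψ).toReal := by
  have hφ := squareSumLE_of_squareFunctionNorm h.left_bdd
  have hψ := squareSumLE_of_squareFunctionNorm h.right_bdd
  have hs := hφ.summable_mul hψ ENNReal.toReal_nonneg ENNReal.toReal_nonneg p.1 p.2
  rw [← (h.hasSum p.1 p.2).tsum_eq]
  refine (norm_tsum_le_tsum_norm (by simpa using hs.1)).trans ?_
  simpa using hs.2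

theorem mem_HInfRBidisc (h : IsHaagerupRep HInfRDisc HInfRDisc Φ φ ψ) : Φ ∈ HInfRBidisc := by
  have hφ := squareSumLE_of_squareFunctionNorm h.left_bdd
  have hψ := squareSumLE_of_squareFunctionNorm h.right_bdd
  refine ⟨?_, ⟨(squareFunctionNorm φ).toReal * (squareFunctionNorm ψ).toReal, fun p hp => ?_⟩,
    fun z w => ⟨?_, ?_⟩⟩
  · have hd : ∀ {χ : ℕ → ClosedDisc → ℂ} {M : ℝ}, SquareSumLE χ M → ∀ z ∈ ball (0 : ℂ) 1,
        (Summable fun n => ‖discExt (χ n) z‖ ^ 2) ∧ ∑' n, ‖discExt (χ n) z‖ ^ 2 ≤ M ^ 2 := by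
      intro χ M hχ z hz
      simp only [discExt_of_mem _ (ball_subset_closedBall hz)]
      exact hχ _
    obtain ⟨F, hF, hFe⟩ := exists_differentiableOn_lp ENNReal.toReal_nonneg
      (fun n => (h.left_mem n).1) (hd hφ)
    obtain ⟨G, hG, hGe⟩ := exists_differentiableOn_lp ENNReal.toReal_nonneg
      (fun n => (h.right_mem n).1) (hd hψ)
    obtain ⟨B, hB⟩ := exists_bilin_lp
    have hF' : DifferentiableOn ℂ (fun p : ℂ × ℂ => F p.1) (ball 0 1 ×ˢ ball 0 1) :=
      hF.comp differentiableOn_fst fun p hp => hp.1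
    have hG' : DifferentiableOn ℂ (fun p : ℂ × ℂ => G p.2) (ball 0 1 ×ˢ ball 0 1) :=
      hG.comp differentiableOn_snd fun p hp => hp.2
    have hBd := (B.differentiable.comp_differentiableOn hF').clm_apply hG'
    refine hBd.congr fun p hp => ?_
    obtain ⟨z, w⟩ := p
    have hz := ball_subset_closedBall hp.1
    have hw := ball_subset_closedBall hp.2
    have e := bidiscExt_coe Φ ⟨z, hz⟩ ⟨w, hw⟩
    simp only at e
    rw [e]
    refine (h.hasSum _ _).unique ?_
    have := hB (F z) (G w)
    simp only [hFe z hp.1, hGe w hp.2, discExt_of_mem _ hz, discExt_of_mem _ hw] at this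
    exact this
  · have e := bidiscExt_coe Φ ⟨p.1, ball_subset_closedBall hp.1⟩ ⟨p.2, ball_subset_closedBall hp.2⟩
    simp only [Prod.mk.eta] at e
    rw [e]
    exact h.norm_le _
  · refine Tendsto.congr' (bidiscExt_eventuallyEq_shrink_left Φ z w).symm ?_
    exact HInfRDisc.tendsto_shrink (f := fun z => Φ (z, w)) (sum_mem_HInfRDisc
      ENNReal.toReal_nonneg h.left_mem hφ (hψ w).1 fun x => h.hasSum x w) z
  · refine Tendsto.congr' (bidiscExt_eventuallyEq_shrink_right Φ z w).symm ?_
    exact HInfRDisc.tendsto_shrink (f := fun w => Φ (z, w)) (sum_mem_HInfRDisc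
      ENNReal.toReal_nonneg h.right_mem hψ (hφ z).1 fun x => by
        simpa only [mul_comm] using h.hasSum z x) w

theorem bddMeasurable (h : IsHaagerupRep HInfRDisc HInfRDisc Φ φ ψ) :
    BddMeasurable (torusRestriction Φ) := by
  refine ⟨?_, _, fun p => h.norm_le _⟩
  refine measurable_of_tendsto_metrizable
    (f := fun N p => ∑ n ∈ Finset.range N, φ n (circleToDisc p.1) * ψ n (circleToDisc p.2))
    (fun N => ?_) ?_
  · exact Finset.measurable_sum _ fun n _ =>
      ((HInfRDisc.measurable_circle (h.left_mem n)).comp measurable_fst).mul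
        ((HInfRDisc.measurable_circle (h.right_mem n)).comp measurable_snd)
  · rw [tendsto_pi_nhds]
    exact fun p => (h.hasSum _ _).tendsto_sum_nat

theorem mem_analyticSchurMultipliers (h : IsHaagerupRep HInfRDisc HInfRDisc Φ φ ψ) :
    Φ ∈ analyticSchurMultipliers.{u} := by
  refine ⟨h.mem_HInfRBidisc, fun H _ _ _ E₁ E₂ => ?_⟩
  exact isSchurMultiplier_of_hasSum (φ := fun n ζ => φ n (circleToDisc ζ))
    (ψ := fun n ζ => ψ n (circleToDisc ζ))
    (fun n => HInfRDisc.measurable_circle (h.left_mem n))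
    (fun n => HInfRDisc.measurable_circle (h.right_mem n)) ENNReal.toReal_nonneg
    ENNReal.toReal_nonneg (fun x => squareSumLE_of_squareFunctionNorm h.left_bdd _)
    (fun x => squareSumLE_of_squareFunctionNorm h.right_bdd _) h.bddMeasurable
    fun x y => h.hasSum _ _

theorem analyticSchurNorm_le (h : IsHaagerupRep HInfRDisc HInfRDisc Φ φ ψ) :
    analyticSchurNorm.{u} Φ ≤ squareFunctionNorm φ * squareFunctionNorm ψ := by
  refine iSup_le fun H => iSup_le fun _ => iSup_le fun _ => iSup_le fun _ => iSup_le fun E₁ =>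
    iSup_le fun E₂ => ?_
  have := schurNorm_le_of_hasSum (E₁ := E₁) (E₂ := E₂) (φ := fun n ζ => φ n (circleToDisc ζ))
    (ψ := fun n ζ => ψ n (circleToDisc ζ))
    (fun n => HInfRDisc.measurable_circle (h.left_mem n))
    (fun n => HInfRDisc.measurable_circle (h.right_mem n)) ENNReal.toReal_nonneg
    ENNReal.toReal_nonneg (fun x => squareSumLE_of_squareFunctionNorm h.left_bdd _)
    (fun x => squareSumLE_of_squareFunctionNorm h.right_bdd _) h.bddMeasurable
    fun x y => h.hasSum _ _
  rwa [ENNReal.ofReal_toReal h.left_bdd.ne, ENNReal.ofReal_toReal h.right_bdd.ne] at this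

end IsHaagerupRep

/-! ### Slices of functions on the bidisc and the Poisson representation -/

theorem exists_seq_tendsto_one :
    ∃ u : ℕ → ℝ, (∀ n, u n ∈ Set.Ico (0 : ℝ) 1) ∧ Tendsto u atTop (𝓝[<] 1) := by
  obtain ⟨u, -, hu1, hu⟩ := exists_seq_strictMono_tendsto' (zero_lt_one' ℝ)
  exact ⟨u, fun n => ⟨(hu1 n).1.le, (hu1 n).2⟩,
    tendsto_nhdsWithin_iff.2 ⟨hu, Eventually.of_forall fun n => (hu1 n).2⟩⟩

namespace HInfRBidisc

variable {Φ : ClosedDisc × ClosedDisc → ℂ}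

theorem tendsto_shrink_left (h : Φ ∈ HInfRBidisc) (z w : ClosedDisc) :
    Tendsto (fun r => Φ (shrink r z, w)) (𝓝[<] 1) (𝓝 (Φ (z, w))) :=
  ((h.2.2 z w).1).congr' (bidiscExt_eventuallyEq_shrink_left Φ z w)

theorem tendsto_shrink_right (h : Φ ∈ HInfRBidisc) (z w : ClosedDisc) :
    Tendsto (fun r => Φ (z, shrink r w)) (𝓝[<] 1) (𝓝 (Φ (z, w))) :=
  ((h.2.2 z w).2).congr' (bidiscExt_eventuallyEq_shrink_right Φ z w)

/-- The bound on the open bidisc reaches the closed one by two successive radial limits. -/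
theorem exists_bound (h : Φ ∈ HInfRBidisc) : ∃ C : ℝ, ∀ z w, ‖Φ (z, w)‖ ≤ C := by
  obtain ⟨C, hC⟩ := h.2.1
  refine ⟨C, fun z w => le_of_tendsto (tendsto_shrink_left h z w).norm ?_⟩
  filter_upwards [eventually_mem_Ico] with r hr
  refine le_of_tendsto (tendsto_shrink_right h _ w).norm ?_
  filter_upwards [eventually_mem_Ico] with s hs
  rw [← bidiscExt_coe Φ]
  exact hC _ ⟨shrink_mem_ball hr z, shrink_mem_ball hs w⟩

/-- For `w` in the open disc the slice is a restriction of a holomorphic function of two variables.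
For `w` on the circle it is a bounded pointwise limit of the slices at `r w`, hence still
holomorphic. -/
theorem left_mem (h : Φ ∈ HInfRBidisc) (w : ClosedDisc) : (fun z => Φ (z, w)) ∈ HInfRDisc := by
  obtain ⟨C, hC⟩ := exists_bound h
  have hd : ∀ w : ClosedDisc, (w : ℂ) ∈ ball (0 : ℂ) 1 →
      DifferentiableOn ℂ (discExt fun z => Φ (z, w)) (ball 0 1) := fun w hw => by
    have hc : DifferentiableOn ℂ (fun z : ℂ => bidiscExt Φ (z, (w : ℂ))) (ball 0 1) :=
      h.1.comp (t := ball 0 1 ×ˢ ball 0 1) (by fun_prop) fun z hz => ⟨hz, hw⟩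
    refine hc.congr fun z hz => ?_
    rw [discExt_of_mem _ (ball_subset_closedBall hz)]
    exact (bidiscExt_coe Φ ⟨z, ball_subset_closedBall hz⟩ w).symm
  obtain ⟨u, hu1, hu⟩ := exists_seq_tendsto_one
  refine HInfRDisc.of_tendsto (C := C) ?_ (fun z => hC z w) fun z => tendsto_shrink_left h z w
  refine differentiableOn_ball_of_tendsto (C := C)
    (fun n => hd (shrink (u n) w) (shrink_mem_ball (hu1 n) w)) (fun n z hz => ?_) fun z hz => ?_
  · rw [discExt_of_mem _ (ball_subset_closedBall hz)]
    exact hC _ _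
  · simp only [discExt_of_mem _ (ball_subset_closedBall hz)]
    exact (tendsto_shrink_right h _ w).comp hu

theorem swap (h : Φ ∈ HInfRBidisc) : Φ ∘ Prod.swap ∈ HInfRBidisc := by
  obtain ⟨C, hC⟩ := exists_bound h
  have e : ∀ p ∈ ball (0 : ℂ) 1 ×ˢ ball (0 : ℂ) 1,
      bidiscExt (Φ ∘ Prod.swap) p = bidiscExt Φ p.swap := fun p hp => by
    have e1 := bidiscExt_coe (Φ ∘ Prod.swap) ⟨p.1, ball_subset_closedBall hp.1⟩
      ⟨p.2, ball_subset_closedBall hp.2⟩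
    have e2 := bidiscExt_coe Φ ⟨p.2, ball_subset_closedBall hp.2⟩
      ⟨p.1, ball_subset_closedBall hp.1⟩
    exact e1.trans e2.symm
  refine ⟨?_, ⟨C, fun p hp => ?_⟩, fun z w => ⟨?_, ?_⟩⟩
  · refine DifferentiableOn.congr ?_ e
    exact h.1.comp (t := ball 0 1 ×ˢ ball 0 1)
      (differentiableOn_snd.prodMk differentiableOn_fst) fun p hp => ⟨hp.2, hp.1⟩
  · have e1 := bidiscExt_coe (Φ ∘ Prod.swap) ⟨p.1, ball_subset_closedBall hp.1⟩
      ⟨p.2, ball_subset_closedBall hp.2⟩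
    simp only [Prod.mk.eta] at e1
    rw [e1]
    exact hC _ _
  · refine Tendsto.congr' (bidiscExt_eventuallyEq_shrink_left _ z w).symm ?_
    exact tendsto_shrink_right h w z
  · refine Tendsto.congr' (bidiscExt_eventuallyEq_shrink_right _ z w).symm ?_
    exact tendsto_shrink_left h w z

theorem right_mem (h : Φ ∈ HInfRBidisc) (z : ClosedDisc) : (fun w => Φ (z, w)) ∈ HInfRDisc :=
  left_mem (swap h) z

end HInfRBidisc

namespace HInfRDisc

theorem one_mem : (fun _ => 1 : ClosedDisc → ℂ) ∈ HInfRDisc := by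
  refine of_tendsto (C := 1) ?_ (by simp) (by simp)
  refine (differentiableOn_const (c := (1 : ℂ))).congr fun z hz => ?_
  rw [discExt_of_mem _ (ball_subset_closedBall hz)]

/-- The points of the closed disc are represented by probability measures on the circle. -/
theorem exists_representing_measure (z : ClosedDisc) :
    ∃ μ : Measure UnitCircle, IsProbabilityMeasure μ ∧
      ∀ f ∈ HInfRDisc, ∫ ζ, f (circleToDisc ζ) ∂μ = f z := by
  rcases mem_ball_or_exists_circleToDisc z with hz | ⟨ζ, rfl⟩
  swap
  -- A boundary point represents itself; inside the disc the measure is given by the Poisson kernel.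
  · exact ⟨Measure.dirac ζ, inferInstance, fun f _ => integral_dirac _ _⟩
  have hz1 : ‖(z : ℂ)‖ < 1 := mem_ball_zero_iff.1 hz
  have hc1 : ∀ θ, circleMap 0 1 θ ∈ sphere (0 : ℂ) 1 := fun θ =>
    circleMap_mem_sphere 0 zero_le_one θ
  let c : ℝ → UnitCircle := fun θ => ⟨circleMap 0 1 θ, hc1 θ⟩
  have hc : Continuous c := (continuous_circleMap 0 1).subtype_mk _
  let P : ℝ → ℝ := fun θ => (2 * Real.pi)⁻¹ * poissonKernel 0 z (circleMap 0 1 θ)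
  have hP0 : ∀ θ, 0 ≤ P θ := fun θ => by
    have h1 := mem_sphere_zero_iff_norm.1 (hc1 θ)
    have : 0 ≤ (1 : ℝ) - ‖(z : ℂ)‖ ^ 2 := by nlinarith [norm_nonneg (z : ℂ)]
    simp only [P, poissonKernel, sub_zero, h1, one_pow]
    exact mul_nonneg (inv_nonneg.2 Real.two_pi_pos.le) (div_nonneg this (by positivity))
  have hPc : Continuous P := by
    refine continuous_const.mul ?_
    simp only [poissonKernel, sub_zero]
    refine Continuous.div (by fun_prop) (by fun_prop) fun θ => ?_
    have h1 := mem_sphere_zero_iff_norm.1 (hc1 θ)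
    refine pow_ne_zero 2 (norm_ne_zero_iff.2 (sub_ne_zero.2 fun h => ?_))
    rw [h] at h1
    exact hz1.ne h1
  let ν : Measure ℝ := (volume.restrict (Set.Ioc 0 (2 * Real.pi))).withDensity
    fun θ => ENNReal.ofReal (P θ)
  have hint : ∀ g : UnitCircle → ℂ, Measurable g →
      ∫ ζ, g ζ ∂(ν.map c) = ∫ θ in Set.Ioc 0 (2 * Real.pi), P θ • g (c θ) := fun g hg => by
    rw [integral_map hc.measurable.aemeasurable hg.aestronglyMeasurable]
    simp only [ν]
    rw [integral_withDensity_eq_integral_toReal_smul (hPc.measurable.ennreal_ofReal)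
      (by simp)]
    simp only [ENNReal.toReal_ofReal (hP0 _)]
  have hfin : IsFiniteMeasure (ν.map c) := by
    refine @Measure.isFiniteMeasure_map _ _ _ _ _ ?_ c
    refine isFiniteMeasure_withDensity_ofReal ?_
    exact ((hPc.integrableOn_Icc (a := 0) (b := 2 * Real.pi)).mono_set
      Set.Ioc_subset_Icc_self).2
  have hav : ∀ g : ℂ → ℂ, DiffContOnCl ℂ g (ball 0 1) →
      ∫ ζ, g (ζ : UnitCircle) ∂(ν.map c) = g z := by
    intro g hg
    have hgm : Measurable fun ζ : UnitCircle => g ζ := by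
      refine Continuous.measurable ?_
      refine hg.continuousOn_ball.comp_continuous continuous_subtype_val fun ζ => ?_
      exact sphere_subset_closedBall ζ.2
    rw [hint _ hgm, ← hg.circleAverage_poissonKernel_smul hz, Real.circleAverage,
      intervalIntegral.integral_of_le Real.two_pi_pos.le, ← integral_smul]
    refine integral_congr_ae (Eventually.of_forall fun θ => ?_)
    simp [P, c, mul_assoc]
  obtain ⟨u, hu1, hu⟩ := exists_seq_tendsto_one
  have key : ∀ f ∈ HInfRDisc, ∫ ζ, f (circleToDisc ζ) ∂(ν.map c) = f z := by
    intro f hf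
    obtain ⟨C, hC⟩ := exists_bound hf
    -- The Poisson formula requires continuity up to the circle, so it is applied to the dilations
    -- `w ↦ f (uₙ w)`; dominated convergence then recovers `f`.
    have hn : ∀ n, ∫ ζ, f (shrink (u n) (circleToDisc ζ)) ∂(ν.map c) = f (shrink (u n) z) := by
      intro n
      have hd : DiffContOnCl ℂ (fun w : ℂ => discExt f (u n * w)) (ball 0 1) := by
        refine DifferentiableOn.diffContOnCl_ball (U := closedBall 0 1) ?_ subset_rfl
        exact hf.1.comp (by fun_prop) fun w hw => real_mul_mem_ball (hu1 n) ⟨w, hw⟩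
      have := hav _ hd
      simp only [← coe_shrink (Set.Ico_subset_Icc_self (hu1 n)), discExt_coe] at this
      rw [← this]
      refine integral_congr_ae (Eventually.of_forall fun ζ => ?_)
      have := coe_shrink (Set.Ico_subset_Icc_self (hu1 n)) (circleToDisc ζ)
      simp only
      rw [← discExt_coe f, this]
      rfl
    have hm : ∀ n, Measurable fun ζ => f (shrink (u n) (circleToDisc ζ)) := fun n => by
      refine Continuous.measurable ?_
      have : Continuous fun ζ : UnitCircle => discExt f (u n * (ζ : ℂ)) :=
        hf.1.continuousOn.comp_continuous (by fun_prop) fun ζ =>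
          real_mul_mem_ball (hu1 n) (circleToDisc ζ)
      refine this.congr fun ζ => ?_
      rw [← discExt_coe f, coe_shrink (Set.Ico_subset_Icc_self (hu1 n))]
      rfl
    refine tendsto_nhds_unique (f := fun n => f (shrink (u n) z)) (l := atTop) ?_
      ((tendsto_shrink hf z).comp hu)
    simp only [← hn]
    refine tendsto_integral_of_dominated_convergence (fun _ => C)
      (fun n => (hm n).aestronglyMeasurable) (integrable_const C)
      (fun n => Eventually.of_forall fun ζ => hC _)
      (Eventually.of_forall fun ζ => (tendsto_shrink hf _).comp hu)
  refine ⟨ν.map c, ⟨?_⟩, key⟩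
  -- The total mass is read off from the constant function 1.
  have h1 := key _ one_mem
  simp only [integral_const, Complex.real_smul, mul_one, Complex.ofReal_eq_one] at h1
  rw [← ENNReal.toReal_eq_one_iff]
  exact h1

end HInfRDisc

/-! ### Spectral measures with a basis of eigenvectors -/

section PurePoint

variable {I : Type*}

theorem hasSum_norm_sq_lp (x : lp (fun _ : I => ℂ) 2) : HasSum (fun i => ‖x i‖ ^ 2) (‖x‖ ^ 2) := by
  have := lp.hasSum_norm (p := 2) (by simp) x
  simpa using this

theorem tsum_enorm_sq_lp (x : lp (fun _ : I => ℂ) 2) : ∑' i, ‖x i‖ₑ ^ 2 = ‖x‖ₑ ^ 2 := by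
  have h := hasSum_norm_sq_lp x
  have := ENNReal.ofReal_tsum_of_nonneg (fun i => by positivity) h.summable
  rw [h.tsum_eq] at this
  simpa only [ENNReal.ofReal_pow (norm_nonneg _), ofReal_norm] using this.symm

theorem memℓp_indicator (S : Set I) (x : lp (fun _ : I => ℂ) 2) :
    Memℓp (fun i => S.indicator x i) 2 := by
  rw [memℓp_gen_iff (by simp)]
  simp only [ENNReal.toReal_ofNat, Real.rpow_ofNat]
  refine Summable.of_nonneg_of_le (fun i => by positivity) (fun i => ?_)
    (hasSum_norm_sq_lp x).summable
  gcongr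
  exact norm_indicator_le_norm_self _ i

/-- Multiplication by an indicator function on `ℓ²`. -/
noncomputable def lpIndicator (S : Set I) : lp (fun _ : I => ℂ) 2 →L[ℂ] lp (fun _ : I => ℂ) 2 :=
  LinearMap.mkContinuous
    { toFun := fun x => ⟨fun i => S.indicator x i, memℓp_indicator S x⟩
      map_add' := fun x y => lp.ext (funext fun i => congrFun (Set.indicator_add S x y) i)
      map_smul' := fun c x => lp.ext (funext fun i => congrFun (Set.indicator_const_smul S c x) i) }
    1 (fun x => by
      rw [one_mul]
      refine (sq_le_sq₀ (norm_nonneg _) (norm_nonneg _)).1 ?_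
      refine hasSum_le (fun i => ?_) (hasSum_norm_sq_lp _) (hasSum_norm_sq_lp x)
      have := norm_indicator_le_norm_self (s := S) (x : I → ℂ) i
      exact pow_le_pow_left₀ (norm_nonneg _) this 2)

theorem lpIndicator_apply (S : Set I) (x : lp (fun _ : I => ℂ) 2) (i : I) :
    lpIndicator S x i = S.indicator x i := rfl

theorem lpIndicator_single [DecidableEq I] {S : Set I} {i : I} (hi : i ∈ S) (c : ℂ) :
    lpIndicator S (lp.single 2 i c) = lp.single 2 i c := by
  ext j
  rw [lpIndicator_apply]
  by_cases hj : j ∈ S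
  · rw [Set.indicator_of_mem hj]
  · rw [Set.indicator_of_notMem hj, lp.single_apply_ne]
    rintro rfl
    exact hj hi

theorem isOrthProj_lpIndicator (S : Set I) : IsOrthProj (lpIndicator S) := by
  refine ⟨fun x => lp.ext (funext fun i => ?_), fun x y => ?_⟩
  · by_cases hi : i ∈ S <;> simp [lpIndicator_apply, hi]
  · rw [lp.inner_eq_tsum, lp.inner_eq_tsum]
    refine tsum_congr fun i => ?_
    by_cases hi : i ∈ S <;> simp [lpIndicator_apply, hi]

theorem hasSum_norm_sq_lpIndicator {s : ℕ → Set I} (hs : Pairwise (Function.onFun Disjoint s))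
    (x : lp (fun _ : I => ℂ) 2) :
    HasSum (fun n => ‖lpIndicator (s n) x‖ ^ 2) (‖lpIndicator (⋃ n, s n) x‖ ^ 2) := by
  have h : ∑' n, ‖lpIndicator (s n) x‖ₑ ^ 2 = ‖lpIndicator (⋃ n, s n) x‖ₑ ^ 2 := by
    simp only [← tsum_enorm_sq_lp, lpIndicator_apply]
    rw [ENNReal.tsum_comm]
    refine tsum_congr fun i => ?_
    by_cases hi : i ∈ ⋃ n, s n
    · obtain ⟨n, hn⟩ := Set.mem_iUnion.1 hi
      rw [tsum_eq_single n, Set.indicator_of_mem hn, Set.indicator_of_mem hi]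
      intro m hm
      rw [Set.indicator_of_notMem (Set.disjoint_right.1 (hs hm) hn)]
      simp
    · rw [Set.indicator_of_notMem hi]
      have : ∀ n, i ∉ s n := fun n hn => hi (Set.mem_iUnion.2 ⟨n, hn⟩)
      simp [this]
  have h1 := ENNReal.hasSum_toReal (f := fun n => ‖lpIndicator (s n) x‖ₑ ^ 2)
    (by rw [h]; exact ENNReal.pow_ne_top enorm_ne_top)
  rw [← ENNReal.tsum_toReal_eq (fun n => ENNReal.pow_ne_top enorm_ne_top), h] at h1
  simpa using h1

variable {X : Type*} [MeasurableSpace X]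

/-- The spectral measure on `ℓ²(I)` for which the basis vector of index `i` is an eigenvector of
eigenvalue `d i`. -/
noncomputable def purePointMeasure (d : I → X) : SpectralMeasure X (lp (fun _ : I => ℂ) 2) where
  proj s := lpIndicator (d ⁻¹' s)
  idem s _ := (isOrthProj_lpIndicator _).idem
  symm s _ := (isOrthProj_lpIndicator _).symm
  univ := by
    ext x i
    simp [lpIndicator_apply]
  iUnion s _ hd x := by
    rw [Set.preimage_iUnion]
    exact (isOrthProj_lpIndicator _).hasSum_of_hasSum_norm_sq
      (fun n => isOrthProj_lpIndicator _)
      (hasSum_norm_sq_lpIndicator fun m n hmn => (hd hmn).preimage d) x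

theorem purePointMeasure_proj (d : I → X) (s : Set X) :
    (purePointMeasure d).proj s = lpIndicator (d ⁻¹' s) := rfl

/-- For pure point spectral measures, double operator integrals are Schur products. -/
theorem inner_single_doubleOperatorIntegral [DecidableEq I] [MeasurableSingletonClass X]
    {d : I → X} {Φ : X × X → ℂ}
    (hΦ : BddMeasurable Φ) {Q T : HilbertSchmidt (lp (fun _ : I => ℂ) 2)}
    (h : IsDoubleOperatorIntegral (purePointMeasure d) (purePointMeasure d) Φ Q T) (i j : I) :
    T.toCLM (lp.single 2 j 1) i = Φ (d i, d j) * Q.toCLM (lp.single 2 j 1) i := by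
  obtain ⟨E, hE, J, hJ, rfl⟩ := h
  rw [hJ.unique (E.isIntegral_integral hΦ)]
  -- The matrix unit of index `(i, j)` lies in the range of the projection of the point `(d i, d
  -- j)`, hence is an eigenvector of every integral. Injectivity of `d` is not needed.
  have hr : E.proj {(d i, d j)} (HilbertSchmidt.rankOne (lp.single 2 i 1) (lp.single 2 j 1)) =
      HilbertSchmidt.rankOne (lp.single 2 i 1) (lp.single 2 j 1) := by
    rw [← Set.singleton_prod_singleton]
    ext1
    rw [hE _ _ (measurableSet_singleton _) (measurableSet_singleton _)]
    ext1 x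
    simp only [ContinuousLinearMap.comp_apply, HilbertSchmidt.rankOne_apply, map_smul,
      purePointMeasure_proj]
    rw [lpIndicator_single (by simp), ← (isOrthProj_lpIndicator _).symm,
      lpIndicator_single (by simp)]
  have := E.inner_integral_of_proj_singleton hΦ hr Q
  rw [HilbertSchmidt.inner_rankOne, HilbertSchmidt.inner_rankOne, lp.inner_single_left,
    lp.inner_single_left] at this
  simpa using this

end PurePoint

/-! ### Nuclear estimates for Schur multipliers -/

open scoped ComplexConjugate

/-- The matrix `M`, restricted to `F × F`, is a sum of rank one matrices `α k s * conj (β k t)` such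
that the squares of the norms of the vectors `α k`, and those of the vectors `β k`, add up to at
most `C`. -/
def NuclearLE {X : Type*} (F : Finset X) (M : X → X → ℂ) (C : ℝ) : Prop :=
  ∃ α β : ℕ → X → ℂ, (∀ s ∈ F, ∀ t ∈ F, HasSum (fun k => α k s * conj (β k t)) (M s t)) ∧
    ((Summable fun k => ∑ s ∈ F, ‖α k s‖ ^ 2) ∧ ∑' k, ∑ s ∈ F, ‖α k s‖ ^ 2 ≤ C) ∧
    ((Summable fun k => ∑ s ∈ F, ‖β k s‖ ^ 2) ∧ ∑' k, ∑ s ∈ F, ‖β k s‖ ^ 2 ≤ C)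

section Nuclear

variable {X : Type*} {F : Finset X} {M : X → X → ℂ}

theorem NuclearLE.mono {C D : ℝ} (h : NuclearLE F M C) (hCD : C ≤ D) : NuclearLE F M D := by
  obtain ⟨α, β, h1, h2, h3⟩ := h
  exact ⟨α, β, h1, ⟨h2.1, h2.2.trans hCD⟩, ⟨h3.1, h3.2.trans hCD⟩⟩

theorem NuclearLE.of_smul {C c : ℝ} (hc : 0 < c) (h : NuclearLE F (fun s t => c * M s t) C) :
    NuclearLE F M (c⁻¹ * C) := by
  obtain ⟨α, β, h1, h2, h3⟩ := h
  have hs : √c⁻¹ ^ 2 = c⁻¹ := Real.sq_sqrt (by positivity)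
  have key : ∀ γ : ℕ → X → ℂ, ((Summable fun k => ∑ s ∈ F, ‖γ k s‖ ^ 2) ∧
      ∑' k, ∑ s ∈ F, ‖γ k s‖ ^ 2 ≤ C) →
      (Summable fun k => ∑ s ∈ F, ‖(√c⁻¹ : ℂ) * γ k s‖ ^ 2) ∧
      ∑' k, ∑ s ∈ F, ‖(√c⁻¹ : ℂ) * γ k s‖ ^ 2 ≤ c⁻¹ * C := fun γ hγ => by
    have e : ∀ k s, ‖(√c⁻¹ : ℂ) * γ k s‖ ^ 2 = c⁻¹ * ‖γ k s‖ ^ 2 := fun k s => by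
      rw [norm_mul, mul_pow, Complex.norm_real, Real.norm_of_nonneg (by positivity), hs]
    simp only [e, ← Finset.mul_sum, tsum_mul_left]
    exact ⟨hγ.1.mul_left _, by gcongr; exact hγ.2⟩
  refine ⟨fun k s => √c⁻¹ * α k s, fun k s => √c⁻¹ * β k s, fun s hs' t ht => ?_,
    key α h2, key β h3⟩
  have := (h1 s hs' t ht).mul_left ((c⁻¹ : ℝ) : ℂ)
  have e : ((c⁻¹ : ℝ) : ℂ) * (c * M s t) = M s t := by
    rw [← mul_assoc, ← Complex.ofReal_mul, inv_mul_cancel₀ hc.ne', Complex.ofReal_one, one_mul]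
  rw [e] at this
  refine this.congr_fun fun k => ?_
  have hs2 : ((√c⁻¹ : ℝ) : ℂ) * ((√c⁻¹ : ℝ) : ℂ) = ((c⁻¹ : ℝ) : ℂ) := by
    rw [← Complex.ofReal_mul, ← sq, hs]
  rw [map_mul, Complex.conj_ofReal, ← hs2]
  ring

variable {I : Type*} [DecidableEq I]

/-- Read off the entries of a rank one expansion of `T`. The factors `√(‖b k‖ / ‖a k‖)` and `√(‖a k‖
/ ‖b k‖)` balance the two vectors: each squared norm becomes at most `‖a k‖ ‖b k‖`, and the product
of the vectors is unchanged. -/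
theorem NuclearLE.of_traceNorm_lt {ι : X → I} (hι : Function.Injective ι)
    {T : lp (fun _ : I => ℂ) 2 →L[ℂ] lp (fun _ : I => ℂ) 2} {C : ℝ}
    (hT : traceNorm T < ENNReal.ofReal C)
    (hM : ∀ s ∈ F, ∀ t ∈ F, T (lp.single 2 (ι t) 1) (ι s) = M s t) : NuclearLE F M C := by
  obtain ⟨a, b, hab, hlt⟩ := exists_of_traceNorm_lt hT
  have hC : 0 < C := ENNReal.ofReal_pos.1 (bot_le.trans_lt hlt)
  have h0 := ENNReal.hasSum_toReal hlt.ne_top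
  have e0 : ∀ k, (‖a k‖ₑ * ‖b k‖ₑ).toReal = ‖a k‖ * ‖b k‖ := fun k => by simp
  simp only [e0] at h0
  have hle : ∑' k, ‖a k‖ * ‖b k‖ ≤ C := by
    rw [← ENNReal.ofReal_le_ofReal_iff hC.le, ENNReal.ofReal_tsum_of_nonneg
      (fun k => by positivity) h0.summable]
    simp only [ENNReal.ofReal_mul (norm_nonneg _), ofReal_norm]
    exact hlt.le
  have key : ∀ f g : ℕ → lp (fun _ : I => ℂ) 2, (Summable fun k => ‖f k‖ * ‖g k‖) →
      ∑' k, ‖f k‖ * ‖g k‖ ≤ C →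
      (Summable fun k => ∑ s ∈ F, ‖(√(‖g k‖ / ‖f k‖) : ℂ) * f k (ι s)‖ ^ 2) ∧
        ∑' k, ∑ s ∈ F, ‖(√(‖g k‖ / ‖f k‖) : ℂ) * f k (ι s)‖ ^ 2 ≤ C := by
    intro f g hfg hC
    have e : ∀ k, ∑ s ∈ F, ‖(√(‖g k‖ / ‖f k‖) : ℂ) * f k (ι s)‖ ^ 2 ≤ ‖f k‖ * ‖g k‖ := by
      intro k
      have e1 : ∀ s, ‖(√(‖g k‖ / ‖f k‖) : ℂ) * f k (ι s)‖ ^ 2 =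
          ‖g k‖ / ‖f k‖ * ‖f k (ι s)‖ ^ 2 := fun s => by
        rw [norm_mul, mul_pow, Complex.norm_real, Real.norm_of_nonneg (by positivity),
          Real.sq_sqrt (by positivity)]
      have e2 : ∑ s ∈ F, ‖f k (ι s)‖ ^ 2 ≤ ‖f k‖ ^ 2 := by
        have := sum_le_hasSum (F.map ⟨ι, hι⟩) (fun _ _ => by positivity) (hasSum_norm_sq_lp (f k))
        simpa using this
      simp only [e1, ← Finset.mul_sum]
      rcases eq_or_ne (f k) 0 with h | h
      · simp [h]
      · have : 0 < ‖f k‖ := norm_pos_iff.2 h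
        refine (mul_le_mul_of_nonneg_left e2 (by positivity)).trans_eq ?_
        field_simp
    have hs := Summable.of_nonneg_of_le (fun k => Finset.sum_nonneg fun _ _ => by positivity) e hfg
    exact ⟨hs, (hs.tsum_le_tsum e hfg).trans hC⟩
  refine ⟨fun k s => √(‖b k‖ / ‖a k‖) * a k (ι s), fun k s => √(‖a k‖ / ‖b k‖) * b k (ι s),
    fun s hs t ht => ?_, key a b h0.summable hle,
    key b a (by simpa only [mul_comm] using h0.summable)
    (by simpa only [mul_comm] using hle)⟩
  have h1 := (hab (lp.single 2 (ι t) 1)).mapL (innerSL ℂ (lp.single 2 (ι s) 1))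
  simp only [innerSL_apply_apply, inner_smul_right, lp.inner_single_left, lp.inner_single_right,
    hM s hs t ht] at h1
  simp only [RCLike.inner_apply, map_one, mul_one, one_mul] at h1
  refine h1.congr_fun fun k => ?_
  -- If one of the vectors vanishes the quotients are the default 0, but so is the rank one term.
  rcases eq_or_ne (a k) 0 with ha | ha
  · simp [ha]
  rcases eq_or_ne (b k) 0 with hb | hb
  · simp [hb]
  have : √(‖b k‖ / ‖a k‖) * √(‖a k‖ / ‖b k‖) = 1 := by
    have ha := norm_pos_iff.2 ha
    have hb := norm_pos_iff.2 hb
    rw [← Real.sqrt_mul (by positivity), div_mul_div_cancel₀ ha.ne', div_self hb.ne', Real.sqrt_one]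
  rw [map_mul, Complex.conj_ofReal]
  have h2 : ((√(‖b k‖ / ‖a k‖) : ℝ) : ℂ) * ((√(‖a k‖ / ‖b k‖) : ℝ) : ℂ) = 1 := by
    exact_mod_cast this
  linear_combination (a k (ι s) * conj (b k (ι t))) * h2

end Nuclear

section BlockVectors

variable {X : Type*}

/-- The inclusion of the block of index `n`. -/
def blockEmb (n : ℕ) : X ↪ ULift.{u} (ℕ × X) :=
  ⟨fun s => ⟨(n, s)⟩, fun s t h => by simpa using h⟩

theorem exists_blockVector (n : ℕ) (F : Finset X) {u : X → ℂ} (hu : ∑ s ∈ F, ‖u s‖ ^ 2 ≤ 1) :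
    ∃ a : lp (fun _ : ULift.{u} (ℕ × X) => ℂ) 2, ‖a‖ ≤ 1 ∧ (∀ s ∈ F, a (blockEmb n s) = u s) ∧
      ∀ m s, m ≠ n → a (blockEmb m s) = 0 := by
  classical
  let f : ULift.{u} (ℕ × X) → ℂ := fun i => if i.down.1 = n ∧ i.down.2 ∈ F then u i.down.2 else 0
  have hf : ∀ i ∉ F.map (blockEmb n), ‖f i‖ ^ 2 = 0 := by
    intro i hi
    have : ¬ (i.down.1 = n ∧ i.down.2 ∈ F) := by
      rintro ⟨h1, h2⟩
      refine hi (Finset.mem_map.2 ⟨i.down.2, h2, ?_⟩)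
      rw [← h1]
      rfl
    simp [f, this]
  have hs : HasSum (fun i => ‖f i‖ ^ 2) _ := hasSum_sum_of_ne_finset_zero hf
  have hmem : Memℓp f 2 := by
    rw [memℓp_gen_iff (by simp)]
    simpa using hs.summable
  have hfs : ∀ s ∈ F, f (blockEmb n s) = u s := fun s hs => if_pos ⟨rfl, hs⟩
  refine ⟨⟨f, hmem⟩, ?_, hfs, fun m s hm => ?_⟩
  · have e := (hasSum_norm_sq_lp ⟨f, hmem⟩).unique hs
    rw [Finset.sum_map, Finset.sum_congr rfl fun s hs => by rw [hfs s hs]] at e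
    rw [← e] at hu
    exact (sq_le_one_iff₀ (norm_nonneg _)).1 hu
  · exact if_neg fun h => hm h.1

end BlockVectors

theorem traceNorm_le {H : Type*} [NormedAddCommGroup H] [InnerProductSpace ℂ H] [CompleteSpace H]
    {T : H →L[ℂ] H} {a b : ℕ → H} (h : ∀ x, HasSum (fun k => inner ℂ (b k) x • a k) (T x)) :
    traceNorm T ≤ ∑' k, ‖a k‖ₑ * ‖b k‖ₑ :=
  iInf_le_of_le a (iInf_le_of_le b (iInf_le _ h))

theorem traceNorm_rankOne_le {H : Type*} [NormedAddCommGroup H] [InnerProductSpace ℂ H]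
    [CompleteSpace H] (a b : H) : traceNorm (HilbertSchmidt.rankOne a b).toCLM ≤ ‖a‖ₑ * ‖b‖ₑ := by
  refine (traceNorm_le (a := fun k => if k = 0 then a else 0)
    (b := fun k => if k = 0 then b else 0) fun x => ?_).trans_eq ?_
  · have := hasSum_single (L := .unconditional ℕ)
      (f := fun k : ℕ => inner ℂ (if k = 0 then b else 0) x • (if k = 0 then a else 0)) 0
      fun k hk => by simp [hk]
    simpa using this
  · rw [tsum_eq_single 0 fun k hk => by simp [hk]]
    simp

theorem HilbertSchmidt.toCLM_rankOne_single {I : Type*} [DecidableEq I]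
    (a b : lp (fun _ : I => ℂ) 2) (i j : I) :
    (rankOne a b).toCLM (lp.single 2 j 1) i = a i * conj (b j) := by
  simp [lp.inner_single_right, mul_comm]

section Schur

variable {X : Type} [MeasurableSpace X]

variable (X) in
/-- The spectral measure on `ℓ²(ℕ × X)` for which the basis vectors of index `(n, s)` are
eigenvectors of eigenvalue `s`. -/
noncomputable def blockMeasure :
    SpectralMeasure X (lp (fun _ : ULift.{u} (ℕ × X) => ℂ) 2) :=
  purePointMeasure fun i => i.down.2

variable [MeasurableSingletonClass X] {Φ : X × X → ℂ}

open HilbertSchmidt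

/-- The transformer is tested on the rank one operator with entries `u s * conj (v t)` in block 0,
whose trace norm is at most 1. The index set is lifted to the universe over which the Hilbert spaces
range. -/
theorem nuclearLE_of_schurNorm_lt
    (h : IsSchurMultiplier (blockMeasure.{u} X) (blockMeasure.{u} X) Φ) {C : ℝ}
    (hC : schurNorm (blockMeasure.{u} X) (blockMeasure.{u} X) Φ < ENNReal.ofReal C)
    (F : Finset X) (u v : X → ℂ) (hu : ∑ s ∈ F, ‖u s‖ ^ 2 ≤ 1) (hv : ∑ s ∈ F, ‖v s‖ ^ 2 ≤ 1) :
    NuclearLE F (fun s t => Φ (s, t) * (u s * conj (v t))) C := by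
  classical
  obtain ⟨a, ha1, ha, -⟩ := exists_blockVector 0 F hu
  obtain ⟨b, hb1, hb, -⟩ := exists_blockVector 0 F hv
  have hQ : traceNorm (rankOne a b).toCLM ≤ 1 := by
    refine (traceNorm_rankOne_le a b).trans (mul_le_one' ?_ ?_)
    · rw [← ofReal_norm]
      exact ENNReal.ofReal_le_one.2 ha1
    · rw [← ofReal_norm]
      exact ENNReal.ofReal_le_one.2 hb1
  obtain ⟨T, hT, -⟩ := h.2.2 (rankOne a b) (hQ.trans_lt ENNReal.one_lt_top)
  have hTn : traceNorm T.toCLM ≤ schurNorm (blockMeasure.{u} X) (blockMeasure.{u} X) Φ :=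
    le_iSup₂_of_le (rankOne a b) T (le_iSup₂_of_le hQ hT le_rfl)
  refine NuclearLE.of_traceNorm_lt (blockEmb 0).injective (hTn.trans_lt hC) fun s hs t ht => ?_
  rw [inner_single_doubleOperatorIntegral ⟨h.1, h.2.1⟩ hT, toCLM_rankOne_single, ha s hs, hb t ht]
  rfl

/-- A Schur multiplier has a finite norm on the finite sections. -/
theorem exists_nuclearLE (h : IsSchurMultiplier (blockMeasure.{u} X) (blockMeasure.{u} X) Φ) :
    ∃ C : ℝ, ∀ (F : Finset X) (u v : X → ℂ), ∑ s ∈ F, ‖u s‖ ^ 2 ≤ 1 → ∑ s ∈ F, ‖v s‖ ^ 2 ≤ 1 →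
      NuclearLE F (fun s t => Φ (s, t) * (u s * conj (v t))) C := by
  classical
  -- Gliding hump: a multiplier is only assumed to map trace class into trace class. If no constant
  -- works, a counterexample to the constant `4 ^ n` is placed in the block `n` with weight `2⁻ⁿ`;
  -- the weighted sum is of trace class. This is what the infinitely many blocks of `blockMeasure`
  -- are for.
  by_contra! hne
  choose F u v hu hv hn using fun n : ℕ => hne (4 ^ n)
  choose a ha1 ha ha0 using fun n => exists_blockVector.{u} n (F n) (hu n)
  choose b hb1 hb hb0 using fun n => exists_blockVector.{u} n (F n) (hv n)
  have hR : ∀ n, ‖rankOne (((1 / 2 : ℝ) ^ n : ℂ) • a n) (b n)‖ ≤ (1 / 2 : ℝ) ^ n := fun n => by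
    rw [norm_rankOne, norm_smul]
    have : ‖((1 / 2 : ℝ) ^ n : ℂ)‖ = (1 / 2 : ℝ) ^ n := by simp
    rw [this, mul_assoc]
    exact mul_le_of_le_one_right (by positivity) (mul_le_one₀ (ha1 n) (norm_nonneg _) (hb1 n))
  have hgeo : Summable fun n : ℕ => (1 / 2 : ℝ) ^ n := summable_geometric_two
  have hsum : Summable fun n => rankOne (((1 / 2 : ℝ) ^ n : ℂ) • a n) (b n) :=
    Summable.of_norm_bounded hgeo hR
  obtain ⟨Q, hQ⟩ := hsum
  have hQx : ∀ y x, HasSum (fun n => inner ℂ y (inner ℂ (b n) x • ((1 / 2 : ℝ) ^ n : ℂ) • a n))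
      (inner ℂ y (Q.toCLM x)) := fun y x => by
    have := hQ.mapL (innerSL ℂ (rankOne y x))
    simpa only [innerSL_apply_apply, inner_rankOne, rankOne_apply] using this
  have hQs : ∀ x, HasSum (fun n => inner ℂ (b n) x • ((1 / 2 : ℝ) ^ n : ℂ) • a n)
      (Q.toCLM x) := fun x => by
    have hs : Summable fun n => inner ℂ (b n) x • ((1 / 2 : ℝ) ^ n : ℂ) • a n := by
      refine Summable.of_norm_bounded (hgeo.mul_right ‖x‖) fun n => ?_
      rw [norm_smul]
      have h2 := norm_inner_le_norm (𝕜 := ℂ) (b n) x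
      have h3 := hR n
      rw [norm_rankOne] at h3
      calc _ ≤ (‖b n‖ * ‖x‖) * ‖((1 / 2 : ℝ) ^ n : ℂ) • a n‖ := by gcongr
        _ = (‖((1 / 2 : ℝ) ^ n : ℂ) • a n‖ * ‖b n‖) * ‖x‖ := by ring
        _ ≤ _ := by gcongr
    obtain ⟨z, hz⟩ := hs
    -- Convergence in the Hilbert-Schmidt norm identifies the matrix coefficients; the vector series
    -- is already known to converge.
    have : z = Q.toCLM x := ext_inner_left ℂ fun y =>
      (hz.mapL (innerSL ℂ y)).unique (hQx y x)
    rwa [this] at hz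
  have hQ1 : IsTraceClass Q.toCLM := by
    refine (traceNorm_le hQs).trans_lt ?_
    have h1 : ∀ n, ‖((1 / 2 : ℝ) ^ n : ℂ) • a n‖ₑ * ‖b n‖ₑ ≤ ENNReal.ofReal ((1 / 2 : ℝ) ^ n) :=
      fun n => by
        rw [← ofReal_norm, ← ofReal_norm, ← ENNReal.ofReal_mul (norm_nonneg _), ← norm_rankOne]
        exact ENNReal.ofReal_le_ofReal (hR n)
    refine (ENNReal.tsum_le_tsum h1).trans_lt ?_
    rw [← ENNReal.ofReal_tsum_of_nonneg (fun n => by positivity) hgeo]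
    exact ENNReal.ofReal_lt_top
  obtain ⟨T, hT, hT1⟩ := h.2.2 Q hQ1
  have hlt : traceNorm T.toCLM < ENNReal.ofReal ((traceNorm T.toCLM).toReal + 1) := by
    rw [ENNReal.lt_ofReal_iff_toReal_lt hT1.ne]
    exact lt_add_one _
  obtain ⟨n, hn2⟩ := pow_unbounded_of_one_lt ((traceNorm T.toCLM).toReal + 1) (one_lt_two (α := ℝ))
  -- The image is of trace class, so for some `n` its norm plus 1 is below `2 ^ n`. Undoing the
  -- weight `2⁻ⁿ` of the block costs another `2 ^ n`, which contradicts the failure at `4 ^ n`.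
  refine hn n (NuclearLE.mono (NuclearLE.of_smul (c := (1 / 2 : ℝ) ^ n) (by positivity)
    (NuclearLE.of_traceNorm_lt (blockEmb n).injective hlt fun s hs t ht => ?_)) ?_)
  · rw [inner_single_doubleOperatorIntegral ⟨h.1, h.2.1⟩ hT]
    have h1 : Q.toCLM (lp.single 2 (blockEmb n t) 1) (blockEmb n s) =
        ((1 / 2 : ℝ) ^ n : ℂ) * (u n s * conj (v n t)) := by
      have h2 := hQx (lp.single 2 (blockEmb n s) 1) (lp.single 2 (blockEmb n t) 1)
      rw [lp.inner_single_left] at h2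
      simp only [RCLike.inner_apply, map_one, mul_one] at h2
      refine h2.unique ?_
      have h3 := hasSum_single (L := .unconditional ℕ) (f := fun m =>
        inner ℂ (lp.single 2 (blockEmb n s) 1) (inner ℂ (b m) (lp.single 2 (blockEmb n t) 1) •
          ((1 / 2 : ℝ) ^ m : ℂ) • a m)) n fun m hm => by
        rw [inner_smul_right, inner_smul_right, lp.inner_single_left, ha0 m n s hm.symm]
        simp
      convert h3 using 1
      rw [inner_smul_right, inner_smul_right, lp.inner_single_left, lp.inner_single_right,
        ha n s hs, hb n t ht]
      simp only [RCLike.inner_apply, map_one, mul_one, one_mul]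
      ring
    rw [h1]
    change Φ (s, t) * _ = _
    push_cast
    ring
  · have e : (((1 / 2 : ℝ) ^ n)⁻¹) = 2 ^ n := by simp
    have e4 : (4 : ℝ) ^ n = 2 ^ n * 2 ^ n := by rw [← mul_pow]; norm_num
    rw [e, e4]
    gcongr

end Schur

/-! ### From nuclear estimates to positive semidefinite kernels -/

open scoped ComplexConjugate ComplexOrder

section Finite

variable {X : Type*} [Fintype X]

/-- The rows of a nuclear expansion become vectors of `ℓ²` after division by the weights `w s`;
conjugation makes the inner product of two such vectors match `∑ α k s * conj (β k t)`. -/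
theorem exists_lp_of_summable {α : ℕ → X → ℂ} {C : ℝ} {w : X → ℝ} (hw : ∀ s, 0 < w s)
    (h : (Summable fun k => ∑ s, ‖α k s‖ ^ 2) ∧ ∑' k, ∑ s, ‖α k s‖ ^ 2 ≤ C) :
    ∃ V : X → lp (fun _ : ℕ => ℂ) 2, (∀ s k, V s k = conj (α k s) / w s) ∧
      ∑ s, w s ^ 2 * ‖V s‖ ^ 2 ≤ C := by
  have hs : ∀ s, Summable fun k => ‖α k s‖ ^ 2 := fun s =>
    Summable.of_nonneg_of_le (fun k => by positivity)
      (fun k => Finset.single_le_sum (f := fun s => ‖α k s‖ ^ 2) (fun _ _ => by positivity)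
        (Finset.mem_univ s)) h.1
  have e : ∀ s k, ‖conj (α k s) / (w s : ℂ)‖ ^ 2 = (w s ^ 2)⁻¹ * ‖α k s‖ ^ 2 := fun s k => by
    rw [norm_div, div_pow, RCLike.norm_conj, Complex.norm_real, Real.norm_of_nonneg (hw s).le,
      div_eq_inv_mul]
  have hmem : ∀ s, Memℓp (fun k => conj (α k s) / (w s : ℂ)) 2 := fun s => by
    rw [memℓp_gen_iff (by simp)]
    simp only [ENNReal.toReal_ofNat, Real.rpow_ofNat, e]
    exact (hs s).mul_left _
  refine ⟨fun s => ⟨_, hmem s⟩, fun s k => rfl, ?_⟩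
  refine le_trans (le_of_eq ?_) h.2
  rw [Summable.tsum_finsetSum fun s _ => hs s]
  refine Finset.sum_congr rfl fun s _ => ?_
  rw [← (hasSum_norm_sq_lp _).tsum_eq]
  simp only [e, tsum_mul_left]
  have := (hw s).ne'
  field_simp

variable {A : X → X → ℂ} {C : ℝ}

/-- Weighted estimates of the diagonal of a positive semidefinite completion. -/
theorem exists_posSemidef_weighted [Nonempty X]
    (hA : ∀ u v : X → ℂ, ∑ s, ‖u s‖ ^ 2 ≤ 1 → ∑ s, ‖v s‖ ^ 2 ≤ 1 →
      NuclearLE Finset.univ (fun s t => A s t * (u s * conj (v t))) C) {q : X ⊕ X → ℝ}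
    (hq : ∀ i, 0 < q i) :
    ∃ Z : Matrix (X ⊕ X) (X ⊕ X) ℂ, Z.PosSemidef ∧ (∀ s t, Z (.inl s) (.inr t) = A s t) ∧
      ∑ i, q i * (Z i i).re ≤ C * ∑ i, q i := by
  have hn : ∀ p : X → ℝ, (∀ s, 0 < p s) → (∀ s, 0 < √(p s / ∑ s, p s)) ∧
      0 < ∑ s, p s ∧ (∑ s, ‖(√(p s / ∑ s, p s) : ℂ)‖ ^ 2 ≤ 1) ∧
      ∀ s, √(p s / ∑ s, p s) ^ 2 = p s / ∑ s, p s := fun p hp => by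
    have h0 : 0 < ∑ s, p s := Finset.sum_pos (fun s _ => hp s) Finset.univ_nonempty
    have h1 : ∀ s, √(p s / ∑ s, p s) ^ 2 = p s / ∑ s, p s := fun s =>
      Real.sq_sqrt (div_pos (hp s) h0).le
    refine ⟨fun s => Real.sqrt_pos.2 (div_pos (hp s) h0), h0, ?_, h1⟩
    simp only [Complex.norm_real, Real.norm_of_nonneg (Real.sqrt_nonneg _), h1, ← Finset.sum_div]
    rw [div_self h0.ne']
  -- The test vectors are the square roots of the weights `q`, normalized separately on the two
  -- copies of `X`. Dividing the nuclear expansion by them leaves vectors whose inner products are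
  -- the entries of `A`, and the weights reappear in the estimate of the norms.
  obtain ⟨hu0, ha, hu1, hu⟩ := hn (fun s => q (.inl s)) fun s => hq _
  obtain ⟨hv0, hb, hv1, hv⟩ := hn (fun s => q (.inr s)) fun s => hq _
  set a := ∑ s, q (.inl s)
  set b := ∑ s, q (.inr s)
  obtain ⟨α, β, hαβ, hα, hβ⟩ := hA _ _ hu1 hv1
  obtain ⟨V, hV, hV2⟩ := exists_lp_of_summable hu0 hα
  obtain ⟨W, hW, hW2⟩ := exists_lp_of_summable hv0 hβ
  refine ⟨Matrix.gram ℂ (Sum.elim V W), Matrix.posSemidef_gram ℂ _, fun s t => ?_, ?_⟩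
  · rw [Matrix.gram_apply, Sum.elim_inl, Sum.elim_inr]
    refine (lp.hasSum_inner (V s) (W t)).unique ?_
    have h1 := (hαβ s (Finset.mem_univ s) t (Finset.mem_univ t)).mul_left
      ((√(q (.inl s) / a) : ℂ)⁻¹ * (√(q (.inr t) / b) : ℂ)⁻¹)
    have hs : (√(q (.inl s) / a) : ℂ) ≠ 0 := by exact_mod_cast (hu0 s).ne'
    have ht : (√(q (.inr t) / b) : ℂ) ≠ 0 := by exact_mod_cast (hv0 t).ne'
    have e : (√(q (.inl s) / a) : ℂ)⁻¹ * (√(q (.inr t) / b) : ℂ)⁻¹ *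
        (A s t * ((√(q (.inl s) / a) : ℂ) * conj (√(q (.inr t) / b) : ℂ))) = A s t := by
      rw [Complex.conj_ofReal]
      field_simp
    rw [e] at h1
    refine h1.congr_fun fun k => ?_
    rw [hV, hW, RCLike.inner_apply, map_div₀, Complex.conj_conj, Complex.conj_ofReal]
    field_simp
  · have hg : ∀ i, (Matrix.gram ℂ (Sum.elim V W) i i).re = ‖Sum.elim V W i‖ ^ 2 := fun i => by
      rw [Matrix.gram_apply, ← inner_self_eq_norm_sq (𝕜 := ℂ)]
      rfl
    simp only [hg, Fintype.sum_sum_type, Sum.elim_inl, Sum.elim_inr]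
    have e1 : ∑ s, q (.inl s) * ‖V s‖ ^ 2 ≤ a * C := by
      rw [← mul_le_mul_iff_right₀ (inv_pos.2 ha), inv_mul_cancel_left₀ ha.ne', Finset.mul_sum]
      refine le_trans (le_of_eq (Finset.sum_congr rfl fun s _ => ?_)) hV2
      rw [hu s]
      ring
    have e2 : ∑ s, q (.inr s) * ‖W s‖ ^ 2 ≤ b * C := by
      rw [← mul_le_mul_iff_right₀ (inv_pos.2 hb), inv_mul_cancel_left₀ hb.ne', Finset.mul_sum]
      refine le_trans (le_of_eq (Finset.sum_congr rfl fun s _ => ?_)) hW2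
      rw [hv s]
      ring
    linarith

/-- A minimax argument: for every system of positive weights some completion has weighted diagonal
average at most `C`; Hahn-Banach produces one completion with the whole diagonal at most `D`.
Otherwise the convex set `S` of upper bounds for diagonals would miss the open orthant `U` of
vectors with all coordinates below `D`, and the separating functional would be a system of weights
violating the averaged estimate. -/
theorem exists_posSemidef_of_finite [Nonempty X]
    (hA : ∀ u v : X → ℂ, ∑ s, ‖u s‖ ^ 2 ≤ 1 → ∑ s, ‖v s‖ ^ 2 ≤ 1 →
      NuclearLE Finset.univ (fun s t => A s t * (u s * conj (v t))) C) {D : ℝ} (hD : C < D) :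
    ∃ Z : Matrix (X ⊕ X) (X ⊕ X) ℂ, Z.PosSemidef ∧ (∀ s t, Z (.inl s) (.inr t) = A s t) ∧
      ∀ i, (Z i i).re ≤ D := by
  classical
  by_contra! hne
  let S : Set (X ⊕ X → ℝ) := {d | ∃ Z : Matrix (X ⊕ X) (X ⊕ X) ℂ, Z.PosSemidef ∧
    (∀ s t, Z (.inl s) (.inr t) = A s t) ∧ ∀ i, (Z i i).re ≤ d i}
  let U : Set (X ⊕ X → ℝ) := Set.pi Set.univ fun _ => Set.Iio D
  have hU : Convex ℝ U := convex_pi fun i _ => convex_Iio D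
  have hUo : IsOpen U := isOpen_set_pi Set.finite_univ fun i _ => isOpen_Iio
  have hS : Convex ℝ S := by
    rintro d ⟨Z, hZ, hZA, hZd⟩ e ⟨W, hW, hWA, hWe⟩ a b ha hb hab
    refine ⟨a • Z + b • W, (hZ.smul ha).add (hW.smul hb), fun s t => ?_, fun i => ?_⟩
    · rw [Matrix.add_apply, Matrix.smul_apply, Matrix.smul_apply, hZA, hWA, ← add_smul, hab,
        one_smul]
    · simp only [Matrix.add_apply, Matrix.smul_apply, Complex.add_re, Complex.smul_re, smul_eq_mul,
        Pi.add_apply, Pi.smul_apply]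
      have := hZd i
      have := hWe i
      gcongr
  have hdisj : Disjoint U S := by
    refine Set.disjoint_left.2 fun d hdU ⟨Z, hZ, hZA, hZd⟩ => ?_
    obtain ⟨i, hi⟩ := hne Z hZ hZA
    exact (hi.trans_le (hZd i)).not_ge (hdU i trivial).le
  obtain ⟨f, r, hfU, hfS⟩ := geometric_hahn_banach_open hU hUo hS hdisj
  set p : X ⊕ X → ℝ := fun i => f (fun j => if i = j then 1 else 0) with hp
  have hf : ∀ d, f d = ∑ i, p i * d i := fun d => by
    have := (f : (X ⊕ X → ℝ) →ₗ[ℝ] ℝ).pi_apply_eq_sum_univ d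
    simpa [hp, mul_comm] using this
  have hconst : ∀ c < D, c * ∑ i, p i < r := fun c hc => by
    have := hfU (fun _ => c) fun i _ => hc
    rw [hf, ← Finset.sum_mul] at this
    linarith
  -- `U` is unbounded below in each coordinate, so a negative weight would make the functional too
  -- large on `U`. The shift `(r - m) / (-p i)` is chosen to reach the value `r` exactly.
  have hp0 : ∀ i, 0 ≤ p i := by
    intro i
    by_contra! hi
    have h1 := hconst (D - 1) (by linarith)
    set m := (D - 1) * ∑ i, p i
    have h2 := hfU (fun j => (D - 1) - if j = i then (r - m) / (-p i) else 0) fun j _ => by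
      have : 0 ≤ (r - m) / (-p i) := div_nonneg (by linarith) (by linarith)
      have : 0 ≤ if j = i then (r - m) / (-p i) else 0 := by split_ifs <;> simp [this]
      simp only [Set.mem_Iio]
      linarith
    rw [hf] at h2
    simp only [mul_sub, Finset.sum_sub_distrib, mul_ite, mul_zero, Finset.sum_ite_eq',
      Finset.mem_univ, if_true] at h2
    rw [← Finset.sum_sub_distrib] at h2
    have h3 : p i * ((r - m) / (-p i)) = m - r := by
      have := hi.ne
      field_simp
      ring
    have h4 : ∑ i, (p i * D - p i * 1) = m := by
      simp only [m, Finset.mul_sum]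
      exact Finset.sum_congr rfl fun _ _ => by ring
    rw [h3, h4] at h2
    linarith
  have hP0 : 0 ≤ ∑ i, p i := Finset.sum_nonneg fun i _ => hp0 i
  have hDr : D * ∑ i, p i ≤ r := by
    refine le_of_forall_pos_lt_add fun ε hε => ?_
    have h1 := hconst (D - ε / (∑ i, p i + 1)) (by
      have : 0 < ε / (∑ i, p i + 1) := by positivity
      linarith)
    have h2 : ε / (∑ i, p i + 1) * ∑ i, p i ≤ ε := by
      rw [div_mul_eq_mul_div, div_le_iff₀ (by positivity)]
      nlinarith
    linarith
  -- Some weights may vanish, while the weighted estimate needs positive ones; hence the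
  -- perturbation by `δ`, removed in the limit below.
  have hrC : ∀ δ > 0, r ≤ C * ∑ i, (p i + δ) := fun δ hδ => by
    obtain ⟨Z, hZ, hZA, hZq⟩ := exists_posSemidef_weighted hA (q := fun i => p i + δ)
      fun i => by have := hp0 i; positivity
    refine (hfS (fun i => (Z i i).re) ⟨Z, hZ, hZA, fun i => le_rfl⟩).trans ?_
    rw [hf]
    refine le_trans (Finset.sum_le_sum fun i _ => ?_) hZq
    have h1 : 0 ≤ (Z i i).re := (Complex.nonneg_iff.1 hZ.diag_nonneg).1
    nlinarith
  have hrC' : r ≤ C * ∑ i, p i := by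
    have ht : Tendsto (fun δ : ℝ => C * ∑ i, (p i + δ)) (𝓝[>] 0) (𝓝 (C * ∑ i, (p i + 0))) := by
      have : Continuous fun δ : ℝ => C * ∑ i, (p i + δ) := by fun_prop
      exact (this.tendsto 0).mono_left nhdsWithin_le_nhds
    simp only [add_zero] at ht
    exact ge_of_tendsto ht (eventually_mem_nhdsWithin.mono hrC)
  -- `D ∑ p ≤ r ≤ C ∑ p` with `C < D` leaves only zero total weight. Then `r ≤ 0`, whereas strict
  -- separation at a constant vector of `U` gives `0 < r`.
  have hP : ∑ i, p i = 0 := by nlinarith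
  have := hconst (D - 1) (by linarith)
  rw [hP] at this hrC'
  linarith

end Finite

/-! ### Factorization of Schur multipliers through a Hilbert space -/

section Factorization

/-- A 2 × 2 principal minor is nonnegative. A bound on the diagonal thus bounds all entries, as
compactness will require. -/
theorem Matrix.PosSemidef.norm_sq_apply_le {J : Type*} {Z : Matrix J J ℂ} (hZ : Z.PosSemidef)
    (i j : J) : ‖Z i j‖ ^ 2 ≤ (Z i i).re * (Z j j).re := by
  have h := (hZ.submatrix ![i, j]).det_nonneg
  have hr : ∀ i, Z i i = ((Z i i).re : ℂ) := fun i =>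
    Complex.ext rfl (Complex.nonneg_iff.1 (hZ.diag_nonneg (i := i))).2.symm
  rw [Matrix.det_fin_two] at h
  simp only [Matrix.submatrix_apply, Matrix.cons_val_zero, Matrix.cons_val_one] at h
  rw [← hZ.1.apply j i, hr i, hr j, Complex.star_def, Complex.mul_conj, Complex.normSq_eq_norm_sq,
    ← Complex.ofReal_mul, ← Complex.ofReal_sub] at h
  have := Complex.zero_le_real.1 h
  linarith

/-- Pointwise limits of positive semidefinite kernels are positive semidefinite. -/
theorem Matrix.PosSemidef.of_tendsto {J ι : Type*} {l : Filter ι} [l.NeBot]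
    {Z : ι → Matrix J J ℂ} {K : Matrix J J ℂ} (hZ : ∀ n, (Z n).PosSemidef)
    (h : ∀ i j, Tendsto (fun n => Z n i j) l (𝓝 (K i j))) : K.PosSemidef := by
  refine ⟨?_, fun x => ?_⟩
  · ext i j
    refine tendsto_nhds_unique ?_ (h i j)
    have := (Complex.continuous_conj.tendsto _).comp (h j i)
    exact this.congr fun n => (hZ n).1.apply i j
  · have ht : Tendsto (fun n => x.sum fun i xi => x.sum fun j xj => star xi * Z n i j * xj) l
        (𝓝 (x.sum fun i xi => x.sum fun j xj => star xi * K i j * xj)) :=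
      tendsto_finsetSum _ fun i _ => tendsto_finsetSum _ fun j _ =>
        ((h i j).const_mul _).mul_const _
    exact ge_of_tendsto' ht fun n => (hZ n).2 x

/-- A positive semidefinite kernel is a Gram matrix. -/
theorem Matrix.PosSemidef.exists_inner {J : Type u} {Z : Matrix J J ℂ} (hZ : Z.PosSemidef) :
    ∃ (H : Type u) (_ : NormedAddCommGroup H) (_ : InnerProductSpace ℂ H) (_ : CompleteSpace H)
      (x : J → H), ∀ i j, inner ℂ (x i) (x j) = Z i j := by
  -- The scalar kernel is viewed as a kernel of operators on `ℂ`; the Gram vectors are the kernel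
  -- functions of its reproducing kernel Hilbert space.
  let K : Matrix J J (ℂ →L[ℂ] ℂ) := Matrix.of fun i j => Z i j • (1 : ℂ →L[ℂ] ℂ)
  have hK : K.PosSemidef := by
    have hiff := (RKHS.posSemidef_tfae (𝕜 := ℂ) (K := K)).out 0 2
    refine hiff.2 ⟨?_, fun v => ?_⟩
    · ext i j
      simp [K, Matrix.conjTranspose_apply, ← hZ.1.apply i j]
    · have := (Complex.nonneg_iff.1 (hZ.2 v)).1
      refine this.trans_eq (congrArg Complex.re ?_)
      refine Finsupp.sum_congr fun i _ => Finsupp.sum_congr fun j _ => ?_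
      rw [← hZ.1.apply i j]
      simp [K]
      ring
  have : Fact K.PosSemidef := ⟨hK⟩
  refine ⟨RKHS.OfKernel K, inferInstance, inferInstance, inferInstance,
    fun i => RKHS.kerFun (RKHS.OfKernel K) i 1, fun i j => ?_⟩
  have := RKHS.kernel_inner (RKHS.OfKernel K) j i (1 : ℂ) (1 : ℂ)
  rw [← this, RKHS.OfKernel.kernel_ofKernel, ← hZ.1.apply i j]
  simp [K]

variable {X : Type} {Φ : X × X → ℂ} {C D : ℝ}

/-- Compactness: the completions of the finite sections have entries in the disc of radius `D`, so
they converge entrywise along an ultrafilter of finite sets. Positivity, the prescribed block and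
the diagonal bound are closed conditions. -/
theorem NuclearLE.exists_posSemidef [Nonempty X]
    (hΦ : ∀ (F : Finset X) (u v : X → ℂ), ∑ s ∈ F, ‖u s‖ ^ 2 ≤ 1 → ∑ s ∈ F, ‖v s‖ ^ 2 ≤ 1 →
      NuclearLE F (fun s t => Φ (s, t) * (u s * conj (v t))) C) (hD : C < D) :
    ∃ Z : Matrix (X ⊕ X) (X ⊕ X) ℂ, Z.PosSemidef ∧ (∀ s t, Z (.inl s) (.inr t) = Φ (s, t)) ∧
      ∀ i, (Z i i).re ≤ D := by
  classical
  obtain ⟨x₀⟩ := ‹Nonempty X›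
  have hfin : ∀ F : Finset X, ∃ Z : Matrix (X ⊕ X) (X ⊕ X) ℂ, Z.PosSemidef ∧
      (∀ s ∈ F, ∀ t ∈ F, Z (.inl s) (.inr t) = Φ (s, t)) ∧ ∀ i, (Z i i).re ≤ D := by
    intro F
    let G := insert x₀ F
    have : Nonempty G := ⟨⟨x₀, Finset.mem_insert_self _ _⟩⟩
    -- A retraction of `X` onto the finite set. Pulling the completion back along it puts all
    -- kernels on one index set and keeps positivity and the diagonal bound; `x₀` keeps `G`
    -- nonempty.
    let r : X → G := fun s => if h : s ∈ G then ⟨s, h⟩ else ⟨x₀, Finset.mem_insert_self _ _⟩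
    have hr : ∀ s ∈ F, (r s : X) = s := fun s hs => by simp [r, G, hs]
    have hrr : ∀ s : G, r s = s := fun s => by simp [r]
    have hG : ∀ u v : G → ℂ, ∑ s, ‖u s‖ ^ 2 ≤ 1 → ∑ s, ‖v s‖ ^ 2 ≤ 1 →
        NuclearLE Finset.univ (fun s t : G => Φ (s, t) * (u s * conj (v t))) C := by
      intro u v hu hv
      obtain ⟨α, β, h1, h2, h3⟩ := hΦ G (u ∘ r) (v ∘ r)
        (by rw [← Finset.sum_coe_sort]; simpa [hrr] using hu)
        (by rw [← Finset.sum_coe_sort]; simpa [hrr] using hv)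
      refine ⟨fun k s => α k s, fun k s => β k s, fun s _ t _ => ?_, ?_, ?_⟩
      · have := h1 s s.2 t t.2
        simpa [hrr] using this
      · simpa only [← Finset.sum_coe_sort G] using h2
      · simpa only [← Finset.sum_coe_sort G] using h3
    obtain ⟨Z, hZ, hZΦ, hZD⟩ := exists_posSemidef_of_finite hG hD
    refine ⟨Z.submatrix (Sum.map r r) (Sum.map r r), hZ.submatrix _, fun s hs t ht => ?_,
      fun i => hZD _⟩
    rw [Matrix.submatrix_apply, Sum.map_inl, Sum.map_inr, hZΦ, hr s hs, hr t ht]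
  choose Z hZ hZΦ hZD using hfin
  let l : Ultrafilter (Finset X) := Ultrafilter.of atTop
  have hl : (l : Filter (Finset X)) ≤ atTop := Ultrafilter.of_le atTop
  have hlim : ∀ i j, ∃ z, Tendsto (fun F => Z F i j) l (𝓝 z) := fun i j => by
    have hb : ∀ F, Z F i j ∈ Metric.closedBall (0 : ℂ) D := fun F => by
      have h0 : ∀ i, 0 ≤ (Z F i i).re := fun i => (Complex.nonneg_iff.1 ((hZ F).diag_nonneg)).1
      have h1 := (hZ F).norm_sq_apply_le i j
      have hD0 : 0 ≤ D := (h0 i).trans (hZD F i)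
      rw [mem_closedBall_zero_iff]
      refine (sq_le_sq₀ (norm_nonneg _) hD0).1 (h1.trans ?_)
      rw [sq]
      exact mul_le_mul (hZD F i) (hZD F j) (h0 j) hD0
    obtain ⟨z, -, hz⟩ := (isCompact_closedBall (0 : ℂ) D).ultrafilter_le_nhds
      (l.map fun F => Z F i j) (by
        rw [le_principal_iff, Ultrafilter.mem_coe, Ultrafilter.mem_map]
        exact univ_mem' hb)
    exact ⟨z, hz⟩
  choose K hK using hlim
  refine ⟨K, Matrix.PosSemidef.of_tendsto hZ hK, fun s t => ?_, fun i => ?_⟩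
  · refine tendsto_nhds_unique (hK _ _) (Tendsto.congr' ?_ tendsto_const_nhds)
    filter_upwards [hl (mem_atTop {s, t})] with F hF
    exact (hZΦ F s (hF (by simp)) t (hF (by simp))).symm
  · exact le_of_tendsto' ((Complex.continuous_re.tendsto _).comp (hK i i)) fun F => hZD F i

/-- Grothendieck's factorization of Schur multipliers. -/
theorem NuclearLE.exists_inner [Nonempty X]
    (hΦ : ∀ (F : Finset X) (u v : X → ℂ), ∑ s ∈ F, ‖u s‖ ^ 2 ≤ 1 → ∑ s ∈ F, ‖v s‖ ^ 2 ≤ 1 →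
      NuclearLE F (fun s t => Φ (s, t) * (u s * conj (v t))) C) (hD : C < D) :
    ∃ (H : Type) (_ : NormedAddCommGroup H) (_ : InnerProductSpace ℂ H) (_ : CompleteSpace H)
      (x y : X → H), (∀ s t, inner ℂ (x s) (y t) = Φ (s, t)) ∧ (∀ s, ‖x s‖ ^ 2 ≤ D) ∧
        ∀ t, ‖y t‖ ^ 2 ≤ D := by
  obtain ⟨Z, hZ, hZΦ, hZD⟩ := NuclearLE.exists_posSemidef hΦ hD
  obtain ⟨H, i1, i2, i3, x, hx⟩ := hZ.exists_inner
  have hn : ∀ i, ‖x i‖ ^ 2 ≤ D := fun i => by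
    rw [← inner_self_eq_norm_sq (𝕜 := ℂ), hx]
    exact hZD i
  exact ⟨H, i1, i2, i3, fun s => x (.inl s), fun t => x (.inr t), fun s t => by rw [hx, hZΦ],
    fun s => hn _, fun t => hn _⟩

end Factorization

/-! ### Analytic Schur multipliers belong to the Haagerup tensor product -/

section Hilbert

variable {H : Type*} [NormedAddCommGroup H] [InnerProductSpace ℂ H]

/-- The weak barycenter of a bounded function with values in a Hilbert space. -/
theorem exists_barycenter [CompleteSpace H] {S : Type*} [MeasurableSpace S] (μ : Measure S)
    [IsProbabilityMeasure μ]
    {x : S → H} {R : ℝ} (hR : ∀ s, ‖x s‖ ≤ R) :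
    ∃ X : H, ‖X‖ ≤ R ∧ ∀ h, AEStronglyMeasurable (fun s => inner ℂ (x s) h) μ →
      inner ℂ X h = ∫ s, inner ℂ (x s) h ∂μ := by
  have hR0 : 0 ≤ R := by
    obtain ⟨s⟩ := μ.nonempty_of_neZero
    exact (norm_nonneg _).trans (hR s)
  have hb : ∀ h s, ‖inner ℂ (x s) h‖ ≤ R * ‖h‖ := fun h s =>
    (norm_inner_le_norm _ _).trans (by gcongr; exact hR s)
  have hi : ∀ h, AEStronglyMeasurable (fun s => inner ℂ (x s) h) μ →
      Integrable (fun s => inner ℂ (x s) h) μ := fun h hh =>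
    Integrable.of_bound hh (R * ‖h‖) (Eventually.of_forall (hb h))
  -- The function `x` is not assumed measurable: the factorization vectors come from a compactness
  -- argument. The integral is therefore defined only on the subspace of those `h` for which the
  -- pairing is measurable.
  let V : Submodule ℂ H :=
    { carrier := {h | AEStronglyMeasurable (fun s => inner ℂ (x s) h) μ}
      zero_mem' := by simpa using aestronglyMeasurable_const
      add_mem' := fun {a b} ha hb => by
        simp only [Set.mem_ofPred_eq, inner_add_right]
        exact ha.add hb
      smul_mem' := fun c a ha => by
        simpa only [Set.mem_ofPred_eq, inner_smul_right] using ha.const_mul c }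
  let L : V →ₗ[ℂ] ℂ :=
    { toFun := fun h => ∫ s, inner ℂ (x s) (h : H) ∂μ
      map_add' := fun a b => by
        simp only [Submodule.coe_add, inner_add_right]
        exact integral_add (hi _ a.2) (hi _ b.2)
      map_smul' := fun c a => by
        simp only [Submodule.coe_smul, inner_smul_right, RingHom.id_apply, smul_eq_mul]
        exact integral_const_mul c _ }
  have hL : ∀ h, ‖L h‖ ≤ R * ‖h‖ := fun h => by
    have := norm_integral_le_of_norm_le_const (μ := μ) (Eventually.of_forall (hb h))
    simp only [probReal_univ, mul_one] at this
    exact this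
  -- A norm-preserving extension to all of `H` keeps the bound `R` for the representing vector.
  obtain ⟨g, hg1, hg2⟩ := exists_extension_norm_eq V (L.mkContinuous R hL)
  refine ⟨(InnerProductSpace.toDual ℂ H).symm g, ?_, fun h hh => ?_⟩
  · rw [LinearIsometryEquiv.norm_map, hg2]
    exact L.mkContinuous_norm_le hR0 hL
  · rw [InnerProductSpace.toDual_symm_apply]
    exact hg1 ⟨h, hh⟩

/-- Distinct vectors are at distance `√2`, so the balls of radius `1 / 2` around them are disjoint.
-/
theorem Orthonormal.countable [TopologicalSpace.SeparableSpace H] {ι : Type*} {v : ι → H}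
    (hv : Orthonormal ℂ v) :
    Countable ι := by
  refine Pairwise.countable_of_isOpen_disjoint (s := fun i => ball (v i) (1 / 2))
    (fun i j hij => ball_disjoint_ball ?_) (fun i => isOpen_ball)
    fun i => ⟨v i, mem_ball_self (by norm_num)⟩
  have h1 : ‖v i - v j‖ ^ 2 = 2 := by
    rw [norm_sub_sq (𝕜 := ℂ), hv.1, hv.1, hv.2 hij]
    norm_num
  rw [dist_eq_norm]
  nlinarith [norm_nonneg (v i - v j)]

/-- An orthonormal basis of a separable subspace, indexed by the natural numbers and possibly
completed by zeros. -/
theorem Submodule.exists_seq_hilbertBasis (V : Submodule ℂ H) [CompleteSpace V]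
    [TopologicalSpace.SeparableSpace V] :
    ∃ e : ℕ → H, (∀ n, e n ∈ V) ∧
      (∀ v ∈ V, ∀ w, HasSum (fun n => inner ℂ v (e n) * inner ℂ (e n) w) (inner ℂ v w)) ∧
      ∀ v, (Summable fun n => ‖inner ℂ (e n) v‖ ^ 2) ∧ ∑' n, ‖inner ℂ (e n) v‖ ^ 2 ≤ ‖v‖ ^ 2 := by
  obtain ⟨W, b, -⟩ := exists_hilbertBasis ℂ V
  have := b.orthonormal.countable
  obtain ⟨f, hf⟩ := exists_injective_nat W
  let e : ℕ → H := Function.extend f (fun i => (b i : H)) 0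
  have he : ∀ i, e (f i) = b i := fun i => hf.extend_apply _ _ _
  have he0 : ∀ n ∉ Set.range f, e n = 0 := fun n hn => Function.extend_apply' _ _ _ hn
  refine ⟨e, fun n => ?_, fun v hv w => ?_, fun v => ?_⟩
  · by_cases hn : n ∈ Set.range f
    · obtain ⟨i, rfl⟩ := hn
      rw [he]
      exact (b i).2
    · rw [he0 n hn]
      exact V.zero_mem
  · refine (hf.hasSum_iff fun n hn => by simp [he0 n hn]).1 ?_
    have h1 := ((b.hasSum_repr ⟨v, hv⟩).mapL V.subtypeL).mapL (innerSL ℂ w)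
    have h2 := h1.star
    simp only [innerSL_apply_apply, Submodule.subtypeL_apply, RCLike.star_def,
      inner_conj_symm, map_smul] at h2
    refine h2.congr_fun fun i => ?_
    rw [Function.comp_apply, he, b.repr_apply_apply, smul_eq_mul, map_mul, inner_conj_symm,
      inner_conj_symm]
    rfl
  · have ho : Orthonormal ℂ fun i => (b i : H) := b.orthonormal.comp_linearIsometry V.subtypeₗᵢ
    have h1 : HasSum (fun n => ‖inner ℂ (e n) v‖ ^ 2) (∑' i, ‖inner ℂ (b i : H) v‖ ^ 2) := by
      refine (hf.hasSum_iff fun n hn => by simp [he0 n hn]).1 ?_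
      refine (ho.inner_products_summable (x := v)).hasSum.congr_fun fun i => ?_
      rw [Function.comp_apply, he]
    exact ⟨h1.summable, h1.tsum_eq.trans_le (ho.tsum_inner_products_le (x := v))⟩

end Hilbert

namespace HInfRDisc

/-- Membership in `H^∞_r` passes from a generating family to the closed linear span. -/
theorem mem_of_mem_closure_span {H : Type*} [NormedAddCommGroup H] [NormedSpace ℂ H]
    {g : H → ClosedDisc → ℂ} {R : ℝ} {σ : ℂ → ℂ} (hadd : ∀ a b, g (a + b) = g a + g b)
    (hsmul : ∀ c a, g (c • a) = σ c • g a) (hb : ∀ a z, ‖g a z‖ ≤ R * ‖a‖) {ι : Type*} {y : ι → H}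
    (hy : ∀ i, g (y i) ∈ HInfRDisc) {h : H}
    (hh : h ∈ (Submodule.span ℂ (Set.range y)).topologicalClosure) : g h ∈ HInfRDisc := by
  have hzero : g 0 = 0 := by
    have := hadd 0 0
    simpa using this
  have hsub : ∀ a b z, g a z - g b z = g (a - b) z := fun a b z => by
    have := congrFun (hadd (a - b) b) z
    rw [sub_add_cancel, Pi.add_apply] at this
    rw [this, add_sub_cancel_right]
  let S : Submodule ℂ H :=
    { carrier := {a | g a ∈ HInfRDisc}
      zero_mem' := by simpa only [Set.mem_ofPred_eq, hzero] using zero_mem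
      add_mem' := fun {a b} ha hb => by
        simpa only [Set.mem_ofPred_eq, hadd] using add_mem ha hb
      smul_mem' := fun c a ha => by
        simpa only [Set.mem_ofPred_eq, hsmul] using smul_mem ha (σ c) }
  have hS : IsClosed (S : Set H) := by
    refine IsSeqClosed.isClosed fun a b ha hab => ?_
    refine of_tendstoUniformly ha ?_
    have ht : Tendsto (fun n => R * ‖b - a n‖) atTop (𝓝 0) := by
      have := ((tendsto_const_nhds (x := b)).sub hab).norm.const_mul R
      simpa using this
    rw [Metric.tendstoUniformly_iff]
    intro ε hε
    filter_upwards [ht.eventually_lt_const hε] with n hn z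
    rw [dist_eq_norm, hsub]
    exact (hb _ _).trans_lt hn
  have hle : Submodule.span ℂ (Set.range y) ≤ S := by
    rw [Submodule.span_le]
    rintro _ ⟨i, rfl⟩
    exact hy i
  exact Submodule.topologicalClosure_minimal _ hle hS hh

/-- A countable uniqueness set for `H^∞_r`. -/
theorem exists_uniqueness_seq :
    ∃ d : ℕ → ClosedDisc, ∀ f ∈ HInfRDisc, (∀ n, f (d n) = 0) → ∀ z, f z = 0 := by
  have : Nonempty (ball (0 : ℂ) 1) := ⟨⟨0, by simp⟩⟩
  refine ⟨fun n => ⟨TopologicalSpace.denseSeq (ball (0 : ℂ) 1) n,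
    ball_subset_closedBall (Subtype.mem _)⟩,
    fun f hf h0 z => ?_⟩
  have hc : Continuous fun z : ball (0 : ℂ) 1 => discExt f z :=
    continuousOn_iff_continuous_domRestrict.1 hf.1.continuousOn
  have h1 : (fun z : ball (0 : ℂ) 1 => discExt f z) = fun _ => 0 := by
    refine hc.ext_on (TopologicalSpace.denseRange_denseSeq _) continuous_const ?_
    rintro _ ⟨n, rfl⟩
    simp only [discExt_of_mem f (ball_subset_closedBall (Subtype.mem _))]
    exact h0 n
  refine tendsto_nhds_unique (tendsto_shrink hf z) (Tendsto.congr' ?_ tendsto_const_nhds)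
  filter_upwards [eventually_mem_Ico] with r hr
  have := congrFun h1 ⟨shrink r z, shrink_mem_ball hr z⟩
  simp only [discExt_coe] at this
  exact this.symm

end HInfRDisc

section Factorization

variable {H : Type*} [NormedAddCommGroup H] [InnerProductSpace ℂ H] [CompleteSpace H]
  {Φ : ClosedDisc × ClosedDisc → ℂ} {R : ℝ}

/-- A factorization on the torus extends to the closed bidisc. -/
theorem HInfRBidisc.exists_extension (hΦ : Φ ∈ HInfRBidisc) {x y : UnitCircle → H}
    (hxy : ∀ s t, inner ℂ (x s) (y t) = Φ (circleToDisc s, circleToDisc t))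
    (hx : ∀ s, ‖x s‖ ≤ R) (hy : ∀ t, ‖y t‖ ≤ R) :
    ∃ X Y : ClosedDisc → H, (∀ z w, inner ℂ (X z) (Y w) = Φ (z, w)) ∧ (∀ z, ‖X z‖ ≤ R) ∧
      ∀ w, ‖Y w‖ ≤ R := by
  choose μ hμ hμf using HInfRDisc.exists_representing_measure
  choose X hXR hX using fun z => exists_barycenter (μ z) hx
  choose Y hYR hY using fun w => exists_barycenter (μ w) hy
  -- The pairings with `y t` are boundary values of a slice of `Φ`, hence measurable, and `μ z`
  -- reproduces the slice at `z`.
  have h1 : ∀ z t, inner ℂ (X z) (y t) = Φ (z, circleToDisc t) := fun z t => by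
    have hm := left_mem hΦ (circleToDisc t)
    rw [hX z _ (by simpa only [hxy] using (HInfRDisc.measurable_circle hm).aestronglyMeasurable)]
    simp only [hxy]
    exact hμf z _ hm
  refine ⟨X, Y, fun z w => ?_, hXR, hYR⟩
  -- For the second barycenter the test vector is `X z`; by `h1` its pairings with `y` are the
  -- conjugates of the other slice of `Φ`.
  have h2 : ∀ t, inner ℂ (y t) (X z) = conj (Φ (z, circleToDisc t)) := fun t => by
    rw [← h1, inner_conj_symm]
  have hm := right_mem hΦ z
  rw [← inner_conj_symm, hY w _ (by
    simp only [h2]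
    exact (Complex.continuous_conj.measurable.comp
      (HInfRDisc.measurable_circle hm)).aestronglyMeasurable)]
  simp only [h2]
  rw [integral_conj, Complex.conj_conj]
  exact hμf w _ hm

/-- The inner product is expanded in an orthonormal basis `e`, and both `(X z, e n)` and `(e n, Y
w)` must be in `H^∞_r`. The first holds on the closed span `V` of the vectors `Y w`, since `(X z, Y
w)` is a slice of `Φ`. The second holds on the closed span `V'` of countably many projected vectors
`x (d n)`. So `e` is taken in `V'`, which lies in `V`, is separable, and contains every `x z`. -/
theorem HInfRBidisc.exists_isHaagerupRep (hΦ : Φ ∈ HInfRBidisc) {X Y : ClosedDisc → H}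
    (hXY : ∀ z w, inner ℂ (X z) (Y w) = Φ (z, w)) (hX : ∀ z, ‖X z‖ ≤ R) (hY : ∀ w, ‖Y w‖ ≤ R) :
    ∃ φ ψ, IsHaagerupRep HInfRDisc HInfRDisc Φ φ ψ ∧ squareFunctionNorm φ ≤ ENNReal.ofReal R ∧
      squareFunctionNorm ψ ≤ ENNReal.ofReal R := by
  have hR0 : 0 ≤ R := (norm_nonneg _).trans (hX ⟨0, by simp⟩)
  let V := (Submodule.span ℂ (Set.range Y)).topologicalClosure
  have hVc : CompleteSpace V := (Submodule.isClosed_topologicalClosure _).completeSpace_coe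
  have hVX : ∀ h ∈ V, (fun z => inner ℂ (X z) h) ∈ HInfRDisc := fun h hh =>
    HInfRDisc.mem_of_mem_closure_span (g := fun h z => inner ℂ (X z) h) (R := R) (σ := id)
      (fun a b => funext fun z => inner_add_right _ _ _)
      (fun c a => funext fun z => inner_smul_right _ _ _)
      (fun a z => (norm_inner_le_norm _ _).trans (by gcongr; exact hX z))
      (fun w => by simpa only [hXY] using left_mem hΦ w) hh
  -- Projecting `X` onto `V` changes none of its pairings with `Y`, and makes it possible to have
  -- one subspace that serves both variables.
  let x : ClosedDisc → H := fun z => V.starProjection (X z)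
  have hxV : ∀ z, x z ∈ V := fun z => V.starProjection_apply_mem _
  have hx : ∀ z, ∀ h ∈ V, inner ℂ (x z) h = inner ℂ (X z) h := fun z h hh => by
    have := V.starProjection_inner_eq_zero (X z) h hh
    rw [inner_sub_left, sub_eq_zero] at this
    exact this.symm
  have hYV : ∀ w, Y w ∈ V := fun w =>
    Submodule.le_topologicalClosure _ (Submodule.subset_span ⟨w, rfl⟩)
  obtain ⟨d, hd⟩ := HInfRDisc.exists_uniqueness_seq
  let V' := (Submodule.span ℂ (Set.range fun n => x (d n))).topologicalClosure
  have hVc' : CompleteSpace V' := (Submodule.isClosed_topologicalClosure _).completeSpace_coe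
  have hVV' : V' ≤ V := by
    refine Submodule.topologicalClosure_minimal _ ?_ (Submodule.isClosed_topologicalClosure _)
    rw [Submodule.span_le]
    rintro _ ⟨n, rfl⟩
    exact hxV _
  have hsep : TopologicalSpace.SeparableSpace V' := by
    have h1 : TopologicalSpace.IsSeparable (Set.range fun n => x (d n)) :=
      (Set.countable_range _).isSeparable
    exact (h1.span (R := ℂ)).closure.separableSpace
  -- Let `h` be the component of `x z` orthogonal to `V'`. It lies in `V`, so its pairing with `X`
  -- is in `H^∞_r`; that function vanishes at all `d n`, hence everywhere, and therefore `(h, h) =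
  -- 0`.
  have hxV' : ∀ z, x z ∈ V' := by
    intro z
    set h := x z - V'.starProjection (x z) with hh
    have hhV : h ∈ V := V.sub_mem (hxV z) (hVV' (V'.starProjection_apply_mem _))
    have h0 : ∀ v ∈ V', inner ℂ h v = 0 := fun v hv => V'.starProjection_inner_eq_zero _ _ hv
    have h1 : inner ℂ (X z) h = 0 := hd _ (hVX h hhV) (fun n => by
      rw [← hx _ h hhV, ← inner_conj_symm, h0 _ (Submodule.le_topologicalClosure _
        (Submodule.subset_span ⟨n, rfl⟩)), map_zero]) z
    rw [← hx _ h hhV] at h1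
    have h2 : inner ℂ h h = 0 := by
      conv_lhs => rw [hh]
      rw [inner_sub_left, h1, ← inner_conj_symm, h0 _ (V'.starProjection_apply_mem _), map_zero,
        sub_zero]
    rw [inner_self_eq_zero, sub_eq_zero] at h2
    rw [h2]
    exact V'.starProjection_apply_mem _
  have hVY : ∀ h ∈ V', (fun w => inner ℂ h (Y w)) ∈ HInfRDisc := fun h hh =>
    HInfRDisc.mem_of_mem_closure_span (g := fun h w => inner ℂ h (Y w)) (R := R)
      -- The pairing is conjugate-linear in its first argument.
      (σ := starRingEnd ℂ)
      (fun a b => funext fun z => inner_add_left _ _ _)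
      (fun c a => funext fun z => inner_smul_left _ _ _)
      (fun a z => (norm_inner_le_norm _ _).trans (by
        rw [mul_comm]; gcongr; exact hY z))
      (fun n => by
        simp only [hx _ _ (hYV _), hXY]
        exact right_mem hΦ (d n)) hh
  obtain ⟨e, heV, he, heB⟩ := V'.exists_seq_hilbertBasis
  have hφ : SquareSumLE (fun n z => inner ℂ (X z) (e n)) R := fun z => by
    have := heB (X z)
    simp only [norm_inner_symm (X z)]
    exact ⟨this.1, this.2.trans (by gcongr; exact hX z)⟩
  have hψ : SquareSumLE (fun n w => inner ℂ (e n) (Y w)) R := fun w =>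
    ⟨(heB (Y w)).1, (heB (Y w)).2.trans (by gcongr; exact hY w)⟩
  have hφ' := squareFunctionNorm_le hR0 hφ
  have hψ' := squareFunctionNorm_le hR0 hψ
  refine ⟨_, _, ⟨fun n => hVX _ (hVV' (heV n)), fun n => hVY _ (heV n), fun z w => ?_,
    hφ'.trans_lt ENNReal.ofReal_lt_top, hψ'.trans_lt ENNReal.ofReal_lt_top⟩, hφ', hψ'⟩
  have := he (x z) (hxV' z) (Y w)
  simp only [hx z _ (hVV' (heV _)), hx z _ (hYV w), hXY] at this
  exact this

end Factorization

/-- Nuclear estimates on the torus yield a Haagerup representation. -/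
theorem NuclearLE.exists_isHaagerupRep {Φ : ClosedDisc × ClosedDisc → ℂ} (hΦ : Φ ∈ HInfRBidisc)
    {C D : ℝ} (h : ∀ (F : Finset UnitCircle) (u v : UnitCircle → ℂ), ∑ s ∈ F, ‖u s‖ ^ 2 ≤ 1 →
      ∑ s ∈ F, ‖v s‖ ^ 2 ≤ 1 →
        NuclearLE F (fun s t => torusRestriction Φ (s, t) * (u s * conj (v t))) C) (hD : C < D) :
    ∃ φ ψ, IsHaagerupRep HInfRDisc HInfRDisc Φ φ ψ ∧
      squareFunctionNorm φ * squareFunctionNorm ψ ≤ ENNReal.ofReal D := by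
  have : Nonempty UnitCircle := ⟨⟨1, by simp⟩⟩
  obtain ⟨H, _, _, _, x, y, hxy, hx, hy⟩ := NuclearLE.exists_inner h hD
  obtain ⟨X, Y, hXY, hX, hY⟩ := HInfRBidisc.exists_extension hΦ (R := √D) hxy
    (fun s => Real.le_sqrt_of_sq_le (hx s)) (fun t => Real.le_sqrt_of_sq_le (hy t))
  obtain ⟨φ, ψ, hr, hφ, hψ⟩ := HInfRBidisc.exists_isHaagerupRep hΦ hXY hX hY
  refine ⟨φ, ψ, hr, (mul_le_mul' hφ hψ).trans_eq ?_⟩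
  have hD0 : 0 ≤ D := (sq_nonneg _).trans (hx ⟨1, by simp⟩)
  rw [← ENNReal.ofReal_mul (Real.sqrt_nonneg _), Real.mul_self_sqrt hD0]

theorem IsHaagerupRep.haagerupNorm_le {α β : Type*} {X : Set (α → ℂ)} {Y : Set (β → ℂ)}
    {Φ : α × β → ℂ} {φ : ℕ → α → ℂ} {ψ : ℕ → β → ℂ} (h : IsHaagerupRep X Y Φ φ ψ) :
    haagerupNorm X Y Φ ≤ squareFunctionNorm φ * squareFunctionNorm ψ :=
  iInf₂_le_of_le φ ψ (iInf_le _ h)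

/-- Finiteness of the multiplier norm is not known in advance, so the constant comes from the
gliding hump argument. -/
theorem mem_haagerup_of_mem_analyticSchurMultipliers {Φ : ClosedDisc × ClosedDisc → ℂ}
    (h : Φ ∈ analyticSchurMultipliers.{u}) : Φ ∈ haagerup HInfRDisc HInfRDisc := by
  obtain ⟨C, hC⟩ := exists_nuclearLE (h.2 _ (blockMeasure.{u} UnitCircle) (blockMeasure UnitCircle))
  obtain ⟨φ, ψ, hr, -⟩ := NuclearLE.exists_isHaagerupRep h.1 hC (lt_add_one C)
  exact ⟨φ, ψ, hr⟩

theorem haagerupNorm_le_analyticSchurNorm {Φ : ClosedDisc × ClosedDisc → ℂ}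
    (h : Φ ∈ analyticSchurMultipliers.{u}) :
    haagerupNorm HInfRDisc HInfRDisc Φ ≤ analyticSchurNorm.{u} Φ := by
  refine le_of_forall_gt fun c hc => ?_
  -- Two intermediate values are needed: `b` makes the bound on the multiplier norm strict, and `b'`
  -- leaves the room `C < D` consumed by the Hahn-Banach step.
  obtain ⟨b, hb1, hb2⟩ := exists_between hc
  obtain ⟨b', hb1', hb2'⟩ := exists_between hb2
  have hbt : b ≠ ∞ := hb2.ne_top
  have hbt' : b' ≠ ∞ := hb2'.ne_top
  have hS : schurNorm (blockMeasure.{u} UnitCircle) (blockMeasure.{u} UnitCircle)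
      (torusRestriction Φ) < ENNReal.ofReal b.toReal := by
    rw [ENNReal.ofReal_toReal hbt]
    refine lt_of_le_of_lt ?_ hb1
    exact le_iSup_of_le _ (le_iSup_of_le _ (le_iSup_of_le _ (le_iSup_of_le _
      (le_iSup₂_of_le (blockMeasure.{u} UnitCircle) (blockMeasure.{u} UnitCircle) le_rfl))))
  obtain ⟨φ, ψ, hr, hle⟩ := NuclearLE.exists_isHaagerupRep h.1
    (nuclearLE_of_schurNorm_lt (h.2 _ (blockMeasure.{u} UnitCircle) (blockMeasure UnitCircle)) hS)
    ((ENNReal.toReal_lt_toReal hbt hbt').2 hb1')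
  rw [ENNReal.ofReal_toReal hbt'] at hle
  exact (hr.haagerupNorm_le.trans hle).trans_lt hb2'
/-- The analytic Schur multipliers on the bidisc are exactly the elements of the Haagerup tensor
square of `H^∞_r(𝔻)`, and the two norms coincide. -/
theorem theorem4p3 :
    analyticSchurMultipliers.{u} = haagerup HInfRDisc HInfRDisc ∧
      ∀ Φ ∈ analyticSchurMultipliers.{u},
        haagerupNorm HInfRDisc HInfRDisc Φ = analyticSchurNorm.{u} Φ := by
  refine ⟨Set.Subset.antisymm (fun Φ h => mem_haagerup_of_mem_analyticSchurMultipliers h) ?_,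
    fun Φ h => le_antisymm (haagerupNorm_le_analyticSchurNorm h) ?_⟩
  · rintro Φ ⟨φ, ψ, h⟩
    exact h.mem_analyticSchurMultipliers
  · exact le_iInf fun φ => le_iInf fun ψ => le_iInf fun h => h.analyticSchurNorm_le
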